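/- Let $\Omega, A, Z, X, Y$ be finite sets ($A$, $X$ nonempty), and write $\Delta(S)$ for the set of probability distributions on a finite set $S$. For every type $z\in Z$ let $\mu(\cdot|z)\in\Delta(\Omega)$ be a prior and let $u_i(\cdot,\cdot,z):\Omega\times A\to\mathbb R$, $i=S,R$, be the payoff functions of a sender $S$ and a receiver $R$. Let $Q:X\to\Delta(Y)$ be a channel. For $q\in\Delta(S)$ let $H(q)=-\sum_s q(s)\log_2 q(s)$, with $0\log_2 0=0$, and let $C(Q)=\max_{p\in\Delta(X)}\big[H\big(\sum_x p(x)Q(\cdot|x)\big)-\sum_x p(x)H(Q(\cdot|x))\big]$ be the capacity of $Q$. For integers $n\ge1$, $k\ge0$ and $z^n\in Z^n$, set $\mu^n(\omega^n|z^n)=\prod_{t=1}^n\mu(\omega_t|z_t)$, $Q^k(y^k|x^k)=\prod_{t=1}^kQ(y_t|x_t)$ and $\bar u_i(\omega^n,a^n)=\frac1n\sum_{t=1}^n u_i(\omega_t,a_t,z_t)$. A strategy of the sender is a map $\sigma:\Omega^n\to\Delta(X^k)$; the set $BR(\sigma)$ of best replies consists of the maps $\tau:Y^k\to A^n$ such that,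 for every $y^k$, $\tau(y^k)$ maximizes $\sum_{\omega^n,x^k}\mu^n(\omega^n|z^n)\sigma(x^k|\omega^n)Q^k(y^k|x^k)\bar u_R(\omega^n,a^n)$ over $a^n\in A^n$. The optimal robust payoff of the sender is $$U^*_S(\mu^n,Q^k,z^n)=\sup_\sigma\min_{\tau\in BR(\sigma)}\sum_{\omega^n,x^k,y^k}\mu^n(\omega^n|z^n)\sigma(x^k|\omega^n)Q^k(y^k|x^k)\,\bar u_S(\omega^n,\tau(y^k)).$$ For $\nu\in\Delta(\Omega)$ let $A^{*z}(\nu)=\operatorname{argmax}_{a\in A}\sum_\omega\nu(\omega)u_R(\omega,a,z)$ and $u^{*z}_S(\nu)=\min_{a\in A^{*z}(\nu)}\sum_\omega\nu(\omega)u_S(\omega,a,z)$. For $\pi\in\Delta(Z)$ and $c\in[0,+\infty]$ let $$V^Z(\mu,c,\pi)=\sup\ \sum_z\pi(z)\sum_m\lambda^z_m\,u^{*z}_S(\nu^z_m),$$ where the supremum is over all choices, for every $z\in Z$, of a finite family $(\lambda^z_m,\nu^z_m)_m$ with $\nu^z_m\in\Delta(\Omega)$, $\lambda^z_m\ge0$,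 $\sum_m\lambda^z_m=1$ and $\sum_m\lambda^z_m\nu^z_m=\mu(\cdot|z)$, subject to $$\sum_z\pi(z)\Big(H(\mu(\cdot|z))-\sum_m\lambda^z_mH(\nu^z_m)\Big)\le c.$$ For $z^n\in Z^n$ let $\pi_n(z)=\frac1n|\{t:z_t=z\}|$ be its empirical frequency. Then: 1. For all integers $n\ge1$, $k\ge0$ and all $z^n\in Z^n$, $$U^*_S(\mu^n,Q^k,z^n)\le V^Z\Big(\mu,\frac kn C(Q),\pi_n\Big).$$ 2. Let $\pi\in\Delta(Z)$ and $r\in[0,+\infty]$. If $r=0$ and $C(Q)>0$, assume in addition that for every $z$ with $\pi(z)>0$ the function $u^{*z}_S$, restricted to the beliefs $\nu\in\Delta(\Omega)$ whose support is contained in that of $\mu(\cdot|z)$, is continuous at $\mu(\cdot|z)$. Then for all sequences of integers $k_j\ge0$, $n_j\ge1$ and all $z^{n_j}\in Z^{n_j}$ such that $\max(n_j,k_j)\to\infty$, $k_j/n_j\to r$ and $\pi_{n_j}\to\pi$ as $j\to\infty$, $$\lim_{j\to\infty}U^*_S(\mu^{n_j},Q^{k_j},z^{n_j})=V^Z\big(\mu,rC(Q),\pi\big),$$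 with the convention $(+\infty)\cdot0=0$. -/

import Mathlib

open Filter Topology
open scoped ENNReal

noncomputable section

/-! Probability distributions on a finite set `S` are the elements of `stdSimplex ℝ S`. -/

namespace Persuasion

variable {Ω A Z X Y : Type*} [Fintype Ω] [Fintype A] [Fintype Z] [Fintype X] [Fintype Y]

/-- Shannon entropy in base `2` (`Real.logb 2 0 = 0`, so `0 log 0 = 0`). -/
def entropy {S : Type*} [Fintype S] (q : S → ℝ) : ℝ :=
  -∑ s, q s * Real.logb 2 (q s)

/-- Mutual information between the input, drawn from `p`, and the output of the channel `Q`. -/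
def mutualInfo (Q : X → Y → ℝ) (p : X → ℝ) : ℝ :=
  entropy (fun y => ∑ x, p x * Q x y) - ∑ x, p x * entropy (Q x)

/-- Capacity of the channel `Q`: the maximum over input distributions of the mutual information. -/
def capacity (Q : X → Y → ℝ) : ℝ :=
  sSup (mutualInfo Q '' stdSimplex ℝ X)

/-! ### The game with `n` problems of types `z 0, …, z (n - 1)` and `k` uses of the channel -/

/-- Distribution of the sequence of states given the sequence of types. -/
def seqPrior {n : ℕ} (μ : Z → Ω → ℝ) (z : Fin n → Z) (ω : Fin n → Ω) : ℝ :=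
  ∏ t, μ (z t) (ω t)

/-- The memoryless channel `Q` used `k` times. -/
def seqChannel {k : ℕ} (Q : X → Y → ℝ) (x : Fin k → X) (y : Fin k → Y) : ℝ :=
  ∏ t, Q (x t) (y t)

/-- Average payoff over the `n` problems. -/
def avgPayoff {n : ℕ} (u : Ω → A → Z → ℝ) (z : Fin n → Z) (ω : Fin n → Ω) (a : Fin n → A) : ℝ :=
  (1 / (n : ℝ)) * ∑ t, u (ω t) (a t) (z t)

/-- Strategies of the sender: `σ ω x` is the probability of the inputs `x` at the states `ω`. -/
def senderStrategies (Ω X : Type*) [Fintype X] (n k : ℕ) :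
    Set ((Fin n → Ω) → (Fin k → X) → ℝ) :=
  {σ | ∀ ω, σ ω ∈ stdSimplex ℝ (Fin k → X)}

/-- Strategies `τ` of the receiver that are best replies to `σ`: for every output sequence `y`,
the actions `τ y` maximize the receiver's expected average payoff. -/
def bestReplies {n k : ℕ} (uR : Ω → A → Z → ℝ) (μ : Z → Ω → ℝ) (Q : X → Y → ℝ) (z : Fin n → Z)
    (σ : (Fin n → Ω) → (Fin k → X) → ℝ) : Set ((Fin k → Y) → (Fin n → A)) :=
  {τ | ∀ y, ∀ a : Fin n → A,
    ∑ ω, ∑ x, seqPrior μ z ω * σ ω x * seqChannel Q x y * avgPayoff uR z ω a ≤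
      ∑ ω, ∑ x, seqPrior μ z ω * σ ω x * seqChannel Q x y * avgPayoff uR z ω (τ y)}

/-- Expected average payoff of the sender at the strategies `σ` and `τ`. -/
def senderPayoff {n k : ℕ} (uS : Ω → A → Z → ℝ) (μ : Z → Ω → ℝ) (Q : X → Y → ℝ) (z : Fin n → Z)
    (σ : (Fin n → Ω) → (Fin k → X) → ℝ) (τ : (Fin k → Y) → (Fin n → A)) : ℝ :=
  ∑ ω, ∑ x, ∑ y, seqPrior μ z ω * σ ω x * seqChannel Q x y * avgPayoff uS z ω (τ y)

/-- Optimal robust payoff of the sender: supremum over the strategies `σ` of the minimum over the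
(finite, nonempty) set of best replies of the receiver. -/
def optimalRobustPayoff {n : ℕ} (uS uR : Ω → A → Z → ℝ) (μ : Z → Ω → ℝ) (Q : X → Y → ℝ)
    (k : ℕ) (z : Fin n → Z) : ℝ :=
  sSup ((fun σ => sInf (senderPayoff uS μ Q z σ '' bestReplies uR μ Q z σ)) ''
    senderStrategies Ω X n k)

/-! ### The optimal splitting problem -/

/-- Optimal actions of the receiver at the belief `ν` in a problem of type `z`. -/
def optActions (uR : Ω → A → Z → ℝ) (z : Z) (ν : Ω → ℝ) : Set A :=
  {a | ∀ b, ∑ ω, ν ω * uR ω b z ≤ ∑ ω, ν ω * uR ω a z}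

/-- Robust payoff of the sender at the belief `ν` in a problem of type `z`: the minimum of the
sender's payoff over the (finite, nonempty) set of optimal actions of the receiver. -/
def robustPayoff (uS uR : Ω → A → Z → ℝ) (z : Z) (ν : Ω → ℝ) : ℝ :=
  sInf ((fun a => ∑ ω, ν ω * uS ω a z) '' optActions uR z ν)

/-- A splitting of the belief `p`: a finite convex combination of beliefs that equals `p`. -/
structure Splitting (p : Ω → ℝ) where
  card : ℕ
  weight : Fin card → ℝ
  posterior : Fin card → Ω → ℝ
  weight_mem : weight ∈ stdSimplex ℝ (Fin card)
  posterior_mem : ∀ m, posterior m ∈ stdSimplex ℝ Ω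
  sum_eq : ∑ m, weight m • posterior m = p

/-- Mutual information of a splitting (expected reduction of entropy). -/
def Splitting.info {p : Ω → ℝ} (s : Splitting p) : ℝ :=
  entropy p - ∑ m, s.weight m * entropy (s.posterior m)

/-- Value of the optimal splitting problem with information constraint `c ∈ [0, ∞]`. -/
def splittingValue (uS uR : Ω → A → Z → ℝ) (μ : Z → Ω → ℝ) (c : ℝ≥0∞) (π : Z → ℝ) : ℝ :=
  sSup {v | ∃ s : (z : Z) → Splitting (μ z),
    ((∑ z, π z * (s z).info : ℝ) : EReal) ≤ (c : EReal) ∧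
    v = ∑ z, π z * ∑ m, (s z).weight m * robustPayoff uS uR z ((s z).posterior m)}

/-- Empirical frequency of the types in the sequence `z`. -/
def empFreq {n : ℕ} (z : Fin n → Z) (z₀ : Z) : ℝ :=
  (Nat.card {t : Fin n // z t = z₀} : ℝ) / n

end Persuasion

end

/-! Upper bound. Payoffs are additive over the problems, so a best reply is optimal problem by
problem at the marginal belief on each state, and breaking ties against the sender gives exactly the
robust payoffs at these beliefs. Grouped by type, the beliefs split the priors with frequencies
`empFreq`. The divergences of the marginals add up to at most the divergence of the joint law
(`sum_marg_mul_log_le`), and data processing with memorylessness bounds the latter by `k` capacities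
(`sum_marg_jointLaw_mul_log_le`), so the splittings are feasible.

Lower bound. At capacity zero the sender reveals nothing (`sum_robustPayoff_prior_le`). At infinite
capacity per problem all messages of a splitting can be transmitted
(`le_optimalRobustPayoff_of_code`). In between, source and channel coding are combined: a codebook
whose size is about the exponential of the total information contains a typical message sequence for
most state sequences (`exists_typical_cover`), and its index is sent with a Feinstein code
(`exists_code`). The resulting beliefs are not the prescribed posteriors, but `sum_marg_mul_log_le`,
now with the posteriors as factors, bounds the sum of the divergences between them by a small
multiple of `n`, and Pinsker's inequality makes the beliefs close on average
(`le_optimalRobustPayoff_of_cover`). Closeness suffices although the receiver's actions jump: at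
beliefs near a posterior, every optimal action gives the sender the robust payoff up to a linear
error (`exists_lowerBoundAt`).

Limit. Mixing with the prior scales information down linearly at a small cost in payoff. This gives
continuity of the value at positive capacities, and strict slack and common supports for the coding
(`exists_perturbed_family`). At capacity zero upper semicontinuity can fail; under the continuity
hypothesis, posteriors far from the prior are paid for by their information
(`exists_splittingValue_le_add`). -/

namespace Persuasion

open scoped Classical

set_option linter.unusedSectionVars false

/-! ### Divergence, Hellinger distance and Pinsker's inequality -/

section Divergence

/-- Pointwise lower bound of the divergence by the squared Hellinger distance. -/
lemma sq_sqrt_sub_sqrt_le {p q : ℝ} (hp : 0 ≤ p) (hq : 0 ≤ q) (h : q = 0 → p = 0) :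
    (√p - √q) ^ 2 ≤ p * Real.log (p / q) - p + q := by
  rcases hp.eq_or_lt with rfl | hp
  · simp [Real.sq_sqrt hq]
  have hq : 0 < q := lt_of_le_of_ne hq fun hq0 => hp.ne' (h hq0.symm)
  have hsp := Real.sqrt_pos.2 hp
  have hsq := Real.sqrt_pos.2 hq
  -- Applying `log x ≤ x - 1` to the square root of the ratio, not to the ratio itself, leaves a
  -- perfect square as remainder.
  have h1 : Real.log (√q / √p) ≤ √q / √p - 1 := Real.log_le_sub_one_of_pos (by positivity)
  have h2 : Real.log (p / q) = -2 * Real.log (√q / √p) := by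
    rw [Real.log_div hsq.ne' hsp.ne', Real.log_div hp.ne' hq.ne', Real.log_sqrt hq.le,
      Real.log_sqrt hp.le]
    ring
  have h3 : p * (√q / √p) = √p * √q := by
    rw [mul_div_assoc', div_eq_iff hsp.ne']
    nlinarith [Real.mul_self_sqrt hp.le]
  have h4 : p * Real.log (√q / √p) ≤ p * (√q / √p - 1) := by gcongr
  rw [h2]
  nlinarith [Real.mul_self_sqrt hp.le, Real.mul_self_sqrt hq.le]

lemma sum_sq_sqrt_sub_sqrt_le {ι : Type*} [Fintype ι] {p q : ι → ℝ} (hp : ∀ i, 0 ≤ p i)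
    (hq : ∀ i, 0 ≤ q i) (h : ∀ i, q i = 0 → p i = 0) :
    ∑ i, (√(p i) - √(q i)) ^ 2 ≤ ∑ i, p i * Real.log (p i / q i) - ∑ i, p i + ∑ i, q i := by
  rw [← Finset.sum_sub_distrib, ← Finset.sum_add_distrib]
  exact Finset.sum_le_sum fun i _ => sq_sqrt_sub_sqrt_le (hp i) (hq i) (h i)

/-- Gibbs' inequality. -/
lemma sum_sub_sum_le_sum_mul_log {ι : Type*} [Fintype ι] {p q : ι → ℝ} (hp : ∀ i, 0 ≤ p i)
    (hq : ∀ i, 0 ≤ q i) (h : ∀ i, q i = 0 → p i = 0) :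
    ∑ i, p i - ∑ i, q i ≤ ∑ i, p i * Real.log (p i / q i) := by
  have h1 := sum_sq_sqrt_sub_sqrt_le hp hq h
  have h2 : 0 ≤ ∑ i, (√(p i) - √(q i)) ^ 2 := Finset.sum_nonneg fun i _ => sq_nonneg _
  linarith

/-- Factor the difference through the square roots and use Young's inequality. Leaving `θ` free
keeps the bound linear in the divergence, so that it can be summed over problems without any
concavity argument. -/
lemma abs_sub_le_sq_sqrt {a b θ : ℝ} (ha : 0 ≤ a) (hb : 0 ≤ b) (hθ : 0 < θ) :
    |a - b| ≤ 1 / (2 * θ) * (√a - √b) ^ 2 + θ * (a + b) := by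
  have h1 : |a - b| = |√a - √b| * (√a + √b) := by
    have : a - b = (√a - √b) * (√a + √b) := by
      nlinarith [Real.mul_self_sqrt ha, Real.mul_self_sqrt hb]
    rw [this, abs_mul, abs_of_nonneg (by positivity : (0 : ℝ) ≤ √a + √b)]
  rw [h1, ← sq_abs (√a - √b)]
  set x := |√a - √b|
  set y := √a + √b
  have hy : y ^ 2 ≤ 2 * (a + b) := by
    nlinarith [Real.mul_self_sqrt ha, Real.mul_self_sqrt hb, sq_nonneg (√a - √b)]
  have h2 : x * y ≤ 1 / (2 * θ) * x ^ 2 + θ / 2 * y ^ 2 := by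
    have : 1 / (2 * θ) * x ^ 2 + θ / 2 * y ^ 2 - x * y = 1 / (2 * θ) * (x - θ * y) ^ 2 := by
      field_simp
      ring
    have h3 : 0 ≤ 1 / (2 * θ) * (x - θ * y) ^ 2 := by positivity
    linarith
  nlinarith

/-- A form of Pinsker's inequality. -/
lemma sum_abs_sub_le {ι : Type*} [Fintype ι] {p q : ι → ℝ} {θ : ℝ} (hp : ∀ i, 0 ≤ p i)
    (hq : ∀ i, 0 ≤ q i) (h : ∀ i, q i = 0 → p i = 0) (hpq : ∑ i, q i = ∑ i, p i) (hθ : 0 < θ) :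
    ∑ i, |p i - q i| ≤
      1 / (2 * θ) * ∑ i, p i * Real.log (p i / q i) + 2 * θ * ∑ i, p i := by
  have h1 := sum_sq_sqrt_sub_sqrt_le hp hq h
  calc ∑ i, |p i - q i|
      ≤ ∑ i, (1 / (2 * θ) * (√(p i) - √(q i)) ^ 2 + θ * (p i + q i)) :=
        Finset.sum_le_sum fun i _ => abs_sub_le_sq_sqrt (hp i) (hq i) hθ
    _ = 1 / (2 * θ) * ∑ i, (√(p i) - √(q i)) ^ 2 + θ * (∑ i, p i + ∑ i, q i) := by
        rw [Finset.sum_add_distrib, ← Finset.mul_sum, ← Finset.mul_sum, Finset.sum_add_distrib]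
    _ ≤ 1 / (2 * θ) * ∑ i, p i * Real.log (p i / q i) + θ * (∑ i, p i + ∑ i, q i) := by
        have : ∑ i, (√(p i) - √(q i)) ^ 2 ≤ ∑ i, p i * Real.log (p i / q i) := by linarith
        gcongr 1 / (2 * θ) * ?_ + _
    _ = _ := by rw [hpq]; ring

end Divergence

/-! ### Moments and Chebyshev's inequality for product laws -/

section Products

variable {S : Type*} [Fintype S]

lemma sum_pi_prod {n : ℕ} (w : Fin n → S → ℝ) :
    ∑ s : Fin n → S, ∏ t, w t (s t) = ∏ t, ∑ a, w t a := by
  rw [Finset.prod_univ_sum, Fintype.piFinset_univ]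

lemma prod_mem_stdSimplex {n : ℕ} {w : Fin n → S → ℝ} (hw : ∀ t, w t ∈ stdSimplex ℝ S) :
    (fun s : Fin n → S => ∏ t, w t (s t)) ∈ stdSimplex ℝ (Fin n → S) :=
  ⟨fun s => Finset.prod_nonneg fun t _ => (hw t).1 _, by
    rw [sum_pi_prod]; exact Finset.prod_eq_one fun t _ => (hw t).2⟩

/-- Expectation of a function of one coordinate under a product distribution. -/
lemma sum_pi_prod_mul {n : ℕ} {w : Fin n → S → ℝ} (hw : ∀ t, ∑ a, w t a = 1) (t : Fin n)
    (f : S → ℝ) :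
    ∑ s : Fin n → S, (∏ u, w u (s u)) * f (s t) = ∑ a, w t a * f a := by
  have h := sum_pi_prod (fun u a => w u a * if u = t then f a else 1)
  calc ∑ s : Fin n → S, (∏ u, w u (s u)) * f (s t)
      = ∑ s : Fin n → S, ∏ u, w u (s u) * (if u = t then f (s u) else 1) := by
        refine Finset.sum_congr rfl fun s _ => ?_
        rw [Finset.prod_mul_distrib, Finset.prod_ite_eq' Finset.univ t fun u => f (s u)]
        simp
    _ = ∏ u, ∑ a, w u a * (if u = t then f a else 1) := h
    _ = ∑ a, w t a * f a := by
        rw [Finset.prod_eq_single t]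
        · simp
        · intro u _ hu; simp [hu, hw]
        · simp

lemma sum_pi_prod_mul_sum {n : ℕ} {w : Fin n → S → ℝ} (hw : ∀ t, ∑ a, w t a = 1)
    (f : Fin n → S → ℝ) :
    ∑ s : Fin n → S, (∏ u, w u (s u)) * ∑ t, f t (s t) = ∑ t, ∑ a, w t a * f t a := by
  simp_rw [Finset.mul_sum]
  rw [Finset.sum_comm]
  exact Finset.sum_congr rfl fun t _ => sum_pi_prod_mul hw t (f t)

/-- The variance of a sum of independent centered variables. -/
lemma sum_pi_prod_mul_sq : ∀ {n : ℕ} {w : Fin n → S → ℝ} (_ : ∀ t, ∑ a, w t a = 1)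
    (f : Fin n → S → ℝ) (_ : ∀ t, ∑ a, w t a * f t a = 0),
    ∑ s : Fin n → S, (∏ u, w u (s u)) * (∑ t, f t (s t)) ^ 2 = ∑ t, ∑ a, w t a * f t a ^ 2
  | 0, _, _, _, _ => by simp
  | n + 1, w, hw, f, hf => by
    have ih := sum_pi_prod_mul_sq (fun t => hw t.succ) (fun t => f t.succ) (fun t => hf t.succ)
    have h1 : ∑ s : Fin n → S, ∏ u, w u.succ (s u) = 1 := by
      rw [sum_pi_prod]; exact Finset.prod_eq_one fun t _ => hw _
    rw [← (Fin.consEquiv fun _ => S).sum_comp, Fintype.sum_prod_type, Fin.sum_univ_succ, ← ih]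
    -- The tail sum has mean zero, which kills the cross term of the square.
    have h2 := sum_pi_prod_mul_sum (fun t => hw t.succ) (fun t => f t.succ)
    simp only [hf, Finset.sum_const_zero] at h2
    simp only [Fin.consEquiv_apply, Fin.prod_univ_succ, Fin.sum_univ_succ, Fin.cons_zero,
      Fin.cons_succ]
    calc _ = ∑ a, (w 0 a * f 0 a ^ 2 * (∑ s : Fin n → S, ∏ u, w u.succ (s u))
              + 2 * (w 0 a * f 0 a) *
                (∑ s : Fin n → S, (∏ u, w u.succ (s u)) * ∑ t, f t.succ (s t))
              + w 0 a * (∑ s : Fin n → S, (∏ u, w u.succ (s u)) * (∑ t, f t.succ (s t)) ^ 2)) := by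
          refine Finset.sum_congr rfl fun a _ => ?_
          simp_rw [Finset.mul_sum (s := (Finset.univ : Finset (Fin n → S)))]
          rw [← Finset.sum_add_distrib, ← Finset.sum_add_distrib]
          refine Finset.sum_congr rfl fun s _ => ?_
          ring
      _ = _ := by
          rw [h1, h2, Finset.sum_add_distrib, Finset.sum_add_distrib, ← Finset.sum_mul,
            ← Finset.sum_mul Finset.univ (w 0), hw 0]
          simp

/-- Chebyshev's inequality for a sum of independent variables bounded by `B`. -/
lemma sum_pi_prod_ite_le {n : ℕ} (hn : 0 < n) {w : Fin n → S → ℝ}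
    (hw : ∀ t, w t ∈ stdSimplex ℝ S)
    (f : Fin n → S → ℝ) {B δ : ℝ} (hB : ∀ t a, |f t a| ≤ B) (hδ : 0 < δ) :
    ∑ s : Fin n → S, (∏ u, w u (s u)) *
      (if n * δ ≤ |∑ t, f t (s t) - ∑ t, ∑ a, w t a * f t a| then 1 else 0) ≤
        4 * B ^ 2 / (δ ^ 2 * n) := by
  have hn' : (0 : ℝ) < n := by exact_mod_cast hn
  set m : Fin n → ℝ := fun t => ∑ a, w t a * f t a with hm
  have hmB : ∀ t, |m t| ≤ B := fun t => by
    calc |m t| ≤ ∑ a, |w t a * f t a| := Finset.abs_sum_le_sum_abs _ _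
      _ ≤ ∑ a, w t a * B := by
        refine Finset.sum_le_sum fun a _ => ?_
        rw [abs_mul, abs_of_nonneg ((hw t).1 a)]
        exact mul_le_mul_of_nonneg_left (hB t a) ((hw t).1 a)
      _ = B := by rw [← Finset.sum_mul, (hw t).2, one_mul]
  have hv := sum_pi_prod_mul_sq (fun t => (hw t).2) (fun t a => f t a - m t) (fun t => by
    simp_rw [mul_sub]
    rw [Finset.sum_sub_distrib, ← Finset.sum_mul, (hw t).2]
    simp [hm])
  have hbound : ∑ t, ∑ a, w t a * (f t a - m t) ^ 2 ≤ n * (4 * B ^ 2) := by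
    calc ∑ t, ∑ a, w t a * (f t a - m t) ^ 2 ≤ ∑ t, ∑ a, w t a * (4 * B ^ 2) := by
          refine Finset.sum_le_sum fun t _ => Finset.sum_le_sum fun a _ => ?_
          refine mul_le_mul_of_nonneg_left ?_ ((hw t).1 a)
          have h1 := abs_le.1 (hB t a)
          have h2 := abs_le.1 (hmB t)
          nlinarith
      _ = n * (4 * B ^ 2) := by
          simp_rw [← Finset.sum_mul, (hw _).2]
          simp
  have hle : ∑ s : Fin n → S, (∏ u, w u (s u)) *
      (if n * δ ≤ |∑ t, f t (s t) - ∑ t, m t| then 1 else 0) ≤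
      ∑ s : Fin n → S, (∏ u, w u (s u)) * (∑ t, (f t (s t) - m t)) ^ 2 / (n * δ) ^ 2 := by
    refine Finset.sum_le_sum fun s _ => ?_
    rw [mul_div_assoc]
    refine mul_le_mul_of_nonneg_left ?_ (Finset.prod_nonneg fun t _ => (hw t).1 _)
    rw [Finset.sum_sub_distrib]
    split_ifs with h
    · rw [le_div_iff₀ (by positivity), one_mul, ← sq_abs (_ - _)]
      gcongr
    · positivity
  refine hle.trans ?_
  rw [← Finset.sum_div, hv]
  calc _ ≤ n * (4 * B ^ 2) / (n * δ) ^ 2 := by gcongr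
    _ = _ := by field_simp

end Products

/-! ### Marginals of a joint law and superadditivity of divergence -/

section Marginals

variable {Ω Y : Type*} [Fintype Ω]

/-- Joint law of the coordinate `t` of the first component and of the second component. -/
noncomputable def marg {n : ℕ} (W : (Fin n → Ω) → Y → ℝ) (t : Fin n) (a : Ω) (y : Y) : ℝ :=
  ∑ ω with ω t = a, W ω y

lemma sum_marg_mul {n : ℕ} (W : (Fin n → Ω) → Y → ℝ) (t : Fin n) (y : Y) (f : Ω → ℝ) :
    ∑ a, marg W t a y * f a = ∑ ω, W ω y * f (ω t) := by
  rw [← Finset.sum_fiberwise (s := Finset.univ) (g := fun ω : Fin n → Ω => ω t)]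
  refine Finset.sum_congr rfl fun a _ => ?_
  rw [marg, Finset.sum_mul]
  refine Finset.sum_congr rfl fun ω hω => ?_
  rw [(Finset.mem_filter.1 hω).2]

lemma sum_marg {n : ℕ} (W : (Fin n → Ω) → Y → ℝ) (t : Fin n) (y : Y) :
    ∑ a, marg W t a y = ∑ ω, W ω y := by
  simpa using sum_marg_mul W t y fun _ => 1

lemma marg_nonneg {n : ℕ} {W : (Fin n → Ω) → Y → ℝ} (hW : ∀ ω y, 0 ≤ W ω y) (t : Fin n) (a : Ω)
    (y : Y) : 0 ≤ marg W t a y := Finset.sum_nonneg fun ω _ => hW ω y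

lemma le_marg {n : ℕ} {W : (Fin n → Ω) → Y → ℝ} (hW : ∀ ω y, 0 ≤ W ω y) (t : Fin n)
    (ω : Fin n → Ω) (y : Y) : W ω y ≤ marg W t (ω t) y :=
  Finset.single_le_sum (f := fun ω => W ω y) (fun ω _ => hW ω y)
    (Finset.mem_filter.2 ⟨Finset.mem_univ _, rfl⟩)

lemma sum_marg_out [Fintype Y] {n : ℕ} (W : (Fin n → Ω) → Y → ℝ) (t : Fin n) (a : Ω) :
    ∑ y, marg W t a y = ∑ ω with ω t = a, ∑ y, W ω y := by
  simp only [marg]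
  rw [Finset.sum_comm]

/-- The divergences of the marginals from the factors of a conditional product law add up to at
most the divergence of the joint law, whatever the reference law `q` of the second component. -/
lemma sum_marg_mul_log_le [Fintype Y] {n : ℕ} {W : (Fin n → Ω) → Y → ℝ} {q : Y → ℝ}
    {ν : Fin n → Y → Ω → ℝ} (hW : ∀ ω y, 0 ≤ W ω y) (hq : ∀ y, 0 ≤ q y)
    (hqW : ∑ y, q y ≤ ∑ y, ∑ ω, W ω y) (hWq : ∀ ω y, W ω y ≠ 0 → q y ≠ 0)
    (hWν : ∀ ω y t, W ω y ≠ 0 → ν t y (ω t) ≠ 0) :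
    ∑ t, ∑ y, ∑ a, marg W t a y * Real.log (marg W t a y / ((∑ ω, W ω y) * ν t y a)) ≤
      ∑ y, ∑ ω, W ω y * Real.log (W ω y / (q y * ∏ t, ν t y (ω t))) := by
  -- Comparison law: `q` on the outputs times the product of the conditional marginals. The
  -- difference of the two sides of the claim is the divergence of `W` from `G`, and Gibbs'
  -- inequality makes it nonnegative. At outputs of mass zero the conditionals are `0 / 0 = 0`, so
  -- the mass of `G` is only bounded by that of `q`.
  set G : Y × (Fin n → Ω) → ℝ := fun i =>
    q i.1 * ∏ t, (marg W t (i.2 t) i.1 / ∑ ω, W ω i.1) with hG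
  have hWY : ∀ y, 0 ≤ ∑ ω, W ω y := fun y => Finset.sum_nonneg fun ω _ => hW ω y
  have hpos : ∀ ω y, W ω y ≠ 0 → 0 < ∑ ω, W ω y := fun ω y h =>
    lt_of_lt_of_le (lt_of_le_of_ne (hW ω y) h.symm)
      (Finset.single_le_sum (f := fun ω => W ω y) (fun ω _ => hW ω y) (Finset.mem_univ ω))
  have hmpos : ∀ ω y t, W ω y ≠ 0 → 0 < marg W t (ω t) y := fun ω y t h =>
    lt_of_lt_of_le (lt_of_le_of_ne (hW ω y) h.symm) (le_marg hW t ω y)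
  have hG0 : ∀ i, 0 ≤ G i := fun i => mul_nonneg (hq _) <| Finset.prod_nonneg fun t _ =>
    div_nonneg (marg_nonneg hW _ _ _) (hWY _)
  have hgibbs := sum_sub_sum_le_sum_mul_log (p := fun i : Y × (Fin n → Ω) => W i.2 i.1)
    (q := G) (fun i => hW _ _) hG0 (fun i hi => by
      by_contra h
      refine mul_ne_zero (hWq _ _ h) (Finset.prod_ne_zero_iff.2 fun t _ => ?_) hi
      exact (div_pos (hmpos _ _ t h) (hpos _ _ h)).ne')
  have hGsum : ∑ i, G i ≤ ∑ y, q y := by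
    rw [Fintype.sum_prod_type]
    refine Finset.sum_le_sum fun y _ => ?_
    simp only [hG]
    rw [← Finset.mul_sum, sum_pi_prod (fun t a => marg W t a y / ∑ ω, W ω y)]
    refine mul_le_of_le_one_right (hq y) (Finset.prod_le_one (fun t _ => ?_) fun t _ => ?_)
    · exact Finset.sum_nonneg fun a _ => div_nonneg (marg_nonneg hW _ _ _) (hWY _)
    · rw [← Finset.sum_div, sum_marg]
      exact div_self_le_one _
  have hdiff : ∑ i : Y × (Fin n → Ω), W i.2 i.1 * Real.log (W i.2 i.1 / G i) =
      ∑ y, ∑ ω, W ω y * Real.log (W ω y / (q y * ∏ t, ν t y (ω t))) -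
      ∑ t, ∑ y, ∑ a, marg W t a y * Real.log (marg W t a y / ((∑ ω, W ω y) * ν t y a)) := by
    have h1 : ∀ t y, ∑ a, marg W t a y *
        Real.log (marg W t a y / ((∑ ω, W ω y) * ν t y a)) =
        ∑ ω', W ω' y * Real.log (marg W t (ω' t) y / ((∑ ω, W ω y) * ν t y (ω' t))) :=
      fun t y => sum_marg_mul W t y _
    simp_rw [h1]
    rw [Fintype.sum_prod_type]
    rw [Finset.sum_comm (s := (Finset.univ : Finset (Fin n))), ← Finset.sum_sub_distrib]
    refine Finset.sum_congr rfl fun y _ => ?_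
    rw [Finset.sum_comm, ← Finset.sum_sub_distrib]
    refine Finset.sum_congr rfl fun ω _ => ?_
    rw [← Finset.mul_sum, ← mul_sub]
    by_cases h : W ω y = 0
    · simp [h]
    congr 1
    have e1 : ∀ t, Real.log (marg W t (ω t) y / ((∑ ω, W ω y) * ν t y (ω t))) =
        Real.log (marg W t (ω t) y / ∑ ω, W ω y) - Real.log (ν t y (ω t)) := fun t => by
      rw [← div_div, Real.log_div (div_pos (hmpos ω y t h) (hpos ω y h)).ne' (hWν ω y t h)]
    simp_rw [e1]
    have e2 : ∏ t, (marg W t (ω t) y / ∑ ω, W ω y) ≠ 0 := Finset.prod_ne_zero_iff.2 fun t _ =>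
      (div_pos (hmpos ω y t h) (hpos ω y h)).ne'
    have e3 : ∏ t, ν t y (ω t) ≠ 0 := Finset.prod_ne_zero_iff.2 fun t _ => hWν ω y t h
    simp only [hG]
    rw [Real.log_div h (mul_ne_zero (hWq ω y h) e2), Real.log_div h (mul_ne_zero (hWq ω y h) e3),
      Real.log_mul (hWq ω y h) e2, Real.log_mul (hWq ω y h) e3,
      Real.log_prod (fun t _ => (div_pos (hmpos ω y t h) (hpos ω y h)).ne'),
      Real.log_prod (fun t _ => hWν ω y t h), Finset.sum_sub_distrib]
    ring
  rw [hdiff, Fintype.sum_prod_type] at hgibbs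
  linarith

end Marginals

/-! ### One-shot covering and channel codes -/

section OneShot

lemma exists_le_of_sum_mul_le {V : Type*} [Fintype V] {p F : V → ℝ} {b : ℝ}
    (hp : p ∈ stdSimplex ℝ V) (h : ∑ v, p v * F v ≤ b) : ∃ v, F v ≤ b := by
  by_contra! hF
  have h1 : ∑ v, p v * (F v - b) ≤ 0 := by
    simp_rw [mul_sub]
    rw [Finset.sum_sub_distrib, ← Finset.sum_mul, hp.2]
    linarith
  have h2 : ∀ v, 0 ≤ p v * (F v - b) := fun v => mul_nonneg (hp.1 v) (by linarith [hF v])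
  have h3 := (Finset.sum_eq_zero_iff_of_nonneg fun v _ => h2 v).1
    (le_antisymm h1 (Finset.sum_nonneg fun v _ => h2 v))
  have h4 : ∑ v, p v = 0 := Finset.sum_eq_zero fun v hv =>
    (mul_eq_zero.1 (h3 v hv)).resolve_right (by linarith [hF v])
  rw [hp.2] at h4
  exact one_ne_zero h4

lemma exists_ge_of_le_sum_mul {V : Type*} [Fintype V] {p F : V → ℝ} {b : ℝ}
    (hp : p ∈ stdSimplex ℝ V) (h : b ≤ ∑ v, p v * F v) : ∃ v, b ≤ F v := by
  obtain ⟨v, hv⟩ := exists_le_of_sum_mul_le (F := fun v => -F v) (b := -b) hp (by simpa using h)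
  exact ⟨v, by linarith⟩

/-- Greedy covering: codewords that cover each point with probability at least `θ`, when drawn at
random, can be chosen so that the uncovered mass decreases geometrically. -/
lemma exists_greedy_cover {U V : Type*} [Fintype U] [Fintype V] {f : U → ℝ} {p : V → ℝ}
    {good : V → U → Prop} {θ : ℝ} (hf : ∀ u, 0 ≤ f u) (hp : p ∈ stdSimplex ℝ V) (hθ : θ ≤ 1)
    (h : ∀ u, f u ≠ 0 → θ ≤ ∑ v, p v * if good v u then 1 else 0) (M : ℕ) :
    ∃ c : Fin M → V, ∑ u, f u * (if ∀ j, ¬ good (c j) u then 1 else 0) ≤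
      (1 - θ) ^ M * ∑ u, f u := by
  induction M with
  | zero => exact ⟨Fin.elim0, by simp⟩
  | succ M ih =>
    obtain ⟨c, hc⟩ := ih
    set g : U → ℝ := fun u => f u * (if ∀ j, ¬ good (c j) u then 1 else 0) with hg
    have hg0 : ∀ u, 0 ≤ g u := fun u => mul_nonneg (hf u) (by split_ifs <;> simp)
    -- Averaged over a random next codeword, the uncovered mass shrinks by the factor `1 - θ`; some
    -- codeword does at least as well.
    have key : ∑ v, p v * ∑ u, g u * (if good v u then 0 else 1) ≤ (1 - θ) * ∑ u, g u := by
      simp_rw [Finset.mul_sum]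
      rw [Finset.sum_comm]
      refine Finset.sum_le_sum fun u _ => ?_
      have e : ∑ v, p v * (g u * if good v u then 0 else 1) =
          g u * (1 - ∑ v, p v * if good v u then 1 else 0) := by
        have e1 : g u = ∑ v, p v * g u := by rw [← Finset.sum_mul, hp.2, one_mul]
        rw [mul_sub, mul_one, Finset.mul_sum]
        nth_rewrite 2 [e1]
        rw [← Finset.sum_sub_distrib]
        refine Finset.sum_congr rfl fun v _ => ?_
        split_ifs <;> ring
      rw [e, mul_comm]
      by_cases hu : f u = 0
      · simp [hg, hu]
      · exact mul_le_mul_of_nonneg_right (by linarith [h u hu]) (hg0 u)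
    obtain ⟨v, hv⟩ := exists_le_of_sum_mul_le hp key
    refine ⟨Fin.cons v c, ?_⟩
    calc _ = ∑ u, g u * (if good v u then 0 else 1) := by
          refine Finset.sum_congr rfl fun u _ => ?_
          simp only [Fin.forall_fin_succ, Fin.cons_zero, Fin.cons_succ, hg]
          by_cases h1 : good v u <;> simp [h1]
      _ ≤ (1 - θ) * ∑ u, g u := hv
      _ ≤ (1 - θ) * ((1 - θ) ^ M * ∑ u, f u) :=
          mul_le_mul_of_nonneg_left hc (by linarith)
      _ = _ := by ring

/-- Covering lemma. -/
lemma exists_cover {U V : Type*} [Fintype U] [Fintype V] {J : V → U → ℝ} {p : V → ℝ}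
    {m : U → ℝ} {good : V → U → Prop} {a : ℝ} (hJ : ∀ v u, 0 ≤ J v u) (hp : p ∈ stdSimplex ℝ V)
    (hm : m ∈ stdSimplex ℝ U) (hJm : ∀ u, ∑ v, J v u = m u) (ha : 1 ≤ a)
    (hgood : ∀ v u, good v u → J v u ≤ a * (p v * m u)) (M : ℕ) :
    ∃ c : Fin M → V, ∑ u, m u * (if ∀ j, ¬ good (c j) u then 1 else 0) ≤
      2 * (∑ v, ∑ u, J v u * if good v u then 0 else 1) + Real.exp (-(M / (2 * a))) := by
  -- `κ u` is the mass of the good pairs above `u`. Where it is at least half of `m u`, the density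
  -- bound `hgood` turns it into a probability at least `1 / (2 * a)` under `p`, and the greedy
  -- cover applies. Elsewhere `m u` is at most twice the mass of the bad pairs above `u`.
  set κ : U → ℝ := fun u => ∑ v, J v u * if good v u then 1 else 0 with hκ
  have ha0 : 0 < a := by linarith
  have hθ : 1 / (2 * a) ≤ 1 := by rw [div_le_one (by positivity)]; linarith
  set f : U → ℝ := fun u => if m u ≤ 2 * κ u then m u else 0 with hf
  have hf0 : ∀ u, 0 ≤ f u := fun u => by simp only [hf]; split_ifs <;> simp [hm.1 u]
  obtain ⟨c, hc⟩ := exists_greedy_cover (good := good) hf0 hp hθ (fun u hu => by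
    have h1 : m u ≤ 2 * κ u := by by_contra h; simp [hf, h] at hu
    have h2 : 0 < m u := lt_of_le_of_ne (hm.1 u) (by rintro h; simp [hf, ← h] at hu)
    have h3 : κ u ≤ a * m u * ∑ v, p v * if good v u then 1 else 0 := by
      rw [Finset.mul_sum]
      refine Finset.sum_le_sum fun v _ => ?_
      split_ifs with h
      · linarith [hgood v u h]
      · simp
    rw [div_le_iff₀ (by positivity)]
    have h4 : m u * 1 ≤ m u * ((∑ v, p v * if good v u then 1 else 0) * (2 * a)) := by linarith
    exact le_of_mul_le_mul_left h4 h2) M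
  refine ⟨c, ?_⟩
  have hfm : ∑ u, f u ≤ 1 := by
    rw [← hm.2]
    refine Finset.sum_le_sum fun u _ => ?_
    simp only [hf]; split_ifs <;> simp [hm.1 u]
  have hexp : (1 - 1 / (2 * a)) ^ M * ∑ u, f u ≤ Real.exp (-(M / (2 * a))) := by
    have h1 : 1 - 1 / (2 * a) ≤ Real.exp (-(1 / (2 * a))) := by
      linarith [Real.add_one_le_exp (-(1 / (2 * a)))]
    calc (1 - 1 / (2 * a)) ^ M * ∑ u, f u ≤ (1 - 1 / (2 * a)) ^ M * 1 :=
          mul_le_mul_of_nonneg_left hfm (pow_nonneg (by linarith) _)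
      _ ≤ (Real.exp (-(1 / (2 * a)))) ^ M := by
          rw [mul_one]; exact pow_le_pow_left₀ (by linarith) h1 M
      _ = _ := by rw [← Real.exp_nat_mul]; congr 1; ring
  have hsplit : ∀ u, m u * (if ∀ j, ¬ good (c j) u then 1 else 0) ≤
      2 * (∑ v, J v u * if good v u then 0 else 1) +
        f u * (if ∀ j, ¬ good (c j) u then 1 else 0) := fun u => by
    have h0 : 0 ≤ ∑ v, J v u * if good v u then 0 else 1 :=
      Finset.sum_nonneg fun v _ => mul_nonneg (hJ v u) (by split_ifs <;> simp)
    have hκm : (∑ v, J v u * if good v u then 0 else 1) + κ u = m u := by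
      rw [← hJm, hκ, ← Finset.sum_add_distrib]
      refine Finset.sum_congr rfl fun v _ => ?_
      split_ifs <;> ring
    by_cases h : m u ≤ 2 * κ u
    · simp only [hf, h, if_true]; linarith
    · simp only [hf, h, if_false]
      have : m u * (if ∀ j, ¬ good (c j) u then 1 else 0) ≤ m u * 1 :=
        mul_le_mul_of_nonneg_left (by split_ifs <;> simp) (hm.1 u)
      linarith
  calc _ ≤ ∑ u, (2 * (∑ v, J v u * if good v u then 0 else 1) +
        f u * (if ∀ j, ¬ good (c j) u then 1 else 0)) := Finset.sum_le_sum fun u _ => hsplit u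
    _ = 2 * (∑ v, ∑ u, J v u * if good v u then 0 else 1) +
        ∑ u, f u * (if ∀ j, ¬ good (c j) u then 1 else 0) := by
      rw [Finset.sum_add_distrib, ← Finset.mul_sum, Finset.sum_comm]
    _ ≤ _ := by linarith

/-- Feinstein's lemma: existence of a code with small maximal error probability. -/
lemma exists_feinstein_code {U V : Type*} [Fintype U] [Fintype V] {K : U → V → ℝ} {p : U → ℝ}
    {B : U → V → Prop} {γ ε : ℝ} (hK : ∀ u, K u ∈ stdSimplex ℝ V) (hp : p ∈ stdSimplex ℝ U)
    (hγ : 0 < γ) (hB : ∀ u v, B u v → γ * ∑ u', p u' * K u' v ≤ K u v) (M : ℕ)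
    (hε : (∑ u, ∑ v, p u * K u v * if B u v then 0 else 1) + M / γ ≤ ε) :
    ∃ (c : Fin M → U) (d : V → Option (Fin M)), (∀ j v, d v = some j → B (c j) v) ∧
      ∀ j, 1 - ε ≤ ∑ v, K (c j) v * if d v = some j then 1 else 0 := by
  induction M with
  | zero => exact ⟨Fin.elim0, fun _ => none, by simp, fun j => j.elim0⟩
  | succ M ih =>
    have hMγ : (M : ℝ) / γ ≤ ((M + 1 : ℕ) : ℝ) / γ := by gcongr; simp
    obtain ⟨c, d, hd, hcd⟩ := ih (by linarith)
    set q : V → ℝ := fun v => ∑ u', p u' * K u' v with hq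
    have hq0 : ∀ v, 0 ≤ q v := fun v =>
      Finset.sum_nonneg fun u _ => mul_nonneg (hp.1 u) ((hK u).1 v)
    -- On the decoding set of `c j` the law `K (c j)` is at least `γ * q`, so this set has `q`-mass
    -- at most `1 / γ`.
    have hqd : ∑ v, q v * (if d v = none then 0 else 1) ≤ M / γ := by
      have e : ∀ v, q v * (if d v = none then 0 else 1) =
          ∑ j, q v * (if d v = some j then 1 else 0) := fun v => by
        rcases h : d v with _ | j <;> simp
      simp_rw [e]
      rw [Finset.sum_comm]
      calc _ ≤ ∑ j : Fin M, 1 / γ := by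
            refine Finset.sum_le_sum fun j _ => ?_
            rw [le_div_iff₀ hγ, Finset.sum_mul]
            refine le_of_le_of_eq ?_ (hK (c j)).2
            refine Finset.sum_le_sum fun v _ => ?_
            split_ifs with h
            · linarith [hB (c j) v (hd j v h)]
            · simpa using (hK (c j)).1 v
        _ = M / γ := by simp [div_eq_mul_inv]
    -- For a random input, the output satisfies `B` and is not yet assigned with probability at
    -- least `1 - ε`. Some input attains this bound; it becomes the new codeword, decoded on the
    -- unassigned outputs that satisfy `B`.
    have key : 1 - ε ≤ ∑ u, p u * ∑ v, K u v * (if d v = none ∧ B u v then 1 else 0) := by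
      have h1 : ∑ u, ∑ v, p u * K u v = 1 := by
        simp_rw [← Finset.mul_sum, (hK _).2, mul_one]; exact hp.2
      have h2 : ∑ v, q v * (if d v = none then (0 : ℝ) else 1) =
          ∑ u, ∑ v, p u * K u v * (if d v = none then 0 else 1) := by
        rw [Finset.sum_comm]
        simp_rw [hq, Finset.sum_mul]
      have h3 : ∑ u, ∑ v, p u * K u v ≤
          (∑ u, ∑ v, p u * K u v * if B u v then (0 : ℝ) else 1) +
          (∑ u, ∑ v, p u * K u v * (if d v = none then (0 : ℝ) else 1)) +
          ∑ u, p u * ∑ v, K u v * (if d v = none ∧ B u v then 1 else 0) := by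
        simp_rw [Finset.mul_sum, ← Finset.sum_add_distrib]
        refine Finset.sum_le_sum fun u _ => Finset.sum_le_sum fun v _ => ?_
        have := mul_nonneg (hp.1 u) ((hK u).1 v)
        by_cases h4 : d v = none <;> by_cases h5 : B u v <;> simp [h4, h5]
        exact this
      linarith
    obtain ⟨u, hu⟩ := exists_ge_of_le_sum_mul hp key
    refine ⟨Fin.cons u c, fun v => (d v).elim (if B u v then some 0 else none)
      (fun j => some j.succ), fun j v h => ?_, fun j => ?_⟩
    · rcases h1 : d v with _ | i
      · by_cases h2 : B u v
        · simp [h1, h2] at h; subst h; simpa using h2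
        · simp [h1, h2] at h
      · simp [h1] at h; subst h; simpa using hd i v h1
    · refine Fin.cases ?_ (fun i => ?_) j
      · refine hu.trans_eq (Finset.sum_congr rfl fun v _ => ?_)
        rcases h1 : d v with _ | i
        · by_cases h2 : B u v <;> simp [h1, h2]
        · simp [h1]
      · refine (hcd i).trans_eq (Finset.sum_congr rfl fun v _ => ?_)
        rcases h1 : d v with _ | i'
        · by_cases h2 : B u v <;> simp [h1, h2, (Fin.succ_ne_zero _).symm]
        · simp [h1]

end OneShot

/-! ### Entropy identities and the channel coding theorem -/

section Channel

variable {X Y : Type*} [Fintype Y]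

lemma entropy_mul_log_two {S : Type*} [Fintype S] (q : S → ℝ) :
    entropy q * Real.log 2 = -∑ s, q s * Real.log (q s) := by
  have h2 : Real.log 2 ≠ 0 := (Real.log_pos one_lt_two).ne'
  rw [entropy, neg_mul, Finset.sum_mul]
  congr 1
  refine Finset.sum_congr rfl fun s _ => ?_
  rw [Real.logb, mul_assoc, div_mul_cancel₀ _ h2]

/-- The entropy of a mixture minus the mean entropy, as a mean divergence. -/
lemma sum_mul_sum_mul_log_div {ι S : Type*} [Fintype ι] [Fintype S] {p : ι → ℝ} {K : ι → S → ℝ}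
    {q : S → ℝ} (hp : ∀ i, 0 ≤ p i) (hK : ∀ i s, 0 ≤ K i s) (hq : ∀ s, ∑ i, p i * K i s = q s) :
    (entropy q - ∑ i, p i * entropy (K i)) * Real.log 2 =
      ∑ i, ∑ s, p i * K i s * Real.log (K i s / q s) := by
  rw [sub_mul, entropy_mul_log_two, Finset.sum_mul]
  simp_rw [mul_assoc, entropy_mul_log_two, mul_neg, Finset.sum_neg_distrib, sub_neg_eq_add,
    Finset.mul_sum]
  have h1 : ∑ s, q s * Real.log (q s) = ∑ i, ∑ s, p i * (K i s * Real.log (q s)) := by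
    rw [Finset.sum_comm]
    refine Finset.sum_congr rfl fun s _ => ?_
    rw [← hq, Finset.sum_mul]
    refine Finset.sum_congr rfl fun i _ => ?_
    ring
  rw [h1, neg_add_eq_sub, ← Finset.sum_sub_distrib]
  refine Finset.sum_congr rfl fun i _ => ?_
  rw [← Finset.sum_sub_distrib]
  refine Finset.sum_congr rfl fun s _ => ?_
  by_cases h : p i * K i s = 0
  · rw [← mul_assoc, ← mul_assoc, ← mul_assoc, h]; simp
  have hpi : p i ≠ 0 := left_ne_zero_of_mul h
  have hKi : K i s ≠ 0 := right_ne_zero_of_mul h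
  have hqs : q s ≠ 0 := by
    rw [← hq]
    refine (lt_of_lt_of_le (lt_of_le_of_ne (mul_nonneg (hp i) (hK i s)) (Ne.symm h)) ?_).ne'
    exact Finset.single_le_sum (f := fun i => p i * K i s)
      (fun i _ => mul_nonneg (hp i) (hK i s)) (Finset.mem_univ i)
  rw [Real.log_div hKi hqs]
  ring

lemma seqChannel_mem {k : ℕ} {Q : X → Y → ℝ} (hQ : ∀ x, Q x ∈ stdSimplex ℝ Y) (x : Fin k → X) :
    seqChannel Q x ∈ stdSimplex ℝ (Fin k → Y) :=
  prod_mem_stdSimplex fun t => hQ (x t)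

/-- Channel coding theorem, with maximal error probability. -/
lemma exists_code [Fintype X] [Nonempty X] {Q : X → Y → ℝ} (hQ : ∀ x, Q x ∈ stdSimplex ℝ Y) {ρ ε : ℝ}
    (hρ : ρ < capacity Q * Real.log 2) (hε : 0 < ε) :
    ∀ᶠ k : ℕ in atTop, ∀ M : ℕ, (M : ℝ) ≤ Real.exp (k * ρ) →
      ∃ (c : Fin M → Fin k → X) (d : (Fin k → Y) → Option (Fin M)),
        ∀ j, 1 - ε ≤ ∑ y, seqChannel Q (c j) y * if d y = some j then 1 else 0 := by
  have hl2 : 0 < Real.log 2 := Real.log_pos one_lt_two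
  have hne : (mutualInfo Q '' stdSimplex ℝ X).Nonempty := by
    have x : X := Classical.arbitrary X
    exact ⟨_, Pi.single x 1, single_mem_stdSimplex ℝ x, rfl⟩
  obtain ⟨_, ⟨p, hp, rfl⟩, hpρ⟩ := exists_lt_of_lt_csSup hne (show ρ / Real.log 2 < capacity Q by
    rwa [div_lt_iff₀ hl2])
  rw [div_lt_iff₀ hl2] at hpρ
  set q : Y → ℝ := fun y => ∑ x, p x * Q x y with hq
  have hI : mutualInfo Q p * Real.log 2 = ∑ x, ∑ y, p x * Q x y * Real.log (Q x y / q y) :=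
    sum_mul_sum_mul_log_div hp.1 (fun x => (hQ x).1) fun _ => rfl
  set I := mutualInfo Q p * Real.log 2 with hIdef
  -- Half of the gap absorbs the fluctuations of the information density; the other half makes the
  -- number of messages negligible against the threshold `γ`, since `ρ - (I - δ) = -δ`.
  set δ := (I - ρ) / 2 with hδdef
  have hδ : 0 < δ := by rw [hδdef]; linarith
  obtain ⟨Λ, hΛ⟩ : ∃ Λ : ℝ, ∀ a : X × Y, |Real.log (Q a.1 a.2 / q a.2)| ≤ Λ := by
    obtain ⟨Λ, hΛ⟩ := (Set.finite_range fun a : X × Y => |Real.log (Q a.1 a.2 / q a.2)|).bddAbove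
    exact ⟨Λ, fun a => hΛ ⟨a, rfl⟩⟩
  have hlim : Tendsto (fun k : ℕ => 4 * Λ ^ 2 / (δ ^ 2 * k) + Real.exp (-(δ * k))) atTop
      (𝓝 0) := by
    have hk : Tendsto (fun k : ℕ => (k : ℝ)) atTop atTop := tendsto_natCast_atTop_atTop
    have h1 : Tendsto (fun k : ℕ => 4 * Λ ^ 2 / (δ ^ 2 * k)) atTop (𝓝 0) :=
      (hk.const_mul_atTop (by positivity : 0 < δ ^ 2)).const_div_atTop _
    have h2 : Tendsto (fun k : ℕ => Real.exp (-(δ * k))) atTop (𝓝 0) :=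
      Real.tendsto_exp_neg_atTop_nhds_zero.comp (hk.const_mul_atTop hδ)
    simpa using h1.add h2
  filter_upwards [hlim.eventually (gt_mem_nhds hε), eventually_gt_atTop 0] with k hk hk0 M hM
  set w : Fin k → X × Y → ℝ := fun _ a => p a.1 * Q a.1 a.2
  have hw : ∀ t, w t ∈ stdSimplex ℝ (X × Y) := fun t =>
    ⟨fun a => mul_nonneg (hp.1 _) ((hQ _).1 _), by
      simp only [w, Fintype.sum_prod_type, ← Finset.mul_sum, (hQ _).2, mul_one, hp.2]⟩
  have hcheb := sum_pi_prod_ite_le hk0 hw (fun _ a => Real.log (Q a.1 a.2 / q a.2))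
    (fun _ a => hΛ a) hδ
  have hmean : ∑ t : Fin k, ∑ a, w t a * Real.log (Q a.1 a.2 / q a.2) = k * I := by
    simp only [w, Fintype.sum_prod_type, ← hI]
    simp
  rw [hmean] at hcheb
  set γ := Real.exp (k * (I - δ)) with hγ
  have hqk : ∀ y : Fin k → Y, ∑ x : Fin k → X, (∏ t, p (x t)) * seqChannel Q x y = ∏ t, q (y t) :=
    fun y => by
      simp only [seqChannel, ← Finset.prod_mul_distrib]
      rw [sum_pi_prod (fun t x => p x * Q x (y t))]
  obtain ⟨c, d, -, h⟩ := exists_feinstein_code (K := fun x : Fin k → X => seqChannel Q x)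
    (p := fun x => ∏ t, p (x t)) (B := fun x y => γ * ∏ t, q (y t) ≤ seqChannel Q x y) (γ := γ)
    (ε := ε) (seqChannel_mem hQ) (prod_mem_stdSimplex fun _ => hp) (Real.exp_pos _)
    (fun x y h => by rwa [hqk]) M (by
      have e1 : ∑ x : Fin k → X, ∑ y : Fin k → Y, (∏ t, p (x t)) * seqChannel Q x y *
          (if γ * ∏ t, q (y t) ≤ seqChannel Q x y then 0 else 1) ≤ 4 * Λ ^ 2 / (δ ^ 2 * k) := by
        refine le_trans ?_ hcheb
        rw [← (Equiv.arrowProdEquivProdArrow (Fin k) (fun _ => X) (fun _ => Y)).symm.sum_comp,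
          Fintype.sum_prod_type]
        refine Finset.sum_le_sum fun x _ => Finset.sum_le_sum fun y _ => ?_
        have hpQ : (∏ t, p (x t)) * seqChannel Q x y = ∏ t, p (x t) * Q (x t) (y t) := by
          rw [seqChannel, ← Finset.prod_mul_distrib]
        simp only [w, Equiv.arrowProdEquivProdArrow_symm_apply, hpQ]
        have h0 : 0 ≤ ∏ t, p (x t) * Q (x t) (y t) :=
          Finset.prod_nonneg fun t _ => mul_nonneg (hp.1 _) ((hQ _).1 _)
        by_cases hz : ∏ t, p (x t) * Q (x t) (y t) = 0
        · simp [hz]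
        refine mul_le_mul_of_nonneg_left ?_ h0
        by_cases hb : γ * ∏ t, q (y t) ≤ seqChannel Q x y
        · simp only [hb, if_true]; split_ifs <;> simp
        -- Outside the decoding condition, the information density falls short of its mean `k * I`
        -- by at least `k * δ`, which is an event in Chebyshev's bound.
        rw [if_neg hb, if_pos]
        by_contra hlt
        apply hb
        have hpos : ∀ t, 0 < p (x t) * Q (x t) (y t) := fun t =>
          lt_of_le_of_ne (mul_nonneg (hp.1 _) ((hQ _).1 _))
            (Ne.symm (Finset.prod_ne_zero_iff.1 hz t (Finset.mem_univ t)))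
        have hQpos : ∀ t, 0 < Q (x t) (y t) := fun t =>
          lt_of_le_of_ne ((hQ _).1 _) (Ne.symm (right_ne_zero_of_mul (hpos t).ne'))
        have hqpos : ∀ t, 0 < q (y t) := fun t => (hpos t).trans_le
          (Finset.single_le_sum (f := fun x' => p x' * Q x' (y t))
            (fun x' _ => mul_nonneg (hp.1 _) ((hQ _).1 _)) (Finset.mem_univ (x t)))
        have hprod : seqChannel Q x y =
            Real.exp (∑ t, Real.log (Q (x t) (y t) / q (y t))) * ∏ t, q (y t) := by
          rw [seqChannel, Real.exp_sum, ← Finset.prod_mul_distrib]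
          refine Finset.prod_congr rfl fun t _ => ?_
          rw [Real.exp_log (div_pos (hQpos t) (hqpos t)), div_mul_cancel₀ _ (hqpos t).ne']
        rw [hprod, hγ]
        refine mul_le_mul_of_nonneg_right (Real.exp_le_exp.2 ?_)
          (Finset.prod_nonneg fun t _ => (hqpos t).le)
        have := (abs_lt.1 (not_le.1 hlt)).1
        linarith
      have e2 : (M : ℝ) / γ ≤ Real.exp (-(δ * k)) := by
        rw [div_le_iff₀ (Real.exp_pos _), ← Real.exp_add]
        refine hM.trans (Real.exp_le_exp.2 (le_of_eq ?_))
        rw [hδdef]; ring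
      linarith)
  exact ⟨c, d, h⟩

end Channel

/-! ### The robust payoff near a belief -/

section RobustPayoff

variable {Ω A Z : Type*} [Fintype Ω] [Fintype A] [Nonempty A]

lemma optActions_nonempty (uR : Ω → A → Z → ℝ) (z : Z) (ν : Ω → ℝ) :
    (optActions uR z ν).Nonempty :=
  Finite.exists_max fun a => ∑ ω, ν ω * uR ω a z

lemma robustPayoff_le (uS uR : Ω → A → Z → ℝ) {z : Z} {ν : Ω → ℝ} {a : A}
    (ha : a ∈ optActions uR z ν) : robustPayoff uS uR z ν ≤ ∑ ω, ν ω * uS ω a z :=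
  csInf_le (Set.toFinite _).bddBelow ⟨a, ha, rfl⟩

lemma exists_robustPayoff_eq (uS uR : Ω → A → Z → ℝ) (z : Z) (ν : Ω → ℝ) :
    ∃ a ∈ optActions uR z ν, robustPayoff uS uR z ν = ∑ ω, ν ω * uS ω a z := by
  obtain ⟨a, ha, h⟩ := ((optActions_nonempty uR z ν).image
    (fun a => ∑ ω, ν ω * uS ω a z)).csInf_mem (Set.toFinite _)
  exact ⟨a, ha, h.symm⟩

lemma abs_sum_mul_le {ι : Type*} [Fintype ι] {w f : ι → ℝ} {B : ℝ} (hf : ∀ i, |f i| ≤ B) :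
    |∑ i, w i * f i| ≤ B * ∑ i, |w i| := by
  rw [Finset.mul_sum]
  refine (Finset.abs_sum_le_sum_abs _ _).trans (Finset.sum_le_sum fun i _ => ?_)
  rw [abs_mul, mul_comm]
  exact mul_le_mul_of_nonneg_right (hf i) (abs_nonneg _)

lemma abs_sum_mul_le_of_mem {ι : Type*} [Fintype ι] {w f : ι → ℝ} {B : ℝ}
    (hw : w ∈ stdSimplex ℝ ι) (hf : ∀ i, |f i| ≤ B) : |∑ i, w i * f i| ≤ B := by
  refine (abs_sum_mul_le hf).trans_eq ?_
  rw [Finset.sum_congr rfl fun i _ => abs_of_nonneg (hw.1 i), hw.2, mul_one]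

lemma abs_robustPayoff_le {uS : Ω → A → Z → ℝ} (uR : Ω → A → Z → ℝ) {z : Z} {ν : Ω → ℝ} {B : ℝ}
    (hB : ∀ ω a z, |uS ω a z| ≤ B) (hν : ν ∈ stdSimplex ℝ Ω) :
    |robustPayoff uS uR z ν| ≤ B := by
  obtain ⟨a, -, h⟩ := exists_robustPayoff_eq uS uR z ν
  rw [h]
  exact abs_sum_mul_le_of_mem hν fun ω => hB ω a z

lemma exists_abs_payoff_le [Fintype Z] (u : Ω → A → Z → ℝ) :
    ∃ B, 0 ≤ B ∧ ∀ ω a z, |u ω a z| ≤ B := by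
  obtain ⟨B, hB⟩ := (Set.finite_range fun i : Ω × A × Z => |u i.1 i.2.1 i.2.2|).bddAbove
  exact ⟨max B 0, le_max_right _ _, fun ω a z => le_max_of_le_left (hB ⟨(ω, a, z), rfl⟩)⟩

/-- `K` is a constant for the linear lower bound of the sender's payoff near the belief `ν`: at any
unnormalized belief `w`, every optimal action gives the sender the robust payoff at `ν` up to `K`
times the distance between `w` and a multiple of `ν`. -/
def LowerBoundAt (uS uR : Ω → A → Z → ℝ) (z : Z) (ν : Ω → ℝ) (K : ℝ) : Prop :=
  ∀ w : Ω → ℝ, (∀ ω, 0 ≤ w ω) → ∀ a, (∀ b, ∑ ω, w ω * uR ω b z ≤ ∑ ω, w ω * uR ω a z) →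
    (∑ ω, w ω) * robustPayoff uS uR z ν - K * ∑ ω, |w ω - (∑ ω', w ω') * ν ω| ≤
      ∑ ω, w ω * uS ω a z

lemma LowerBoundAt.mono {uS uR : Ω → A → Z → ℝ} {z : Z} {ν : Ω → ℝ} {K K' : ℝ}
    (h : LowerBoundAt uS uR z ν K) (hK : K ≤ K') : LowerBoundAt uS uR z ν K' := by
  intro w hw a ha
  have h1 := h w hw a ha
  have h2 : 0 ≤ ∑ ω, |w ω - (∑ ω', w ω') * ν ω| := Finset.sum_nonneg fun _ _ => abs_nonneg _
  nlinarith

/-- An action optimal at `ν` gives at least the robust payoff there, and its payoff is Lipschitz in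
the belief. An action not optimal at `ν` loses a positive gap there, so it can be optimal at `w`
only if the distance is at least proportional to the mass of `w`, and then a large constant makes
the bound trivial. Finitely many actions allow one constant. Unnormalized `w` will spare divisions
by output probabilities. -/
lemma exists_lowerBoundAt [Fintype Z] (uS uR : Ω → A → Z → ℝ) (z : Z) {ν : Ω → ℝ}
    (hν : ν ∈ stdSimplex ℝ Ω) : ∃ K, 0 ≤ K ∧ LowerBoundAt uS uR z ν K := by
  obtain ⟨B, hB0, hB⟩ := exists_abs_payoff_le uS
  obtain ⟨R, hR0, hR⟩ := exists_abs_payoff_le uR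
  have key : ∀ a, ∃ K, 0 ≤ K ∧ ∀ w : Ω → ℝ, (∀ ω, 0 ≤ w ω) →
      (∀ b, ∑ ω, w ω * uR ω b z ≤ ∑ ω, w ω * uR ω a z) →
      (∑ ω, w ω) * robustPayoff uS uR z ν - K * ∑ ω, |w ω - (∑ ω', w ω') * ν ω| ≤
        ∑ ω, w ω * uS ω a z := by
    intro a
    have hdec : ∀ (w : Ω → ℝ) (f : Ω → ℝ), ∑ ω, w ω * f ω =
        (∑ ω, w ω) * ∑ ω, ν ω * f ω + ∑ ω, (w ω - (∑ ω', w ω') * ν ω) * f ω := fun w f => by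
      rw [Finset.mul_sum, ← Finset.sum_add_distrib]
      exact Finset.sum_congr rfl fun ω _ => by ring
    by_cases ha : a ∈ optActions uR z ν
    · refine ⟨B, hB0, fun w hw _ => ?_⟩
      have h1 := robustPayoff_le uS uR ha
      have h2 := (abs_le.1 (abs_sum_mul_le (w := fun ω => w ω - (∑ ω', w ω') * ν ω)
        (fun ω => hB ω a z))).1
      have h3 := mul_le_mul_of_nonneg_left h1
        (Finset.sum_nonneg fun ω (_ : ω ∈ Finset.univ) => hw ω)
      rw [hdec w]
      linarith
    · simp only [optActions, Set.mem_ofPred_eq, not_forall, not_le] at ha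
      obtain ⟨b, hb⟩ := ha
      set g := ∑ ω, ν ω * uR ω b z - ∑ ω, ν ω * uR ω a z with hg
      have hg0 : 0 < g := by rw [hg]; linarith
      -- Optimality of `a` at `w` forces `s * g ≤ 2 * R * D`, while the payoffs to be compared
      -- differ by at most `2 * B * s`.
      refine ⟨2 * B * (2 * R) / g, by positivity, fun w hw hopt => ?_⟩
      set s := ∑ ω, w ω
      set D := ∑ ω, |w ω - s * ν ω| with hD
      have hs : 0 ≤ s := Finset.sum_nonneg fun ω _ => hw ω
      have h1 : s * g ≤ 2 * R * D := by
        have e1 := hopt b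
        rw [hdec w, hdec w (fun ω => uR ω a z)] at e1
        have e2 := (abs_le.1 (abs_sum_mul_le (w := fun ω => w ω - s * ν ω)
          (fun ω => hR ω a z))).2
        have e3 := (abs_le.1 (abs_sum_mul_le (w := fun ω => w ω - s * ν ω)
          (fun ω => hR ω b z))).1
        rw [hg, mul_sub]
        linarith
      have h2 : s ≤ 2 * R * D / g := by rwa [le_div_iff₀ hg0]
      have h3 := (abs_le.1 (abs_robustPayoff_le (z := z) uR hB hν)).2
      have h4 : -(B * s) ≤ ∑ ω, w ω * uS ω a z := by
        have := (abs_le.1 (abs_sum_mul_le (w := w) (fun ω => hB ω a z))).1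
        rwa [Finset.sum_congr rfl fun i _ => abs_of_nonneg (hw i)] at this
      have h5 : s * robustPayoff uS uR z ν ≤ s * B := mul_le_mul_of_nonneg_left h3 hs
      have h6 : 2 * B * s ≤ 2 * B * (2 * R * D / g) := by gcongr
      have h7 : 2 * B * (2 * R) / g * D = 2 * B * (2 * R * D / g) := by ring
      rw [h7]
      linarith
  choose K hK0 hK using key
  refine ⟨∑ a, K a, Finset.sum_nonneg fun a _ => hK0 a, fun w hw a ha => ?_⟩
  have h1 := hK a w hw ha
  have h2 : K a ≤ ∑ a, K a := Finset.single_le_sum (fun a _ => hK0 a) (Finset.mem_univ a)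
  have h3 : 0 ≤ ∑ ω, |w ω - (∑ ω', w ω') * ν ω| := Finset.sum_nonneg fun _ _ => abs_nonneg _
  nlinarith

end RobustPayoff

/-! ### The game: separability and basic strategies -/

section Game

variable {Ω A Z X Y : Type*} [Fintype Ω] [Fintype A] [Fintype X] [Fintype Y]

/-- Joint law of the states and of the outputs of the channel. -/
noncomputable def jointLaw {n k : ℕ} (μ : Z → Ω → ℝ) (Q : X → Y → ℝ) (z : Fin n → Z)
    (σ : (Fin n → Ω) → (Fin k → X) → ℝ) (ω : Fin n → Ω) (y : Fin k → Y) : ℝ :=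
  ∑ x, seqPrior μ z ω * σ ω x * seqChannel Q x y

variable {n k : ℕ} {μ : Z → Ω → ℝ} {Q : X → Y → ℝ} {z : Fin n → Z}
  {σ : (Fin n → Ω) → (Fin k → X) → ℝ}

lemma seqPrior_mem (hμ : ∀ z, μ z ∈ stdSimplex ℝ Ω) (z : Fin n → Z) :
    seqPrior μ z ∈ stdSimplex ℝ (Fin n → Ω) :=
  prod_mem_stdSimplex fun t => hμ (z t)

lemma jointLaw_nonneg (hμ : ∀ z, μ z ∈ stdSimplex ℝ Ω) (hQ : ∀ x, Q x ∈ stdSimplex ℝ Y)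
    (hσ : σ ∈ senderStrategies Ω X n k) (ω : Fin n → Ω) (y : Fin k → Y) :
    0 ≤ jointLaw μ Q z σ ω y :=
  Finset.sum_nonneg fun x _ => mul_nonneg (mul_nonneg ((seqPrior_mem hμ z).1 ω) ((hσ ω).1 x))
    ((seqChannel_mem hQ x).1 y)

lemma sum_jointLaw (hQ : ∀ x, Q x ∈ stdSimplex ℝ Y) (hσ : σ ∈ senderStrategies Ω X n k)
    (ω : Fin n → Ω) : ∑ y, jointLaw μ Q z σ ω y = seqPrior μ z ω := by
  simp only [jointLaw]
  rw [Finset.sum_comm]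
  simp_rw [← Finset.mul_sum, (seqChannel_mem hQ _).2, mul_one, ← Finset.mul_sum, (hσ ω).2, mul_one]

lemma sum_sum_jointLaw (hμ : ∀ z, μ z ∈ stdSimplex ℝ Ω) (hQ : ∀ x, Q x ∈ stdSimplex ℝ Y)
    (hσ : σ ∈ senderStrategies Ω X n k) : ∑ y, ∑ ω, jointLaw μ Q z σ ω y = 1 := by
  rw [Finset.sum_comm]
  simp_rw [sum_jointLaw hQ hσ]
  exact (seqPrior_mem hμ z).2

lemma sum_marg_jointLaw (hμ : ∀ z, μ z ∈ stdSimplex ℝ Ω) (hQ : ∀ x, Q x ∈ stdSimplex ℝ Y)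
    (hσ : σ ∈ senderStrategies Ω X n k) (t : Fin n) (a : Ω) :
    ∑ y, marg (jointLaw μ Q z σ) t a y = μ (z t) a := by
  rw [sum_marg_out]
  simp_rw [sum_jointLaw hQ hσ]
  have h := sum_pi_prod_mul (w := fun t => μ (z t)) (fun t => (hμ (z t)).2) t
    (fun b => if b = a then 1 else 0)
  simp only [mul_ite, mul_one, mul_zero, Finset.sum_ite_eq', Finset.mem_univ, if_true] at h
  rw [← h, Finset.sum_filter]
  rfl

/-- Average payoffs are additive over the problems, so the strategy matters only through the joint
laws of each single state with the outputs. -/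
lemma sum_payoff (u : Ω → A → Z → ℝ) (y : Fin k → Y) (a : Fin n → A) :
    ∑ ω, ∑ x, seqPrior μ z ω * σ ω x * seqChannel Q x y * avgPayoff u z ω a =
      1 / n * ∑ t, ∑ b, marg (jointLaw μ Q z σ) t b y * u b (a t) (z t) := by
  simp_rw [sum_marg_mul, ← Finset.sum_mul]
  rw [Finset.sum_comm, Finset.mul_sum]
  refine Finset.sum_congr rfl fun ω _ => ?_
  rw [← Finset.mul_sum, avgPayoff, jointLaw]
  ring

lemma senderPayoff_eq (u : Ω → A → Z → ℝ) (τ : (Fin k → Y) → Fin n → A) :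
    senderPayoff u μ Q z σ τ =
      1 / n * ∑ t, ∑ y, ∑ b, marg (jointLaw μ Q z σ) t b y * u b (τ y t) (z t) := by
  rw [Finset.sum_comm, Finset.mul_sum]
  simp_rw [← sum_payoff u _ (τ _)]
  rw [senderPayoff, Finset.sum_comm]
  rw [Finset.sum_comm (s := (Finset.univ : Finset (Fin k → Y)))]
  rw [Finset.sum_comm]
  refine Finset.sum_congr rfl fun ω _ => ?_
  rw [Finset.sum_comm]

/-- By separability the receiver faces no trade-off between problems: deviating in one problem alone
tests optimality there. -/
lemma mem_bestReplies_iff (hn : 0 < n) {uR : Ω → A → Z → ℝ} {τ : (Fin k → Y) → Fin n → A} :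
    τ ∈ bestReplies uR μ Q z σ ↔ ∀ y t b,
      ∑ ω, marg (jointLaw μ Q z σ) t ω y * uR ω b (z t) ≤
        ∑ ω, marg (jointLaw μ Q z σ) t ω y * uR ω (τ y t) (z t) := by
  have hn' : (0 : ℝ) < 1 / n := by positivity
  simp only [bestReplies, Set.mem_ofPred_eq, sum_payoff, mul_le_mul_iff_right₀ hn']
  refine ⟨fun h y t b => ?_, fun h y a => Finset.sum_le_sum fun t _ => h y t (a t)⟩
  have h1 := h y (Function.update (τ y) t b)
  rw [← Finset.add_sum_erase _ _ (Finset.mem_univ t),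
    ← Finset.add_sum_erase (a := t) _ (fun t => ∑ ω, _ * uR ω (τ y t) (z t))
      (Finset.mem_univ t)] at h1
  have h2 : ∑ s ∈ Finset.univ.erase t, ∑ ω, marg (jointLaw μ Q z σ) s ω y *
      uR ω (Function.update (τ y) t b s) (z s) = ∑ s ∈ Finset.univ.erase t,
      ∑ ω, marg (jointLaw μ Q z σ) s ω y * uR ω (τ y s) (z s) := by
    refine Finset.sum_congr rfl fun s hs => ?_
    rw [Function.update_of_ne (Finset.ne_of_mem_erase hs)]
  rw [h2, Function.update_self] at h1
  linarith

lemma bestReplies_nonempty [Nonempty A] (uR : Ω → A → Z → ℝ) (μ : Z → Ω → ℝ) (Q : X → Y → ℝ)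
    (z : Fin n → Z) (σ : (Fin n → Ω) → (Fin k → X) → ℝ) :
    (bestReplies uR μ Q z σ).Nonempty := by
  choose τ hτ using fun y : Fin k → Y => Finite.exists_max fun a : Fin n → A =>
    ∑ ω, ∑ x, seqPrior μ z ω * σ ω x * seqChannel Q x y * avgPayoff uR z ω a
  exact ⟨τ, hτ⟩

lemma sInf_senderPayoff_le (uS uR : Ω → A → Z → ℝ) {τ : (Fin k → Y) → Fin n → A}
    (hτ : τ ∈ bestReplies uR μ Q z σ) :
    sInf (senderPayoff uS μ Q z σ '' bestReplies uR μ Q z σ) ≤ senderPayoff uS μ Q z σ τ :=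
  csInf_le (Set.toFinite _).bddBelow ⟨τ, hτ, rfl⟩

lemma senderPayoff_le [Fintype Z] (hμ : ∀ z, μ z ∈ stdSimplex ℝ Ω) (hQ : ∀ x, Q x ∈ stdSimplex ℝ Y)
    (hσ : σ ∈ senderStrategies Ω X n k) (hn : 0 < n) {uS : Ω → A → Z → ℝ} {B : ℝ}
    (hB : ∀ ω a z, |uS ω a z| ≤ B) (τ : (Fin k → Y) → Fin n → A) :
    senderPayoff uS μ Q z σ τ ≤ B := by
  have hn' : (0 : ℝ) < n := by positivity
  rw [senderPayoff_eq, one_div, inv_mul_le_iff₀ hn']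
  calc _ ≤ ∑ t : Fin n, ∑ y, ∑ b, marg (jointLaw μ Q z σ) t b y * B :=
        Finset.sum_le_sum fun t _ => Finset.sum_le_sum fun y _ => Finset.sum_le_sum fun b _ =>
          mul_le_mul_of_nonneg_left (abs_le.1 (hB _ _ _)).2
            (marg_nonneg (jointLaw_nonneg hμ hQ hσ) _ _ _)
    _ = n * B := by
        simp_rw [← Finset.sum_mul, sum_marg, sum_sum_jointLaw hμ hQ hσ]
        simp

lemma bddAbove_robust [Fintype Z] [Nonempty A] (hμ : ∀ z, μ z ∈ stdSimplex ℝ Ω)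
    (hQ : ∀ x, Q x ∈ stdSimplex ℝ Y) (hn : 0 < n) (uS uR : Ω → A → Z → ℝ) :
    BddAbove ((fun σ => sInf (senderPayoff uS μ Q z σ '' bestReplies uR μ Q z σ)) ''
      senderStrategies Ω X n k) := by
  obtain ⟨B, -, hB⟩ := exists_abs_payoff_le uS
  refine ⟨B, ?_⟩
  rintro _ ⟨σ, hσ, rfl⟩
  obtain ⟨τ, hτ⟩ := bestReplies_nonempty uR μ Q z σ
  exact (sInf_senderPayoff_le uS uR hτ).trans (senderPayoff_le hμ hQ hσ hn hB τ)

/-- Lower bound of the optimal robust payoff by means of a strategy such that the beliefs of the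
receiver are close to prescribed beliefs `β`. -/
lemma le_optimalRobustPayoff [Fintype Z] [Nonempty A] (hμ : ∀ z, μ z ∈ stdSimplex ℝ Ω)
    (hQ : ∀ x, Q x ∈ stdSimplex ℝ Y) (hσ : σ ∈ senderStrategies Ω X n k) (hn : 0 < n)
    {uS uR : Ω → A → Z → ℝ} {β : Fin n → (Fin k → Y) → Ω → ℝ} {K : ℝ}
    (hβ : ∀ t y, LowerBoundAt uS uR (z t) (β t y) K) :
    1 / n * (∑ y, (∑ ω, jointLaw μ Q z σ ω y) * (∑ t, robustPayoff uS uR (z t) (β t y)) -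
      K * ∑ t, ∑ y, ∑ a, |marg (jointLaw μ Q z σ) t a y -
        (∑ ω, jointLaw μ Q z σ ω y) * β t y a|) ≤
      optimalRobustPayoff uS uR μ Q k z := by
  refine le_trans ?_ (le_csSup (bddAbove_robust hμ hQ hn uS uR) ⟨σ, hσ, rfl⟩)
  refine le_csInf ((bestReplies_nonempty uR μ Q z σ).image _) ?_
  rintro _ ⟨τ, hτ, rfl⟩
  rw [senderPayoff_eq]
  refine mul_le_mul_of_nonneg_left ?_ (by positivity)
  simp_rw [Finset.mul_sum (s := (Finset.univ : Finset (Fin n)))]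
  rw [Finset.sum_comm, ← Finset.sum_sub_distrib]
  refine Finset.sum_le_sum fun t _ => ?_
  rw [Finset.mul_sum, ← Finset.sum_sub_distrib]
  refine Finset.sum_le_sum fun y _ => ?_
  have h := hβ t y (fun a => marg (jointLaw μ Q z σ) t a y)
    (fun a => marg_nonneg (jointLaw_nonneg hμ hQ hσ) _ _ _) (τ y t)
    ((mem_bestReplies_iff hn).1 hτ y t)
  rwa [sum_marg] at h

/-- Without information, the sender gets the robust payoff at the priors. -/
lemma sum_robustPayoff_prior_le [Fintype Z] [Nonempty A] [Nonempty X]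
    (hμ : ∀ z, μ z ∈ stdSimplex ℝ Ω) (hQ : ∀ x, Q x ∈ stdSimplex ℝ Y) (hn : 0 < n)
    (uS uR : Ω → A → Z → ℝ) :
    1 / n * ∑ t, robustPayoff uS uR (z t) (μ (z t)) ≤ optimalRobustPayoff uS uR μ Q k z := by
  choose K hK0 hK using fun z => exists_lowerBoundAt uS uR z (hμ z)
  -- A constant input makes the outputs independent of the states; the beliefs are then the priors
  -- and the error term vanishes.
  have x₀ : Fin k → X := fun _ => Classical.arbitrary X
  have hσ : (fun _ => Pi.single x₀ 1) ∈ senderStrategies Ω X n k :=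
    fun ω => single_mem_stdSimplex ℝ x₀
  have hW : ∀ ω y, jointLaw μ Q z (fun _ => Pi.single x₀ 1) ω y =
      seqPrior μ z ω * seqChannel Q x₀ y := fun ω y => by
    rw [jointLaw, Finset.sum_eq_single x₀] <;> simp +contextual
  have h := le_optimalRobustPayoff (z := z) hμ hQ hσ hn (uS := uS) (uR := uR)
    (β := fun t _ => μ (z t)) (K := ∑ z, K z) fun t y => (hK (z t)).mono
      (Finset.single_le_sum (fun z _ => hK0 z) (Finset.mem_univ _))
  refine le_trans (le_of_eq ?_) h
  congr 1
  rw [← Finset.sum_mul, sum_sum_jointLaw hμ hQ hσ, one_mul, eq_comm, sub_eq_self]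
  refine mul_eq_zero_of_right _ (Finset.sum_eq_zero fun t _ => Finset.sum_eq_zero fun y _ =>
    Finset.sum_eq_zero fun a _ => ?_)
  rw [abs_eq_zero, sub_eq_zero]
  simp_rw [hW, ← Finset.sum_mul, (seqPrior_mem hμ z).2, one_mul]
  rw [← sum_marg_jointLaw hμ hQ hσ t a, sum_marg_out]
  simp_rw [sum_jointLaw hQ hσ]
  simp only [marg, hW]
  rw [← Finset.sum_mul, mul_comm]

end Game

/-! ### Splittings and their information -/

section Splittings

variable {Ω : Type*} [Fintype Ω] {p : Ω → ℝ}

/-- A splitting indexed by an arbitrary finite type. -/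
noncomputable def Splitting.ofFintype {ι : Type*} [Fintype ι] {w : ι → ℝ} {ν : ι → Ω → ℝ}
    (hw : w ∈ stdSimplex ℝ ι) (hν : ∀ i, ν i ∈ stdSimplex ℝ Ω)
    (hp : ∀ ω, ∑ i, w i * ν i ω = p ω) : Splitting p where
  card := Fintype.card ι
  weight m := w ((Fintype.equivFin ι).symm m)
  posterior m := ν ((Fintype.equivFin ι).symm m)
  weight_mem := ⟨fun m => hw.1 _, by
    rw [(Fintype.equivFin ι).symm.sum_comp fun i => w i]; exact hw.2⟩
  posterior_mem m := hν _
  sum_eq := by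
    rw [(Fintype.equivFin ι).symm.sum_comp fun i => w i • ν i]
    ext ω
    simpa using hp ω

lemma Splitting.sum_ofFintype {ι : Type*} [Fintype ι] {w : ι → ℝ} {ν : ι → Ω → ℝ}
    (hw : w ∈ stdSimplex ℝ ι) (hν : ∀ i, ν i ∈ stdSimplex ℝ Ω)
    (hp : ∀ ω, ∑ i, w i * ν i ω = p ω) (f : (Ω → ℝ) → ℝ) :
    ∑ m, (Splitting.ofFintype hw hν hp).weight m * f ((Splitting.ofFintype hw hν hp).posterior m) =
      ∑ i, w i * f (ν i) :=
  (Fintype.equivFin ι).symm.sum_comp fun i => w i * f (ν i)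

lemma Splitting.sum_apply (s : Splitting p) (ω : Ω) :
    ∑ m, s.weight m * s.posterior m ω = p ω := by
  conv_rhs => rw [← s.sum_eq]
  simp

lemma Splitting.info_mul_log_two (s : Splitting p) :
    s.info * Real.log 2 =
      ∑ m, ∑ ω, s.weight m * s.posterior m ω * Real.log (s.posterior m ω / p ω) :=
  sum_mul_sum_mul_log_div s.weight_mem.1 (fun m => (s.posterior_mem m).1) s.sum_apply

lemma Splitting.posterior_eq_zero (s : Splitting p) {m : Fin s.card} (hm : s.weight m ≠ 0) {ω : Ω}
    (hω : p ω = 0) : s.posterior m ω = 0 := by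
  have h := s.sum_apply ω
  rw [hω, Finset.sum_eq_zero_iff_of_nonneg fun m _ =>
    mul_nonneg (s.weight_mem.1 m) ((s.posterior_mem m).1 ω)] at h
  exact (mul_eq_zero.1 (h m (Finset.mem_univ m))).resolve_left hm

/-- The information is the mean divergence of the posteriors from the prior, and each divergence
dominates a squared Hellinger distance. This gives nonnegativity of information, its equality case
and continuity at capacity zero. -/
lemma Splitting.sum_sq_sqrt_le (hp : p ∈ stdSimplex ℝ Ω) (s : Splitting p) :
    ∑ m, s.weight m * ∑ ω, (√(s.posterior m ω) - √(p ω)) ^ 2 ≤ s.info * Real.log 2 := by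
  rw [s.info_mul_log_two]
  refine Finset.sum_le_sum fun m _ => ?_
  by_cases hm : s.weight m = 0
  · simp [hm]
  simp_rw [mul_assoc]
  rw [← Finset.mul_sum]
  refine mul_le_mul_of_nonneg_left ?_ (s.weight_mem.1 m)
  have h := sum_sq_sqrt_sub_sqrt_le (s.posterior_mem m).1 hp.1
    fun ω hω => s.posterior_eq_zero hm hω
  rw [(s.posterior_mem m).2, hp.2] at h
  linarith

lemma Splitting.info_nonneg (hp : p ∈ stdSimplex ℝ Ω) (s : Splitting p) : 0 ≤ s.info := by
  have h := s.sum_sq_sqrt_le hp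
  have h0 : 0 ≤ ∑ m, s.weight m * ∑ ω, (√(s.posterior m ω) - √(p ω)) ^ 2 :=
    Finset.sum_nonneg fun m _ => mul_nonneg (s.weight_mem.1 m)
      (Finset.sum_nonneg fun ω _ => sq_nonneg _)
  exact nonneg_of_mul_nonneg_left (h0.trans h) (Real.log_pos one_lt_two)

/-- The splitting that reveals nothing. -/
noncomputable def Splitting.trivial (hp : p ∈ stdSimplex ℝ Ω) : Splitting p :=
  Splitting.ofFintype (ι := Unit) (w := fun _ => 1) (ν := fun _ => p)
    ⟨fun _ => zero_le_one, by simp⟩ (fun _ => hp) (by simp)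

lemma Splitting.sum_trivial (hp : p ∈ stdSimplex ℝ Ω) (f : (Ω → ℝ) → ℝ) :
    ∑ m, (Splitting.trivial hp).weight m * f ((Splitting.trivial hp).posterior m) = f p := by
  refine (Splitting.sum_ofFintype _ _ _ f).trans ?_
  simp

lemma Splitting.info_trivial (hp : p ∈ stdSimplex ℝ Ω) : (Splitting.trivial hp).info = 0 := by
  rw [Splitting.info, Splitting.sum_trivial hp entropy, sub_self]

variable {A Z : Type*} [Fintype A] [Fintype Z] [Nonempty A]
  {uS uR : Ω → A → Z → ℝ} {μ : Z → Ω → ℝ} {c : ℝ≥0∞} {π : Z → ℝ}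

lemma abs_sum_robustPayoff_le {B : ℝ} (hB : ∀ ω a z, |uS ω a z| ≤ B) (z : Z) (s : Splitting p) :
    |∑ m, s.weight m * robustPayoff uS uR z (s.posterior m)| ≤ B :=
  abs_sum_mul_le_of_mem s.weight_mem fun m => abs_robustPayoff_le uR hB (s.posterior_mem m)

lemma le_splittingValue (s : (z : Z) → Splitting (μ z))
    (h : ((∑ z, π z * (s z).info : ℝ) : EReal) ≤ (c : EReal)) :
    ∑ z, π z * ∑ m, (s z).weight m * robustPayoff uS uR z ((s z).posterior m) ≤
      splittingValue uS uR μ c π := by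
  refine le_csSup ?_ ⟨s, h, rfl⟩
  obtain ⟨B, -, hB⟩ := exists_abs_payoff_le uS
  refine ⟨B * ∑ z, |π z|, ?_⟩
  rintro _ ⟨s, -, rfl⟩
  exact (le_abs_self _).trans (abs_sum_mul_le fun z => abs_sum_robustPayoff_le hB z (s z))

/-- The trivial splittings carry no information and are feasible at every capacity, so the supremum
runs over a nonempty set. -/
lemma splittingValue_le (hμ : ∀ z, μ z ∈ stdSimplex ℝ Ω) {b : ℝ}
    (h : ∀ s : (z : Z) → Splitting (μ z), ((∑ z, π z * (s z).info : ℝ) : EReal) ≤ (c : EReal) →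
      ∑ z, π z * ∑ m, (s z).weight m * robustPayoff uS uR z ((s z).posterior m) ≤ b) :
    splittingValue uS uR μ c π ≤ b := by
  refine csSup_le ⟨_, fun z => Splitting.trivial (hμ z), ?_, rfl⟩ ?_
  · simpa [Splitting.info_trivial] using EReal.coe_ennreal_nonneg c
  · rintro _ ⟨s, hs, rfl⟩
    exact h s hs

lemma coe_le_ofReal_iff {x r : ℝ} (hr : 0 ≤ r) :
    (x : EReal) ≤ (ENNReal.ofReal r : EReal) ↔ x ≤ r := by
  rw [EReal.coe_ennreal_ofReal, max_eq_left hr, EReal.coe_le_coe_iff]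

end Splittings

/-! ### The upper bound -/

section Converse

/-- Log-sum inequality. -/
lemma sum_mul_log_sum_le {ι : Type*} [Fintype ι] {c d : ι → ℝ} (hc : ∀ i, 0 ≤ c i)
    (hd : ∀ i, 0 ≤ d i) (h : ∀ i, d i = 0 → c i = 0) :
    (∑ i, c i) * Real.log ((∑ i, c i) / ∑ i, d i) ≤ ∑ i, c i * Real.log (c i / d i) := by
  rcases (Finset.sum_nonneg fun i _ => hc i : 0 ≤ ∑ i, c i).eq_or_lt with h0 | h0
  · have h1 := (Finset.sum_eq_zero_iff_of_nonneg fun i _ => hc i).1 h0.symm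
    rw [← h0, zero_mul]
    exact (Finset.sum_eq_zero fun i hi => by rw [h1 i hi, zero_mul]).ge
  have hd0 : 0 < ∑ i, d i := by
    refine lt_of_le_of_ne (Finset.sum_nonneg fun i _ => hd i) fun h1 => h0.ne' ?_
    have h2 := (Finset.sum_eq_zero_iff_of_nonneg fun i _ => hd i).1 h1.symm
    exact Finset.sum_eq_zero fun i hi => h i (h2 i hi)
  have hr : 0 < (∑ i, c i) / ∑ i, d i := div_pos h0 hd0
  -- Gibbs' inequality for `c` against `d` rescaled to the same total mass.
  have hg := sum_sub_sum_le_sum_mul_log (p := c) (q := fun i => d i * ((∑ i, c i) / ∑ i, d i)) hc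
    (fun i => mul_nonneg (hd i) hr.le)
    (fun i hi => h i ((mul_eq_zero.1 hi).resolve_right hr.ne'))
  rw [← Finset.sum_mul, mul_div_cancel₀ _ hd0.ne', sub_self] at hg
  rw [← sub_nonneg]
  refine hg.trans_eq ?_
  rw [Finset.sum_mul, ← Finset.sum_sub_distrib]
  refine Finset.sum_congr rfl fun i _ => ?_
  by_cases hi : c i = 0
  · simp [hi]
  have hdi : d i ≠ 0 := fun hdi => hi (h i hdi)
  rw [← div_div, Real.log_div (div_ne_zero hi hdi) hr.ne']
  ring

lemma continuous_entropy {S : Type*} [Fintype S] : Continuous (entropy (S := S)) := by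
  have h : (entropy (S := S)) = fun q => -∑ s, q s * Real.log (q s) / Real.log 2 := by
    ext q
    simp only [entropy, Real.logb, mul_div_assoc]
  rw [h]
  refine (continuous_finsetSum _ fun s _ => ?_).neg
  exact (Real.continuous_mul_log.comp (continuous_apply s)).div_const _

variable {Ω A Z X Y : Type*} [Fintype Ω] [Fintype A] [Fintype X] [Fintype Y]

/-- Mutual information is continuous on a compact simplex, so the set defining the capacity is
bounded above. -/
lemma mutualInfo_le_capacity (Q : X → Y → ℝ) {p : X → ℝ} (hp : p ∈ stdSimplex ℝ X) :
    mutualInfo Q p ≤ capacity Q := by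
  have hc : Continuous (mutualInfo Q) := by
    unfold mutualInfo
    refine (continuous_entropy.comp ?_).sub ?_ <;> fun_prop
  exact le_csSup ((isCompact_stdSimplex ℝ X).image hc).bddAbove ⟨p, hp, rfl⟩

lemma capacity_nonneg [Nonempty X] (Q : X → Y → ℝ) : 0 ≤ capacity Q := by
  have x : X := Classical.arbitrary X
  refine le_trans (le_of_eq ?_) (mutualInfo_le_capacity Q (single_mem_stdSimplex ℝ x))
  simp [mutualInfo, Pi.single_apply]

variable {n k : ℕ} {μ : Z → Ω → ℝ} {Q : X → Y → ℝ} {z : Fin n → Z}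
  {σ : (Fin n → Ω) → (Fin k → X) → ℝ}

/-- The information that the outputs carry on the states is at most `k` times the capacity. -/
lemma sum_marg_jointLaw_mul_log_le (hμ : ∀ z, μ z ∈ stdSimplex ℝ Ω)
    (hQ : ∀ x, Q x ∈ stdSimplex ℝ Y) (hσ : σ ∈ senderStrategies Ω X n k) :
    ∑ t, ∑ y, ∑ a, marg (jointLaw μ Q z σ) t a y *
      Real.log (marg (jointLaw μ Q z σ) t a y / ((∑ ω, jointLaw μ Q z σ ω y) * μ (z t) a)) ≤
      k * (capacity Q * Real.log 2) := by
  have hP := seqPrior_mem hμ z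
  set W := jointLaw μ Q z σ with hW
  have hW0 : ∀ ω y, 0 ≤ W ω y := jointLaw_nonneg hμ hQ hσ
  set PX : (Fin k → X) → ℝ := fun x => ∑ ω, seqPrior μ z ω * σ ω x with hPX
  have hPX0 : ∀ x, 0 ≤ PX x := fun x =>
    Finset.sum_nonneg fun ω _ => mul_nonneg (hP.1 ω) ((hσ ω).1 x)
  have hPX1 : ∑ x, PX x = 1 := by
    simp only [hPX]
    rw [Finset.sum_comm]
    simp_rw [← Finset.mul_sum, (hσ _).2, mul_one]
    exact hP.2
  -- The law of the input at time `s`; `Unit` stands for an absent second component. Below, `qs s`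
  -- is the corresponding law of the output.
  set p : Fin k → X → ℝ := fun s a => marg (fun x (_ : Unit) => PX x) s a () with hp
  have hpm : ∀ s, p s ∈ stdSimplex ℝ X := fun s =>
    ⟨fun a => marg_nonneg (fun x _ => hPX0 x) _ _ _, by
      simp only [hp]; rw [sum_marg]; exact hPX1⟩
  set qs : Fin k → Y → ℝ := fun s b => ∑ a, p s a * Q a b with hqs
  have hqs0 : ∀ s b, 0 ≤ qs s b := fun s b =>
    Finset.sum_nonneg fun a _ => mul_nonneg ((hpm s).1 a) ((hQ a).1 b)
  have hqsm : ∀ s, qs s ∈ stdSimplex ℝ Y := fun s => ⟨hqs0 s, by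
    simp only [hqs]
    rw [Finset.sum_comm]
    simp_rw [← Finset.mul_sum, (hQ _).2, mul_one]
    exact (hpm s).2⟩
  have hterm0 : ∀ ω x y, 0 ≤ seqPrior μ z ω * σ ω x * seqChannel Q x y := fun ω x y =>
    mul_nonneg (mul_nonneg (hP.1 ω) ((hσ ω).1 x)) ((seqChannel_mem hQ x).1 y)
  have hQne : ∀ (x : Fin k → X) (y : Fin k → Y), seqChannel Q x y ≠ 0 → ∀ s, Q (x s) (y s) ≠ 0 :=
    fun x y h s => Finset.prod_ne_zero_iff.1 h s (Finset.mem_univ s)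
  have hsupp : ∀ ω x y, seqPrior μ z ω * σ ω x * seqChannel Q x y ≠ 0 → ∀ s, qs s (y s) ≠ 0 := by
    intro ω x y h s
    have h1 := left_ne_zero_of_mul h
    have h2 : 0 < PX x := (lt_of_le_of_ne (mul_nonneg (hP.1 ω) ((hσ ω).1 x)) h1.symm).trans_le
      (Finset.single_le_sum (f := fun ω => seqPrior μ z ω * σ ω x)
        (fun ω _ => mul_nonneg (hP.1 ω) ((hσ ω).1 x)) (Finset.mem_univ ω))
    have h3 : 0 < p s (x s) := h2.trans_le (le_marg (fun x _ => hPX0 x) s x ())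
    have h4 : 0 < Q (x s) (y s) := lt_of_le_of_ne ((hQ _).1 _)
      (Ne.symm (hQne x y (right_ne_zero_of_mul h) s))
    exact ((mul_pos h3 h4).trans_le (Finset.single_le_sum (f := fun a => p s a * Q a (y s))
      (fun a _ => mul_nonneg ((hpm s).1 a) ((hQ a).1 _)) (Finset.mem_univ (x s)))).ne'
  -- The reference law is the product of the output marginals, not the output law itself. The
  -- divergence then splits over the uses of the channel without further loss.
  set q : (Fin k → Y) → ℝ := fun y => ∏ s, qs s (y s) with hq
  have hqm : q ∈ stdSimplex ℝ (Fin k → Y) := prod_mem_stdSimplex hqsm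
  have hsq : ∀ ω x y, seqPrior μ z ω * σ ω x * seqChannel Q x y ≠ 0 → q y ≠ 0 :=
    fun ω x y h => Finset.prod_ne_zero_iff.2 fun s _ => hsupp ω x y h s
  have hstep1 := sum_marg_mul_log_le (W := W) (q := q) (ν := fun t _ => μ (z t)) hW0 hqm.1
    (by rw [hqm.2, sum_sum_jointLaw hμ hQ hσ])
    (fun ω y h => by
      obtain ⟨x, -, hx⟩ := Finset.exists_ne_zero_of_sum_ne_zero h
      exact hsq ω x y hx)
    (fun ω y t h => by
      obtain ⟨x, -, hx⟩ := Finset.exists_ne_zero_of_sum_ne_zero h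
      exact Finset.prod_ne_zero_iff.1 (left_ne_zero_of_mul (left_ne_zero_of_mul hx)) t
        (Finset.mem_univ t))
  refine hstep1.trans ?_
  -- Data processing: the log-sum inequality over the inputs `x` replaces the law of states and
  -- outputs by that of states, inputs and outputs, whose density ratio involves only the channel.
  have hstep2 : ∀ y ω, W ω y * Real.log (W ω y / (q y * ∏ t, μ (z t) (ω t))) ≤
      ∑ x, seqPrior μ z ω * σ ω x * (seqChannel Q x y * ∑ s, Real.log (Q (x s) (y s) /
        qs s (y s))) := by
    intro y ω
    have h := sum_mul_log_sum_le (c := fun x => seqPrior μ z ω * σ ω x * seqChannel Q x y)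
      (d := fun x => seqPrior μ z ω * σ ω x * q y) (hterm0 ω · y)
      (fun x => mul_nonneg (mul_nonneg (hP.1 ω) ((hσ ω).1 x)) (hqm.1 y)) (fun x hx => by
        by_contra hne
        exact (mul_ne_zero (left_ne_zero_of_mul hne) (hsq ω x y hne)) hx)
    have hd : ∑ x, seqPrior μ z ω * σ ω x * q y = q y * ∏ t, μ (z t) (ω t) := by
      rw [← Finset.sum_mul, ← Finset.mul_sum, (hσ ω).2, mul_one, mul_comm]
      rfl
    rw [hd] at h
    refine h.trans_eq (Finset.sum_congr rfl fun x _ => ?_)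
    by_cases hne : seqPrior μ z ω * σ ω x * seqChannel Q x y = 0
    · rw [← mul_assoc, hne]; simp
    rw [mul_div_mul_left _ _ (left_ne_zero_of_mul hne), mul_assoc, mul_assoc, mul_assoc]
    congr 3
    rw [← Real.log_prod fun s _ => div_ne_zero (hQne x y (right_ne_zero_of_mul hne) s)
      (hsupp ω x y hne s), Finset.prod_div_distrib]
    rfl
  calc _ ≤ ∑ y, ∑ ω, ∑ x, seqPrior μ z ω * σ ω x * (seqChannel Q x y *
          ∑ s, Real.log (Q (x s) (y s) / qs s (y s))) :=
        Finset.sum_le_sum fun y _ => Finset.sum_le_sum fun ω _ => hstep2 y ω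
    _ = ∑ x, PX x * ∑ y, seqChannel Q x y * ∑ s, Real.log (Q (x s) (y s) / qs s (y s)) := by
        rw [Finset.sum_comm]
        simp_rw [Finset.sum_comm (s := (Finset.univ : Finset (Fin k → Y)))]
        rw [Finset.sum_comm]
        refine Finset.sum_congr rfl fun x _ => ?_
        simp_rw [← Finset.mul_sum]
        rw [hPX, Finset.sum_mul]
    _ = ∑ x, PX x * ∑ s, ∑ b, Q (x s) b * Real.log (Q (x s) b / qs s b) := by
        refine Finset.sum_congr rfl fun x _ => ?_
        congr 1
        exact sum_pi_prod_mul_sum (w := fun s => Q (x s)) (fun s => (hQ _).2)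
          fun s b => Real.log (Q (x s) b / qs s b)
    _ = ∑ s, ∑ a, p s a * ∑ b, Q a b * Real.log (Q a b / qs s b) := by
        simp_rw [Finset.mul_sum (s := (Finset.univ : Finset (Fin k)))]
        rw [Finset.sum_comm]
        refine Finset.sum_congr rfl fun s _ => ?_
        exact (sum_marg_mul (fun x (_ : Unit) => PX x) s ()
          fun a => ∑ b, Q a b * Real.log (Q a b / qs s b)).symm
    _ = ∑ s, mutualInfo Q (p s) * Real.log 2 := by
        refine Finset.sum_congr rfl fun s _ => ?_
        have h := sum_mul_sum_mul_log_div (p := p s) (K := Q) (q := qs s) (hpm s).1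
          (fun a => (hQ a).1) fun _ => rfl
        rw [mutualInfo, h]
        simp_rw [Finset.mul_sum, mul_assoc]
    _ ≤ ∑ _s : Fin k, capacity Q * Real.log 2 := by
        refine Finset.sum_le_sum fun s _ => ?_
        exact mul_le_mul_of_nonneg_right (mutualInfo_le_capacity Q (hpm s))
          (Real.log_pos one_lt_two).le
    _ = _ := by simp

lemma sum_empFreq_mul [Fintype Z] (z : Fin n → Z) (f : Z → ℝ) :
    ∑ z₀, empFreq z z₀ * f z₀ = 1 / n * ∑ t, f (z t) := by
  have h : ∀ z₀, empFreq z z₀ * f z₀ = 1 / n * ∑ t, if z t = z₀ then f z₀ else 0 := fun z₀ => by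
    rw [empFreq, Nat.card_eq_fintype_card, Fintype.card_subtype, Finset.sum_ite]
    simp
    ring
  simp_rw [h]
  rw [← Finset.mul_sum, Finset.sum_comm]
  simp

/-- Belief of the receiver on the state of the problem `t` after the outputs `y`. -/
noncomputable def belief (μ : Z → Ω → ℝ) (Q : X → Y → ℝ) (z : Fin n → Z)
    (σ : (Fin n → Ω) → (Fin k → X) → ℝ) (t : Fin n) (y : Fin k → Y) : Ω → ℝ :=
  -- The default at outputs of probability zero makes the belief a probability distribution
  -- everywhere.
  if ∑ ω, jointLaw μ Q z σ ω y = 0 then μ (z t)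
  else fun a => marg (jointLaw μ Q z σ) t a y / ∑ ω, jointLaw μ Q z σ ω y

/-- At outputs of probability zero both sides vanish, so the default value is harmless. -/
lemma mul_belief (hμ : ∀ z, μ z ∈ stdSimplex ℝ Ω) (hQ : ∀ x, Q x ∈ stdSimplex ℝ Y)
    (hσ : σ ∈ senderStrategies Ω X n k) (t : Fin n) (y : Fin k → Y) (a : Ω) :
    (∑ ω, jointLaw μ Q z σ ω y) * belief μ Q z σ t y a = marg (jointLaw μ Q z σ) t a y := by
  by_cases h : ∑ ω, jointLaw μ Q z σ ω y = 0
  · rw [h, zero_mul]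
    rw [← sum_marg _ t, Finset.sum_eq_zero_iff_of_nonneg fun a _ =>
      marg_nonneg (jointLaw_nonneg hμ hQ hσ) t a y] at h
    exact (h a (Finset.mem_univ a)).symm
  · rw [belief, if_neg h, mul_div_cancel₀ _ h]

lemma belief_mem (hμ : ∀ z, μ z ∈ stdSimplex ℝ Ω) (hQ : ∀ x, Q x ∈ stdSimplex ℝ Y)
    (hσ : σ ∈ senderStrategies Ω X n k) (t : Fin n) (y : Fin k → Y) :
    belief μ Q z σ t y ∈ stdSimplex ℝ Ω := by
  rw [belief]
  split_ifs with h
  · exact hμ _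
  · refine ⟨fun a => div_nonneg (marg_nonneg (jointLaw_nonneg hμ hQ hσ) t a y)
      (Finset.sum_nonneg fun ω _ => jointLaw_nonneg hμ hQ hσ ω y), ?_⟩
    rw [← Finset.sum_div, sum_marg, div_self h]

/-- The splitting of the prior of type `z₀` by the beliefs on the problems of this type. -/
lemma exists_splitting_belief (hμ : ∀ z, μ z ∈ stdSimplex ℝ Ω) (hQ : ∀ x, Q x ∈ stdSimplex ℝ Y)
    (hσ : σ ∈ senderStrategies Ω X n k) (z₀ : Z) :
    ∃ s : Splitting (μ z₀), ∀ f : (Ω → ℝ) → ℝ,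
      empFreq z z₀ * ∑ m, s.weight m * f (s.posterior m) =
        1 / n * ∑ t, if z t = z₀ then
          ∑ y, (∑ ω, jointLaw μ Q z σ ω y) * f (belief μ Q z σ t y) else 0 := by
  set N : ℝ := ∑ t, if z t = z₀ then 1 else 0 with hN
  have hNe : empFreq z z₀ = N / n := by
    rw [empFreq, Nat.card_eq_fintype_card, Fintype.card_subtype, hN, Finset.sum_boole]
  have hN0 : 0 ≤ N := Finset.sum_nonneg fun t _ => by split_ifs <;> simp
  rcases hN0.eq_or_lt with h0 | hpos
  · refine ⟨Splitting.trivial (hμ z₀), fun f => ?_⟩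
    rw [hNe, ← h0, zero_div, zero_mul, eq_comm]
    refine mul_eq_zero_of_right _ (Finset.sum_eq_zero fun t ht => ?_)
    have h1 := (Finset.sum_eq_zero_iff_of_nonneg fun t _ => by split_ifs <;> simp).1 h0.symm t ht
    rw [if_neg fun h => by simp [h] at h1]
  set W := jointLaw μ Q z σ
  -- Messages are pairs of a problem and an output: a problem of type `z₀` is drawn uniformly, and
  -- the output according to its law.
  set w : Fin n × (Fin k → Y) → ℝ := fun i => if z i.1 = z₀ then (∑ ω, W ω i.2) / N else 0 with hw
  have hwm : w ∈ stdSimplex ℝ (Fin n × (Fin k → Y)) := by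
    refine ⟨fun i => ?_, ?_⟩
    · simp only [hw]
      split_ifs
      · exact div_nonneg (Finset.sum_nonneg fun ω _ => jointLaw_nonneg hμ hQ hσ ω _) hN0
      · exact le_rfl
    · rw [Fintype.sum_prod_type]
      have : ∀ t, ∑ y, w (t, y) = (if z t = z₀ then 1 else 0) / N := fun t => by
        simp only [hw]
        split_ifs
        · rw [← Finset.sum_div, sum_sum_jointLaw hμ hQ hσ]
        · simp
      simp_rw [this]
      rw [← Finset.sum_div, ← hN, div_self hpos.ne']
  have hsum : ∀ g : Fin n → (Fin k → Y) → ℝ, ∑ i, w i * g i.1 i.2 =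
      1 / N * ∑ t, if z t = z₀ then ∑ y, (∑ ω, W ω y) * g t y else 0 := fun g => by
    rw [Fintype.sum_prod_type, Finset.mul_sum]
    refine Finset.sum_congr rfl fun t _ => ?_
    simp only [hw]
    split_ifs
    · rw [Finset.mul_sum]
      exact Finset.sum_congr rfl fun y _ => by ring
    · simp
  refine ⟨Splitting.ofFintype hwm (ν := fun i => belief μ Q z σ i.1 i.2)
    (fun i => belief_mem hμ hQ hσ _ _) fun a => ?_, fun f => ?_⟩
  · rw [hsum fun t y => belief μ Q z σ t y a]
    simp_rw [W, mul_belief hμ hQ hσ, sum_marg_jointLaw hμ hQ hσ]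
    have : ∀ t, (if z t = z₀ then μ (z t) a else 0) = (if z t = z₀ then 1 else 0) * μ z₀ a :=
      fun t => by split_ifs with h <;> simp [h]
    simp_rw [this]
    rw [← Finset.sum_mul, ← hN]
    field_simp
  · rw [Splitting.sum_ofFintype, hsum fun t y => f (belief μ Q z σ t y), hNe]
    field_simp

/-- Upper bound of the payoff for a fixed strategy of the sender. -/
lemma sInf_senderPayoff_le_splittingValue [Fintype Z] [Nonempty A] [Nonempty X]
    (hμ : ∀ z, μ z ∈ stdSimplex ℝ Ω)
    (hQ : ∀ x, Q x ∈ stdSimplex ℝ Y) (hn : 0 < n) (hσ : σ ∈ senderStrategies Ω X n k)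
    (uS uR : Ω → A → Z → ℝ) :
    sInf (senderPayoff uS μ Q z σ '' bestReplies uR μ Q z σ) ≤
      splittingValue uS uR μ ((k : ℝ≥0∞) / (n : ℝ≥0∞) * ENNReal.ofReal (capacity Q))
        (empFreq z) := by
  have hn' : (0 : ℝ) < n := by exact_mod_cast hn
  have hl2 : 0 < Real.log 2 := Real.log_pos one_lt_two
  choose a ha hau using fun (t : Fin n) (y : Fin k → Y) =>
    exists_robustPayoff_eq uS uR (z t) (belief μ Q z σ t y)
  have hWY : ∀ y, 0 ≤ ∑ ω, jointLaw μ Q z σ ω y := fun y =>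
    Finset.sum_nonneg fun ω _ => jointLaw_nonneg hμ hQ hσ ω y
  -- In every problem this reply picks an optimal action that is worst for the sender; the payoff is
  -- then the mean robust payoff at the beliefs.
  have hτ : (fun y t => a t y) ∈ bestReplies uR μ Q z σ := by
    rw [mem_bestReplies_iff hn]
    intro y t b
    simp_rw [← mul_belief hμ hQ hσ, mul_assoc, ← Finset.mul_sum]
    exact mul_le_mul_of_nonneg_left (ha t y b) (hWY y)
  refine (sInf_senderPayoff_le uS uR hτ).trans ?_
  choose s hs using exists_splitting_belief (z := z) hμ hQ hσ
  have hkn : (k : ℝ≥0∞) / (n : ℝ≥0∞) * ENNReal.ofReal (capacity Q) =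
      ENNReal.ofReal (k / n * capacity Q) := by
    rw [ENNReal.ofReal_mul (by positivity), ENNReal.ofReal_div_of_pos hn']
    simp
  have hcollect : ∀ f : Z → (Ω → ℝ) → ℝ,
      ∑ z₀, empFreq z z₀ * ∑ m, (s z₀).weight m * f z₀ ((s z₀).posterior m) =
        1 / n * ∑ t, ∑ y, (∑ ω, jointLaw μ Q z σ ω y) * f (z t) (belief μ Q z σ t y) := by
    intro f
    simp_rw [hs]
    rw [← Finset.mul_sum, Finset.sum_comm]
    simp
  refine le_trans (le_of_eq ?_) (le_splittingValue s ?_)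
  · rw [hcollect (robustPayoff uS uR), senderPayoff_eq]
    congr 1
    refine Finset.sum_congr rfl fun t _ => Finset.sum_congr rfl fun y _ => ?_
    rw [hau, Finset.mul_sum]
    simp_rw [← mul_belief hμ hQ hσ, mul_assoc]
  · rw [hkn, coe_le_ofReal_iff (mul_nonneg (by positivity) (capacity_nonneg Q))]
    have h1 : ∑ z₀, empFreq z z₀ * (s z₀).info = 1 / n * ∑ t, (entropy (μ (z t)) -
        ∑ y, (∑ ω, jointLaw μ Q z σ ω y) * entropy (belief μ Q z σ t y)) := by
      simp_rw [Splitting.info, mul_sub]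
      rw [Finset.sum_sub_distrib, hcollect (fun _ => entropy),
        sum_empFreq_mul z (fun z => entropy (μ z)), Finset.sum_sub_distrib, mul_sub]
    have h2 : ∀ t, (entropy (μ (z t)) - ∑ y, (∑ ω, jointLaw μ Q z σ ω y) *
        entropy (belief μ Q z σ t y)) * Real.log 2 =
        ∑ y, ∑ a, marg (jointLaw μ Q z σ) t a y * Real.log (marg (jointLaw μ Q z σ) t a y /
          ((∑ ω, jointLaw μ Q z σ ω y) * μ (z t) a)) := fun t => by
      rw [sum_mul_sum_mul_log_div hWY (fun y => (belief_mem hμ hQ hσ t y).1) (fun a => by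
        simp_rw [mul_belief hμ hQ hσ]; exact sum_marg_jointLaw hμ hQ hσ t a)]
      refine Finset.sum_congr rfl fun y _ => Finset.sum_congr rfl fun a _ => ?_
      rw [← mul_belief hμ hQ hσ]
      by_cases h : ∑ ω, jointLaw μ Q z σ ω y = 0
      · simp [h]
      · rw [mul_div_mul_left _ _ h]
    rw [h1, one_div, inv_mul_le_iff₀ hn']
    refine le_of_mul_le_mul_right ?_ hl2
    rw [Finset.sum_mul]
    simp_rw [h2]
    refine (sum_marg_jointLaw_mul_log_le hμ hQ hσ).trans_eq ?_
    field_simp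

lemma optimalRobustPayoff_le_splittingValue [Fintype Z] [Nonempty A] [Nonempty X]
    (hμ : ∀ z, μ z ∈ stdSimplex ℝ Ω) (hQ : ∀ x, Q x ∈ stdSimplex ℝ Y) (hn : 0 < n)
    (uS uR : Ω → A → Z → ℝ) (k : ℕ) (z : Fin n → Z) :
    optimalRobustPayoff uS uR μ Q k z ≤
      splittingValue uS uR μ ((k : ℝ≥0∞) / (n : ℝ≥0∞) * ENNReal.ofReal (capacity Q))
        (empFreq z) := by
  refine csSup_le (Set.Nonempty.image _ ⟨fun _ => Pi.single (fun _ => Classical.arbitrary X) 1,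
    fun _ => single_mem_stdSimplex ℝ _⟩) ?_
  rintro _ ⟨σ, hσ, rfl⟩
  exact sInf_senderPayoff_le_splittingValue hμ hQ hn hσ uS uR

end Converse

/-! ### Continuity of the value in the capacity and in the type distribution -/

section Continuity

variable {Ω A Z : Type*} [Fintype Ω] [Fintype A] [Fintype Z] [Nonempty A]
  {uS uR : Ω → A → Z → ℝ} {μ : Z → Ω → ℝ} {π π' : Z → ℝ} {B : ℝ}

lemma sum_robustPayoff_le_add (hB : ∀ ω a z, |uS ω a z| ≤ B) (s : (z : Z) → Splitting (μ z)) :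
    ∑ z, π' z * ∑ m, (s z).weight m * robustPayoff uS uR z ((s z).posterior m) ≤
      ∑ z, π z * ∑ m, (s z).weight m * robustPayoff uS uR z ((s z).posterior m) +
        B * ∑ z, |π' z - π z| := by
  have h := (abs_le.1 (abs_sum_mul_le (w := fun z => π' z - π z)
    fun z => abs_sum_robustPayoff_le (uR := uR) hB z (s z))).2
  simp_rw [sub_mul] at h
  rw [Finset.sum_sub_distrib] at h
  linarith

lemma splittingValue_le_top (hμ : ∀ z, μ z ∈ stdSimplex ℝ Ω) (hB : ∀ ω a z, |uS ω a z| ≤ B)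
    (c : ℝ≥0∞) :
    splittingValue uS uR μ c π' ≤ splittingValue uS uR μ ⊤ π + B * ∑ z, |π' z - π z| :=
  splittingValue_le hμ fun s _ => (sum_robustPayoff_le_add hB s).trans
    (by gcongr; exact le_splittingValue s (by simp))

/-- Comparison of the values at two distributions of types and two capacities. -/
lemma splittingValue_le_add (hμ : ∀ z, μ z ∈ stdSimplex ℝ Ω) (hB : ∀ ω a z, |uS ω a z| ≤ B)
    {δ c c' : ℝ} (hδ : 0 ≤ δ) (hc : 0 ≤ c) (hcc' : (1 + δ) * c ≤ c')
    (hπ : ∀ z, π z ≤ (1 + δ) * π' z) :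
    splittingValue uS uR μ (ENNReal.ofReal c) π' ≤
      splittingValue uS uR μ (ENNReal.ofReal c') π + B * ∑ z, |π' z - π z| := by
  refine splittingValue_le hμ fun s hs => (sum_robustPayoff_le_add (π := π) hB s).trans ?_
  gcongr
  refine le_splittingValue s ?_
  rw [coe_le_ofReal_iff hc] at hs
  rw [coe_le_ofReal_iff (le_trans (by positivity) hcc')]
  -- Since information is nonnegative, a multiplicative comparison of the frequencies transfers
  -- feasibility without any bound on the information.
  calc ∑ z, π z * (s z).info ≤ ∑ z, (1 + δ) * π' z * (s z).info :=
        Finset.sum_le_sum fun z _ =>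
          mul_le_mul_of_nonneg_right (hπ z) ((s z).info_nonneg (hμ z))
    _ = (1 + δ) * ∑ z, π' z * (s z).info := by simp_rw [Finset.mul_sum, mul_assoc]
    _ ≤ (1 + δ) * c := by gcongr
    _ ≤ c' := hcc'

lemma mix_weight_mem {p : Ω → ℝ} (s : Splitting p) {θ : ℝ} (hθ0 : 0 ≤ θ) (hθ1 : θ ≤ 1) :
    (fun i : Option (Fin s.card) => i.elim θ fun m => (1 - θ) * s.weight m) ∈
      stdSimplex ℝ (Option (Fin s.card)) := by
  refine ⟨fun i => ?_, ?_⟩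
  · rcases i with _ | m
    · exact hθ0
    · exact mul_nonneg (by linarith) (s.weight_mem.1 m)
  · rw [Fintype.sum_option]
    simp only [Option.elim_none, Option.elim_some]
    rw [← Finset.mul_sum, s.weight_mem.2]
    ring

/-- The prior is kept with probability `θ` and split otherwise. With `f` the entropy, this
multiplies the information by exactly `1 - θ`. -/
lemma exists_mix {p : Ω → ℝ} (hp : p ∈ stdSimplex ℝ Ω) (s : Splitting p) {θ : ℝ} (hθ0 : 0 ≤ θ)
    (hθ1 : θ ≤ 1) : ∃ s' : Splitting p, ∀ f : (Ω → ℝ) → ℝ,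
      ∑ m, s'.weight m * f (s'.posterior m) =
        θ * f p + (1 - θ) * ∑ m, s.weight m * f (s.posterior m) := by
  refine ⟨Splitting.ofFintype (mix_weight_mem s hθ0 hθ1)
    (ν := fun i => i.elim p fun m => s.posterior m) (fun i => ?_) (fun ω => ?_), fun f => ?_⟩
  · rcases i with _ | m
    · exact hp
    · exact s.posterior_mem m
  · rw [Fintype.sum_option]
    simp only [Option.elim_none, Option.elim_some, mul_assoc]
    rw [← Finset.mul_sum, s.sum_apply]
    ring
  · rw [Splitting.sum_ofFintype, Fintype.sum_option]
    simp only [Option.elim_none, Option.elim_some, mul_assoc, Finset.mul_sum]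

/-- Mixing with the prior brings the information within the smaller capacity; the payoff changes
only with probability `θ`, by at most `2 * B`. -/
lemma splittingValue_le_add_of_mul_le (hμ : ∀ z, μ z ∈ stdSimplex ℝ Ω)
    (hB : ∀ ω a z, |uS ω a z| ≤ B) (hπ : π ∈ stdSimplex ℝ Z) {θ c c' : ℝ} (hθ0 : 0 ≤ θ)
    (hθ1 : θ ≤ 1) (hc : 0 ≤ c) (hc' : 0 ≤ c') (hcc' : (1 - θ) * c' ≤ c) :
    splittingValue uS uR μ (ENNReal.ofReal c') π ≤
      splittingValue uS uR μ (ENNReal.ofReal c) π + 2 * B * θ := by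
  refine splittingValue_le hμ fun s hs => ?_
  choose s' hs' using fun z => exists_mix (hμ z) (s z) hθ0 hθ1
  rw [coe_le_ofReal_iff hc'] at hs
  have h := le_splittingValue (uS := uS) (uR := uR) (c := ENNReal.ofReal c) (π := π) s' (by
    rw [coe_le_ofReal_iff hc]
    refine le_trans (le_of_eq ?_) ((mul_le_mul_of_nonneg_left hs (by linarith : 0 ≤ 1 - θ)).trans
      hcc')
    rw [Finset.mul_sum]
    refine Finset.sum_congr rfl fun z _ => ?_
    rw [Splitting.info, hs' z entropy, Splitting.info]
    ring)
  simp_rw [hs'] at h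
  have h1 : ∑ z, π z * (∑ m, (s z).weight m * robustPayoff uS uR z ((s z).posterior m)) -
      ∑ z, π z * (θ * robustPayoff uS uR z (μ z) +
        (1 - θ) * ∑ m, (s z).weight m * robustPayoff uS uR z ((s z).posterior m)) ≤ 2 * B * θ := by
    rw [← Finset.sum_sub_distrib]
    calc _ ≤ ∑ z, π z * (2 * B * θ) := by
          refine Finset.sum_le_sum fun z _ => ?_
          rw [← mul_sub]
          refine mul_le_mul_of_nonneg_left ?_ (hπ.1 z)
          have e1 := (abs_le.1 (abs_sum_robustPayoff_le (uR := uR) hB z (s z))).2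
          have e2 := (abs_le.1 (abs_robustPayoff_le (z := z) uR hB (hμ z))).1
          nlinarith
      _ = _ := by rw [← Finset.sum_mul, hπ.2, one_mul]
  linarith

/-- Without capacity, the value is the payoff at the priors. -/
lemma splittingValue_zero_le (hμ : ∀ z, μ z ∈ stdSimplex ℝ Ω) (hπ : ∀ z, 0 ≤ π z) :
    splittingValue uS uR μ 0 π ≤ ∑ z, π z * robustPayoff uS uR z (μ z) := by
  refine splittingValue_le hμ fun s hs => ?_
  have hs0 : ∑ z, π z * (s z).info ≤ 0 := by
    have := (coe_le_ofReal_iff (x := ∑ z, π z * (s z).info) le_rfl).1 (by simpa using hs)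
    exact this
  have hinfo : ∀ z, 0 ≤ π z * (s z).info := fun z =>
    mul_nonneg (hπ z) ((s z).info_nonneg (hμ z))
  -- For each type, either its weight or its information vanishes. Zero information forces every
  -- posterior of positive weight to be the prior, by the Hellinger bound.
  have hzero := (Finset.sum_eq_zero_iff_of_nonneg fun z _ => hinfo z).1
    (le_antisymm hs0 (Finset.sum_nonneg fun z _ => hinfo z))
  refine Finset.sum_le_sum fun z hz => ?_
  rcases mul_eq_zero.1 (hzero z hz) with h0 | h0
  · simp [h0]
  refine mul_le_mul_of_nonneg_left (le_of_eq ?_) (hπ z)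
  have hsq := (s z).sum_sq_sqrt_le (hμ z)
  rw [h0, zero_mul] at hsq
  have hnn : ∀ m, 0 ≤ (s z).weight m * ∑ ω, (√((s z).posterior m ω) - √(μ z ω)) ^ 2 := fun m =>
    mul_nonneg ((s z).weight_mem.1 m) (Finset.sum_nonneg fun ω _ => sq_nonneg _)
  have hall := (Finset.sum_eq_zero_iff_of_nonneg fun m _ => hnn m).1
    (le_antisymm hsq (Finset.sum_nonneg fun m _ => hnn m))
  have heq : ∀ m, (s z).weight m * robustPayoff uS uR z ((s z).posterior m) =
      (s z).weight m * robustPayoff uS uR z (μ z) := fun m => by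
    rcases mul_eq_zero.1 (hall m (Finset.mem_univ m)) with hw | hw
    · simp [hw]
    congr 2
    ext ω
    have h1 := (Finset.sum_eq_zero_iff_of_nonneg fun ω _ => sq_nonneg _).1 hw ω (Finset.mem_univ ω)
    exact (Real.sqrt_inj (((s z).posterior_mem m).1 ω) ((hμ z).1 ω)).1
      (sub_eq_zero.1 (pow_eq_zero_iff two_ne_zero |>.1 h1))
  simp_rw [heq]
  rw [← Finset.sum_mul, (s z).weight_mem.2, one_mul]

/-- Near the prior continuity gives the bound; away from it the Hellinger distance is bounded below,
and a large constant outweighs the oscillation of the payoff. -/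
lemma exists_robustPayoff_le_add_mul_sq {z : Z} (hμ : μ z ∈ stdSimplex ℝ Ω)
    (hB : ∀ ω a z, |uS ω a z| ≤ B) (hB0 : 0 ≤ B) {ε : ℝ} (hε : 0 < ε)
    (hcont : ContinuousWithinAt (robustPayoff uS uR z)
      {ν | ν ∈ stdSimplex ℝ Ω ∧ ∀ ω, μ z ω = 0 → ν ω = 0} (μ z)) :
    ∃ K, 0 ≤ K ∧ ∀ ν ∈ stdSimplex ℝ Ω, (∀ ω, μ z ω = 0 → ν ω = 0) →
      robustPayoff uS uR z ν ≤
        robustPayoff uS uR z (μ z) + ε + K * ∑ ω, (√(ν ω) - √(μ z ω)) ^ 2 := by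
  obtain ⟨ρ, hρ, h⟩ := Metric.continuousWithinAt_iff.1 hcont ε hε
  -- At distance at least `ρ` some coordinate has squared Hellinger difference at least `ρ ^ 2 / 4`,
  -- which this constant turns into `2 * B`.
  refine ⟨8 * B / ρ ^ 2, by positivity, fun ν hν hsupp => ?_⟩
  have hsum : ∀ ω, 0 ≤ (√(ν ω) - √(μ z ω)) ^ 2 := fun ω => sq_nonneg _
  have hsum0 : 0 ≤ ∑ ω, (√(ν ω) - √(μ z ω)) ^ 2 := Finset.sum_nonneg fun ω _ => hsum ω
  by_cases hd : dist ν (μ z) < ρ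
  · have h1 := h ⟨hν, hsupp⟩ hd
    rw [Real.dist_eq] at h1
    have h2 := (abs_lt.1 h1).2
    have h3 : 0 ≤ 8 * B / ρ ^ 2 * ∑ ω, (√(ν ω) - √(μ z ω)) ^ 2 := by positivity
    linarith
  · obtain ⟨ω, hω⟩ : ∃ ω, ρ ≤ dist (ν ω) (μ z ω) := by
      by_contra! hlt
      exact hd ((dist_pi_lt_iff hρ).2 hlt)
    rw [Real.dist_eq] at hω
    have hle1 : ∀ {p : Ω → ℝ}, p ∈ stdSimplex ℝ Ω → √(p ω) ≤ 1 := fun {p} hp => by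
      rw [Real.sqrt_le_one]
      rw [← hp.2]
      exact Finset.single_le_sum (fun ω _ => hp.1 ω) (Finset.mem_univ ω)
    have h1 : |ν ω - μ z ω| ≤ 2 * |√(ν ω) - √(μ z ω)| := by
      have e : ν ω - μ z ω = (√(ν ω) + √(μ z ω)) * (√(ν ω) - √(μ z ω)) := by
        nlinarith [Real.mul_self_sqrt (hν.1 ω), Real.mul_self_sqrt (hμ.1 ω)]
      rw [e, abs_mul, abs_of_nonneg (by positivity : 0 ≤ √(ν ω) + √(μ z ω))]
      exact mul_le_mul_of_nonneg_right (by linarith [hle1 hν, hle1 hμ]) (abs_nonneg _)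
    have h2 : ρ ^ 2 ≤ 4 * (√(ν ω) - √(μ z ω)) ^ 2 := by
      rw [← sq_abs (√(ν ω) - √(μ z ω))]
      nlinarith [abs_nonneg (√(ν ω) - √(μ z ω))]
    have h3 : (√(ν ω) - √(μ z ω)) ^ 2 ≤ ∑ ω, (√(ν ω) - √(μ z ω)) ^ 2 :=
      Finset.single_le_sum (fun ω _ => hsum ω) (Finset.mem_univ ω)
    have h4 : 2 * B ≤ 8 * B / ρ ^ 2 * ∑ ω, (√(ν ω) - √(μ z ω)) ^ 2 := by
      rw [div_mul_eq_mul_div, le_div_iff₀ (by positivity)]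
      nlinarith
    have h5 := (abs_le.1 (abs_robustPayoff_le (z := z) uR hB hν)).2
    have h6 := (abs_le.1 (abs_robustPayoff_le (z := z) uR hB hμ)).1
    linarith

/-- If the robust payoff is continuous at the priors, so is the value at capacity zero. -/
lemma exists_splittingValue_le_add (hμ : ∀ z, μ z ∈ stdSimplex ℝ Ω) (hπ : π ∈ stdSimplex ℝ Z)
    (hcont : ∀ z, 0 < π z → ContinuousWithinAt (robustPayoff uS uR z)
      {ν | ν ∈ stdSimplex ℝ Ω ∧ ∀ ω, μ z ω = 0 → ν ω = 0} (μ z)) {ε : ℝ} (hε : 0 < ε) :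
    ∃ c, 0 < c ∧ splittingValue uS uR μ (ENNReal.ofReal c) π ≤
      ∑ z, π z * robustPayoff uS uR z (μ z) + ε := by
  obtain ⟨B, hB0, hB⟩ := exists_abs_payoff_le uS
  have hl2 : 0 < Real.log 2 := Real.log_pos one_lt_two
  have hK : ∀ z, ∃ K, 0 ≤ K ∧ (0 < π z → ∀ ν ∈ stdSimplex ℝ Ω, (∀ ω, μ z ω = 0 → ν ω = 0) →
      robustPayoff uS uR z ν ≤
        robustPayoff uS uR z (μ z) + ε / 2 + K * ∑ ω, (√(ν ω) - √(μ z ω)) ^ 2) := fun z => by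
    by_cases h : 0 < π z
    · obtain ⟨K, hK0, hK⟩ := exists_robustPayoff_le_add_mul_sq (hμ z) hB hB0 (half_pos hε)
        (hcont z h)
      exact ⟨K, hK0, fun _ => hK⟩
    · exact ⟨0, le_rfl, fun h' => absurd h' h⟩
  choose K hK0 hK using hK
  set L := ∑ z, K z with hL
  have hL0 : 0 ≤ L := Finset.sum_nonneg fun z _ => hK0 z
  -- The Hellinger terms then contribute at most `ε / 2`; the `+ 1` covers `L = 0`.
  refine ⟨ε / (2 * (L * Real.log 2 + 1)), by positivity, splittingValue_le hμ fun s hs => ?_⟩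
  rw [coe_le_ofReal_iff (by positivity)] at hs
  have hz : ∀ z, π z * ∑ m, (s z).weight m * robustPayoff uS uR z ((s z).posterior m) ≤
      π z * robustPayoff uS uR z (μ z) + π z * (ε / 2) + L * Real.log 2 * (π z * (s z).info) := by
    intro z
    rcases (hπ.1 z).eq_or_lt with h0 | h0
    · simp [← h0]
    have h1 : ∑ m, (s z).weight m * robustPayoff uS uR z ((s z).posterior m) ≤
        robustPayoff uS uR z (μ z) + ε / 2 + K z * ((s z).info * Real.log 2) := by
      calc _ ≤ ∑ m, (s z).weight m * (robustPayoff uS uR z (μ z) + ε / 2 +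
            K z * ∑ ω, (√((s z).posterior m ω) - √(μ z ω)) ^ 2) := by
            refine Finset.sum_le_sum fun m _ => ?_
            by_cases hm : (s z).weight m = 0
            · simp [hm]
            exact mul_le_mul_of_nonneg_left (hK z h0 _ ((s z).posterior_mem m)
              fun ω hω => (s z).posterior_eq_zero hm hω) ((s z).weight_mem.1 m)
        _ = robustPayoff uS uR z (μ z) + ε / 2 + K z *
            ∑ m, (s z).weight m * ∑ ω, (√((s z).posterior m ω) - √(μ z ω)) ^ 2 := by
            simp_rw [mul_add _ (robustPayoff uS uR z (μ z) + ε / 2)]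
            rw [Finset.sum_add_distrib, ← Finset.sum_mul, (s z).weight_mem.2, one_mul,
              Finset.mul_sum]
            congr 1
            exact Finset.sum_congr rfl fun m _ => by ring
        _ ≤ _ := by
            gcongr
            · exact hK0 z
            · exact (s z).sum_sq_sqrt_le (hμ z)
    have h2 : K z ≤ L := Finset.single_le_sum (fun z _ => hK0 z) (Finset.mem_univ z)
    have h3 : K z * ((s z).info * Real.log 2) ≤ L * ((s z).info * Real.log 2) :=
      mul_le_mul_of_nonneg_right h2 (mul_nonneg ((s z).info_nonneg (hμ z)) hl2.le)
    have h4 := mul_le_mul_of_nonneg_left (h1.trans (add_le_add_right h3 _)) (hπ.1 z)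
    linarith
  have hsum := Finset.sum_le_sum fun z (_ : z ∈ Finset.univ) => hz z
  rw [Finset.sum_add_distrib, Finset.sum_add_distrib, ← Finset.sum_mul, ← Finset.mul_sum, hπ.2,
    one_mul] at hsum
  have hlast : L * Real.log 2 * ∑ z, π z * (s z).info ≤ ε / 2 := by
    calc _ ≤ L * Real.log 2 * (ε / (2 * (L * Real.log 2 + 1))) := by gcongr
      _ = ε / 2 * (L * Real.log 2 / (L * Real.log 2 + 1)) := by field_simp
      _ ≤ ε / 2 * 1 := by
          gcongr
          rw [div_le_one (by positivity)]
          linarith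
      _ = _ := mul_one _
  linarith

end Continuity

/-! ### Strategies from channel codes; typical covers -/

section Achievability

variable {Ω A Z X Y S : Type*} [Fintype Ω] [Fintype A] [Fintype Z] [Fintype X] [Fintype Y]
  [Fintype S]

/-- Splittings of the priors of all types, indexed by the same set `S` of messages. -/
structure SplittingFamily (μ : Z → Ω → ℝ) (S : Type*) [Fintype S] where
  weight : Z → S → ℝ
  posterior : Z → S → Ω → ℝ
  weight_mem : ∀ z, weight z ∈ stdSimplex ℝ S
  posterior_mem : ∀ z s, posterior z s ∈ stdSimplex ℝ Ω
  sum_eq : ∀ z ω, ∑ s, weight z s * posterior z s ω = μ z ω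

/-- Payoff of the sender from the splitting of the prior of type `z`. -/
noncomputable def SplittingFamily.value {μ : Z → Ω → ℝ} (F : SplittingFamily μ S)
    (uS uR : Ω → A → Z → ℝ) (z : Z) : ℝ :=
  ∑ s, F.weight z s * robustPayoff uS uR z (F.posterior z s)

/-- Information of the splitting of the prior of type `z`, for the log-densities `l`. -/
noncomputable def SplittingFamily.info {μ : Z → Ω → ℝ} (F : SplittingFamily μ S)
    (l : Z → S → Ω → ℝ) (z : Z) : ℝ :=
  ∑ s, ∑ ω, F.weight z s * F.posterior z s ω * l z s ω

variable {n k : ℕ} {μ : Z → Ω → ℝ} {Q : X → Y → ℝ} {z : Fin n → Z}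

/-- The strategy that draws an index according to `κ` and sends its codeword. -/
noncomputable def codedStrategy {T : Type*} [Fintype T] (κ : (Fin n → Ω) → T → ℝ)
    (c : T → Fin k → X) (ω : Fin n → Ω) (x : Fin k → X) : ℝ :=
  ∑ i, κ ω i * if x = c i then 1 else 0

lemma codedStrategy_mem {T : Type*} [Fintype T] {κ : (Fin n → Ω) → T → ℝ}
    (hκ : ∀ ω, κ ω ∈ stdSimplex ℝ T) (c : T → Fin k → X) :
    codedStrategy κ c ∈ senderStrategies Ω X n k := fun ω => by
  refine ⟨fun x => Finset.sum_nonneg fun i _ => mul_nonneg ((hκ ω).1 i) ?_, ?_⟩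
  · split_ifs <;> simp
  · simp only [codedStrategy]
    rw [Finset.sum_comm]
    simp [(hκ ω).2]

lemma jointLaw_codedStrategy {T : Type*} [Fintype T] (κ : (Fin n → Ω) → T → ℝ)
    (c : T → Fin k → X) (ω : Fin n → Ω) (y : Fin k → Y) :
    jointLaw μ Q z (codedStrategy κ c) ω y =
      ∑ i, seqPrior μ z ω * κ ω i * seqChannel Q (c i) y := by
  simp only [jointLaw, codedStrategy, Finset.mul_sum, Finset.sum_mul]
  rw [Finset.sum_comm]
  simp

lemma sum_filter_prod {w : Fin n → Ω → ℝ} (hw : ∀ t, ∑ a, w t a = 1) (t : Fin n) (a : Ω) :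
    ∑ ω : Fin n → Ω with ω t = a, ∏ u, w u (ω u) = w t a := by
  have h := sum_pi_prod_mul hw t (fun b => if b = a then 1 else 0)
  simp only [mul_ite, mul_one, mul_zero, Finset.sum_ite_eq', Finset.mem_univ, if_true] at h
  rw [← h, Finset.sum_filter]

lemma sum_error_le {U : Type*} [Fintype U] {p : U → ℝ} (hp : p ∈ stdSimplex ℝ U) {P : U → Prop}
    [DecidablePred P] {ε : ℝ} (h : 1 - ε ≤ ∑ u, p u * if P u then 1 else 0) :
    ∑ u, p u * (if P u then 0 else 1) ≤ ε := by
  have h1 : ∑ u, p u * (if P u then (0 : ℝ) else 1) + ∑ u, p u * (if P u then (1 : ℝ) else 0) =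
      1 := by
    rw [← Finset.sum_add_distrib]
    refine (Finset.sum_congr rfl fun u _ => ?_).trans hp.2
    split_ifs <;> simp
  linarith

lemma sum_abs_sub_le_two {p q : Ω → ℝ} (hp : p ∈ stdSimplex ℝ Ω) (hq : q ∈ stdSimplex ℝ Ω) :
    ∑ a, |p a - q a| ≤ 2 := by
  calc _ ≤ ∑ a, (p a + q a) := Finset.sum_le_sum fun a _ => by
        have h1 := hp.1 a
        have h2 := hq.1 a
        exact abs_le.2 ⟨by linarith, by linarith⟩
    _ = 2 := by rw [Finset.sum_add_distrib, hp.2, hq.2]; norm_num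

/-- Payoff of the strategy that draws the messages and sends them through a channel code. -/
lemma le_optimalRobustPayoff_of_code [Nonempty A] (hμ : ∀ z, μ z ∈ stdSimplex ℝ Ω)
    (hQ : ∀ x, Q x ∈ stdSimplex ℝ Y) (hn : 0 < n) {uS uR : Ω → A → Z → ℝ}
    (F : SplittingFamily μ S) {B K ε : ℝ} (hB : ∀ ω a z, |uS ω a z| ≤ B) (hB0 : 0 ≤ B)
    (hK : ∀ z s, LowerBoundAt uS uR z (F.posterior z s) K) (hK0 : 0 ≤ K)
    (c : (Fin n → S) → Fin k → X) (d : (Fin k → Y) → Fin n → S)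
    (hcd : ∀ m, 1 - ε ≤ ∑ y, seqChannel Q (c m) y * if d y = m then 1 else 0) :
    1 / n * ∑ t, F.value uS uR (z t) - 2 * (B + K) * ε ≤ optimalRobustPayoff uS uR μ Q k z := by
  have hn' : (0 : ℝ) < n := by exact_mod_cast hn
  set L : (Fin n → S) → ℝ := fun m => ∏ t, F.weight (z t) (m t) with hL
  have hLm : L ∈ stdSimplex ℝ (Fin n → S) := prod_mem_stdSimplex fun t => F.weight_mem _
  set N : (Fin n → S) → (Fin n → Ω) → ℝ := fun m ω => ∏ t, F.posterior (z t) (m t) (ω t) with hN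
  have hNm : ∀ m, N m ∈ stdSimplex ℝ (Fin n → Ω) := fun m =>
    prod_mem_stdSimplex fun t => F.posterior_mem _ _
  have hLN : ∀ ω, ∑ m, L m * N m ω = seqPrior μ z ω := fun ω => by
    simp only [hL, hN, ← Finset.prod_mul_distrib]
    rw [sum_pi_prod (fun t s => F.weight (z t) s * F.posterior (z t) s (ω t))]
    exact Finset.prod_congr rfl fun t _ => F.sum_eq _ _
  have hP := seqPrior_mem hμ z
  have hLN0 : ∀ m ω, 0 ≤ L m * N m ω := fun m ω => mul_nonneg (hLm.1 m) ((hNm m).1 ω)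
  -- Bayes' rule: messages are drawn given the states so that, given the messages, the states follow
  -- the product of the posteriors. At states of prior probability zero any law would do.
  set κ : (Fin n → Ω) → (Fin n → S) → ℝ := fun ω m =>
    if seqPrior μ z ω = 0 then L m else L m * N m ω / seqPrior μ z ω with hκ
  have hκm : ∀ ω, κ ω ∈ stdSimplex ℝ (Fin n → S) := fun ω => by
    by_cases h : seqPrior μ z ω = 0
    · simpa [hκ, h] using hLm
    · simp only [hκ, h, if_false]
      exact ⟨fun m => div_nonneg (hLN0 m ω) (hP.1 ω), by rw [← Finset.sum_div, hLN, div_self h]⟩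
  have hPκ : ∀ ω m, seqPrior μ z ω * κ ω m = L m * N m ω := fun ω m => by
    by_cases h : seqPrior μ z ω = 0
    · rw [h, zero_mul]
      have h1 := hLN ω
      rw [h, Finset.sum_eq_zero_iff_of_nonneg fun m _ => hLN0 m ω] at h1
      exact (h1 m (Finset.mem_univ m)).symm
    · simp only [hκ, h, if_false]
      rw [mul_div_cancel₀ _ h]
  have hW : ∀ ω y, jointLaw μ Q z (codedStrategy κ c) ω y =
      ∑ m, L m * N m ω * seqChannel Q (c m) y := fun ω y => by
    rw [jointLaw_codedStrategy]
    simp_rw [hPκ]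
  have hσ := codedStrategy_mem hκm c
  have hWY : ∀ y, ∑ ω, jointLaw μ Q z (codedStrategy κ c) ω y =
      ∑ m, L m * seqChannel Q (c m) y := fun y => by
    simp_rw [hW]
    rw [Finset.sum_comm]
    refine Finset.sum_congr rfl fun m _ => ?_
    rw [← Finset.sum_mul, ← Finset.mul_sum, (hNm m).2, mul_one]
  have hmarg : ∀ t a y, marg (jointLaw μ Q z (codedStrategy κ c)) t a y =
      ∑ m, L m * seqChannel Q (c m) y * F.posterior (z t) (m t) a := fun t a y => by
    simp only [marg, hW]
    rw [Finset.sum_comm]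
    refine Finset.sum_congr rfl fun m _ => ?_
    rw [← Finset.sum_mul, ← Finset.mul_sum,
      sum_filter_prod (w := fun t => F.posterior (z t) (m t))
        (fun t => (F.posterior_mem _ _).2) t a]
    ring
  have hterm0 : ∀ m y, 0 ≤ L m * seqChannel Q (c m) y := fun m y =>
    mul_nonneg (hLm.1 m) ((seqChannel_mem hQ _).1 y)
  -- Both errors below, in beliefs and in payoffs, occur only when decoding fails.
  have herr : ∑ y, ∑ m, L m * seqChannel Q (c m) y * (if d y = m then 0 else 1) ≤ ε := by
    rw [Finset.sum_comm]
    calc _ ≤ ∑ m, L m * ε := by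
          refine Finset.sum_le_sum fun m _ => ?_
          simp_rw [mul_assoc]
          rw [← Finset.mul_sum]
          exact mul_le_mul_of_nonneg_left (sum_error_le (seqChannel_mem hQ _) (hcd m)) (hLm.1 m)
      _ = ε := by rw [← Finset.sum_mul, hLm.2, one_mul]
  have hdist : ∑ t, ∑ y, ∑ a, |marg (jointLaw μ Q z (codedStrategy κ c)) t a y -
      (∑ ω, jointLaw μ Q z (codedStrategy κ c) ω y) * F.posterior (z t) (d y t) a| ≤
      n * (2 * ε) := by
    have h1 : ∀ t, ∑ y, ∑ a, |marg (jointLaw μ Q z (codedStrategy κ c)) t a y -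
        (∑ ω, jointLaw μ Q z (codedStrategy κ c) ω y) * F.posterior (z t) (d y t) a| ≤ 2 * ε := by
      intro t
      refine le_trans (Finset.sum_le_sum fun y _ => ?_)
        (le_trans (le_of_eq (Finset.mul_sum _ _ 2).symm) (mul_le_mul_of_nonneg_left herr zero_le_two))
      calc _ ≤ ∑ a, ∑ m, L m * seqChannel Q (c m) y *
            |F.posterior (z t) (m t) a - F.posterior (z t) (d y t) a| := by
            refine Finset.sum_le_sum fun a _ => ?_
            rw [hmarg, hWY, Finset.sum_mul, ← Finset.sum_sub_distrib]
            refine (Finset.abs_sum_le_sum_abs _ _).trans (Finset.sum_le_sum fun m _ => ?_)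
            rw [← mul_sub, abs_mul, abs_of_nonneg (hterm0 m y)]
        _ ≤ _ := by
            rw [Finset.sum_comm, Finset.mul_sum]
            refine Finset.sum_le_sum fun m _ => ?_
            rw [← Finset.mul_sum, mul_left_comm]
            refine mul_le_mul_of_nonneg_left ?_ (hterm0 m y)
            split_ifs with h
            · simp [h]
            · simpa using sum_abs_sub_le_two (F.posterior_mem _ _) (F.posterior_mem _ _)
    calc _ ≤ ∑ _t : Fin n, 2 * ε := Finset.sum_le_sum fun t _ => h1 t
      _ = _ := by simp
  have hpay : ∑ t, F.value uS uR (z t) - n * (2 * B * ε) ≤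
      ∑ y, (∑ ω, jointLaw μ Q z (codedStrategy κ c) ω y) *
        ∑ t, robustPayoff uS uR (z t) (F.posterior (z t) (d y t)) := by
    have h1 : ∑ y, ∑ m, L m * seqChannel Q (c m) y *
        (∑ t, robustPayoff uS uR (z t) (F.posterior (z t) (m t))) = ∑ t, F.value uS uR (z t) := by
      rw [Finset.sum_comm]
      simp_rw [← Finset.sum_mul, ← Finset.mul_sum, (seqChannel_mem hQ _).2, mul_one]
      exact sum_pi_prod_mul_sum (fun t => (F.weight_mem (z t)).2)
        fun t s => robustPayoff uS uR (z t) (F.posterior (z t) s)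
    have h2 : ∑ y, ∑ m, L m * seqChannel Q (c m) y *
        ((∑ t, robustPayoff uS uR (z t) (F.posterior (z t) (m t))) -
          n * (2 * B) * if d y = m then 0 else 1) ≤
        ∑ y, (∑ ω, jointLaw μ Q z (codedStrategy κ c) ω y) *
          ∑ t, robustPayoff uS uR (z t) (F.posterior (z t) (d y t)) := by
      refine Finset.sum_le_sum fun y _ => ?_
      rw [hWY, Finset.sum_mul]
      refine Finset.sum_le_sum fun m _ => mul_le_mul_of_nonneg_left ?_ (hterm0 m y)
      split_ifs with h
      · simp [h]
      · rw [sub_le_iff_le_add, ← sub_le_iff_le_add', ← Finset.sum_sub_distrib]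
        calc _ ≤ ∑ _t : Fin n, 2 * B := by
              refine Finset.sum_le_sum fun t _ => ?_
              have e1 := (abs_le.1 (abs_robustPayoff_le (z := z t) uR hB
                (F.posterior_mem (z t) (m t)))).2
              have e2 := (abs_le.1 (abs_robustPayoff_le (z := z t) uR hB
                (F.posterior_mem (z t) (d y t)))).1
              linarith
          _ = _ := by simp
    refine le_trans ?_ h2
    simp_rw [mul_sub]
    simp_rw [Finset.sum_sub_distrib]
    rw [h1]
    have h3 : ∑ y, ∑ m, L m * seqChannel Q (c m) y * (n * (2 * B) * if d y = m then 0 else 1) =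
        n * (2 * B) * ∑ y, ∑ m, L m * seqChannel Q (c m) y * (if d y = m then 0 else 1) := by
      simp_rw [Finset.mul_sum]
      exact Finset.sum_congr rfl fun y _ => Finset.sum_congr rfl fun m _ => by ring
    rw [h3]
    have h4 := mul_le_mul_of_nonneg_left herr (by positivity : 0 ≤ (n : ℝ) * (2 * B))
    linarith
  have h := le_optimalRobustPayoff (z := z) hμ hQ hσ hn (uS := uS) (uR := uR)
    (β := fun t y => F.posterior (z t) (d y t)) (K := K) fun t y => hK _ _
  refine le_trans ?_ h
  have h5 := mul_le_mul_of_nonneg_left hdist hK0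
  rw [one_div, inv_mul_eq_div, inv_mul_eq_div, sub_le_iff_le_add, div_add' _ _ _ hn'.ne']
  gcongr
  linarith

/-- With unbounded capacity per problem, every family of splittings can be achieved. -/
lemma eventually_le_optimalRobustPayoff_top [Nonempty A] [Nonempty X]
    (hμ : ∀ z, μ z ∈ stdSimplex ℝ Ω) (hQ : ∀ x, Q x ∈ stdSimplex ℝ Y) (hC : 0 < capacity Q)
    (uS uR : Ω → A → Z → ℝ) (F : SplittingFamily μ S) {k n : ℕ → ℕ} (hn : ∀ j, 0 < n j)
    (z : (j : ℕ) → Fin (n j) → Z) (hkn : Tendsto (fun j => (k j : ℝ) / n j) atTop atTop)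
    {ε : ℝ} (hε : 0 < ε) :
    ∀ᶠ j in atTop, 1 / (n j : ℝ) * ∑ t, F.value uS uR (z j t) - ε ≤
      optimalRobustPayoff uS uR μ Q (k j) (z j) := by
  obtain ⟨B, hB0, hB⟩ := exists_abs_payoff_le uS
  choose K hK0 hK using fun z s => exists_lowerBoundAt uS uR z (F.posterior_mem z s)
  set L := ∑ z, ∑ s, K z s with hL
  have hL0 : 0 ≤ L := Finset.sum_nonneg fun z _ => Finset.sum_nonneg fun s _ => hK0 z s
  have hKL : ∀ z s, LowerBoundAt uS uR z (F.posterior z s) L := fun z s => (hK z s).mono <|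
    (Finset.single_le_sum (fun s _ => hK0 z s) (Finset.mem_univ s)).trans
      (Finset.single_le_sum (f := fun z => ∑ s, K z s)
        (fun z _ => Finset.sum_nonneg fun s _ => hK0 z s) (Finset.mem_univ z))
  have hC' : 0 < capacity Q * Real.log 2 := mul_pos hC (Real.log_pos one_lt_two)
  have hk : Tendsto k atTop atTop := by
    refine (tendsto_natCast_atTop_iff (R := ℝ)).1 (tendsto_atTop_mono (fun j => ?_) hkn)
    exact div_le_self (Nat.cast_nonneg _) (by exact_mod_cast hn j)
  set η := ε / (2 * (B + L) + 1) with hη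
  have hη0 : 0 < η := by positivity
  have hcode := hk.eventually (exists_code hQ (half_lt_self hC') hη0)
  filter_upwards [hcode, hkn.eventually_ge_atTop
    (Real.log (Fintype.card S) / (capacity Q * Real.log 2 / 2))] with j hj hlarge
  have hn' : (0 : ℝ) < n j := by exact_mod_cast hn j
  have hS : Nonempty S := by
    by_contra hS
    rw [not_nonempty_iff] at hS
    have := (F.weight_mem (z j ⟨0, hn j⟩)).2
    simp at this
  -- All message sequences get a codeword: with `k / n` large, their number is below the exponential
  -- of `k` times half the capacity in nats. No covering is used, so `n` need not grow.
  obtain ⟨c, d, hcd⟩ := hj (Fintype.card (Fin (n j) → S)) (by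
    rw [Fintype.card_fun, Fintype.card_fin, Nat.cast_pow]
    have hpos : (0 : ℝ) < Fintype.card S := by exact_mod_cast Fintype.card_pos
    rw [← Real.log_le_log_iff (by positivity) (Real.exp_pos _), Real.log_exp, Real.log_pow]
    rw [div_le_div_iff₀ (by positivity) hn'] at hlarge
    linarith)
  set e := Fintype.equivFin (Fin (n j) → S)
  have m₀ : Fin (n j) → S := fun _ => Classical.arbitrary S
  have h := le_optimalRobustPayoff_of_code (z := z j) hμ hQ (hn j) F hB hB0 hKL hL0 (ε := η)
    (fun m => c (e m)) (fun y => ((d y).map e.symm).getD m₀) (fun m => by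
      refine (hcd (e m)).trans (Finset.sum_le_sum fun y _ => ?_)
      refine mul_le_mul_of_nonneg_left ?_ ((seqChannel_mem hQ _).1 y)
      by_cases hd : d y = some (e m)
      · simp [hd]
      · rw [if_neg hd]
        split_ifs <;> simp)
  refine le_trans ?_ h
  have : 2 * (B + L) * η ≤ ε := by
    rw [hη, mul_div_assoc', div_le_iff₀ (by positivity)]
    nlinarith
  linarith

/-- The messages `m` and the states `ω` are typical for the family of splittings. -/
def Typical {μ : Z → Ω → ℝ} (F : SplittingFamily μ S) (l : Z → S → Ω → ℝ)
    (uS uR : Ω → A → Z → ℝ) (z : Fin n → Z) (δ : ℝ) (m : Fin n → S) (ω : Fin n → Ω) : Prop :=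
  |∑ t, l (z t) (m t) (ω t) - ∑ t, F.info l (z t)| < n * δ ∧
    |∑ t, robustPayoff uS uR (z t) (F.posterior (z t) (m t)) - ∑ t, F.value uS uR (z t)| < n * δ

/-- Chebyshev's inequality for the log-densities and for the robust payoffs, and a union bound. -/
lemma sum_not_typical_le [Nonempty A] (F : SplittingFamily μ S) {l : Z → S → Ω → ℝ}
    {uS uR : Ω → A → Z → ℝ} {B Λ δ : ℝ} (hB : ∀ ω a z, |uS ω a z| ≤ B)
    (hΛ : ∀ z s ω, |l z s ω| ≤ Λ) (hδ : 0 < δ) (hn : 0 < n) (z : Fin n → Z) :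
    ∑ m : Fin n → S, ∑ ω : Fin n → Ω,
      (∏ t, F.weight (z t) (m t) * F.posterior (z t) (m t) (ω t)) *
        (if Typical F l uS uR z δ m ω then 0 else 1) ≤
      4 * Λ ^ 2 / (δ ^ 2 * n) + 4 * B ^ 2 / (δ ^ 2 * n) := by
  set w : Fin n → S × Ω → ℝ := fun t a => F.weight (z t) a.1 * F.posterior (z t) a.1 a.2 with hw
  have hwm : ∀ t, w t ∈ stdSimplex ℝ (S × Ω) := fun t =>
    ⟨fun a => mul_nonneg ((F.weight_mem _).1 _) ((F.posterior_mem _ _).1 _), by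
      simp only [hw, Fintype.sum_prod_type, ← Finset.mul_sum, (F.posterior_mem _ _).2, mul_one,
        (F.weight_mem _).2]⟩
  have h1 := sum_pi_prod_ite_le hn hwm (fun t a => l (z t) a.1 a.2) (fun t a => hΛ _ _ _) hδ
  have h2 := sum_pi_prod_ite_le hn hwm
    (fun t a => robustPayoff uS uR (z t) (F.posterior (z t) a.1))
    (fun t a => abs_robustPayoff_le uR hB (F.posterior_mem _ _)) hδ
  have e1 : ∀ t, ∑ a, w t a * l (z t) a.1 a.2 = F.info l (z t) := fun t => by
    simp only [hw, Fintype.sum_prod_type, SplittingFamily.info]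
  have e2 : ∀ t, ∑ a, w t a * robustPayoff uS uR (z t) (F.posterior (z t) a.1) =
      F.value uS uR (z t) := fun t => by
    simp only [hw, Fintype.sum_prod_type, SplittingFamily.value, ← Finset.sum_mul,
      ← Finset.mul_sum, (F.posterior_mem _ _).2, mul_one]
  simp_rw [e1] at h1
  simp_rw [e2] at h2
  refine le_trans ?_ (add_le_add h1 h2)
  rw [← Finset.sum_add_distrib,
    ← (Equiv.arrowProdEquivProdArrow (Fin n) (fun _ => S) (fun _ => Ω)).symm.sum_comp,
    Fintype.sum_prod_type]
  refine Finset.sum_le_sum fun m _ => Finset.sum_le_sum fun ω _ => ?_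
  simp only [hw, Equiv.arrowProdEquivProdArrow_symm_apply]
  rw [← mul_add]
  refine mul_le_mul_of_nonneg_left ?_ (Finset.prod_nonneg fun t _ =>
    mul_nonneg ((F.weight_mem _).1 _) ((F.posterior_mem _ _).1 _))
  by_cases hT : Typical F l uS uR z δ m ω
  · rw [if_pos hT]
    split_ifs <;> norm_num
  · rw [if_neg hT]
    rw [Typical, not_and_or, not_lt, not_lt] at hT
    rcases hT with h | h
    · rw [if_pos h]; split_ifs <;> norm_num
    · rw [if_pos h]; split_ifs <;> norm_num

/-- Codebooks that cover most of the sequences of states by typical messages. -/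
lemma exists_typical_cover [Nonempty A] (hμ : ∀ z, μ z ∈ stdSimplex ℝ Ω) (F : SplittingFamily μ S)
    {l : Z → S → Ω → ℝ} (hl : ∀ z s ω, F.posterior z s ω = μ z ω * Real.exp (l z s ω))
    (hl0 : ∀ z, 0 ≤ F.info l z) (uS uR : Ω → A → Z → ℝ) {δ ε : ℝ} (hδ : 0 < δ) (hε : 0 < ε) :
    ∀ᶠ n : ℕ in atTop, ∀ z : Fin n → Z, ∃ M : ℕ, 0 < M ∧
      (M : ℝ) ≤ Real.exp (∑ t, F.info l (z t) + n * (3 * δ)) ∧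
      ∃ b : Fin M → Fin n → S,
        ∑ ω, seqPrior μ z ω * (if ∀ j, ¬ Typical F l uS uR z δ (b j) ω then 1 else 0) ≤ ε := by
  obtain ⟨B, hB0, hB⟩ := exists_abs_payoff_le uS
  obtain ⟨Λ, hΛ⟩ : ∃ Λ : ℝ, ∀ z s ω, |l z s ω| ≤ Λ := by
    obtain ⟨Λ, hΛ⟩ := (Set.finite_range fun i : Z × S × Ω => |l i.1 i.2.1 i.2.2|).bddAbove
    exact ⟨Λ, fun z s ω => hΛ ⟨(z, s, ω), rfl⟩⟩
  have hlim : Tendsto (fun n : ℕ => 2 * (4 * Λ ^ 2 / (δ ^ 2 * n) + 4 * B ^ 2 / (δ ^ 2 * n)) +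
      Real.exp (-(Real.exp (δ * n) / 2))) atTop (𝓝 0) := by
    have hn : Tendsto (fun n : ℕ => (n : ℝ)) atTop atTop := tendsto_natCast_atTop_atTop
    have h0 : Tendsto (fun n : ℕ => δ ^ 2 * (n : ℝ)) atTop atTop :=
      hn.const_mul_atTop (by positivity)
    have h1 := ((h0.const_div_atTop (4 * Λ ^ 2)).add (h0.const_div_atTop (4 * B ^ 2))).const_mul 2
    have h2 : Tendsto (fun n : ℕ => Real.exp (-(Real.exp (δ * n) / 2))) atTop (𝓝 0) :=
      Real.tendsto_exp_neg_atTop_nhds_zero.comp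
        ((Real.tendsto_exp_atTop.comp (hn.const_mul_atTop hδ)).atTop_div_const two_pos)
    simpa using h1.add h2
  have hlog : ∀ᶠ n : ℕ in atTop, Real.log 2 ≤ n * δ :=
    (tendsto_natCast_atTop_atTop.atTop_mul_const hδ).eventually_ge_atTop _
  filter_upwards [hlim.eventually (gt_mem_nhds hε), eventually_gt_atTop 0, hlog]
    with n hnε hn hnlog z
  have hn' : (0 : ℝ) < n := by exact_mod_cast hn
  set I := ∑ t, F.info l (z t) with hI
  have hI0 : 0 ≤ I := Finset.sum_nonneg fun t _ => hl0 _
  -- Typical pairs have density at most `exp (I + n * δ)`. The second `n * δ` makes the uncovered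
  -- mass left by the greedy choice doubly exponentially small, and the third one in the bound on
  -- `M` absorbs the rounding.
  set M := ⌈Real.exp (I + n * (2 * δ))⌉₊ with hM
  have hMge : Real.exp (I + n * (2 * δ)) ≤ M := Nat.le_ceil _
  refine ⟨M, Nat.ceil_pos.2 (Real.exp_pos _), ?_, ?_⟩
  · have h1 : (M : ℝ) < Real.exp (I + n * (2 * δ)) + 1 := Nat.ceil_lt_add_one (Real.exp_pos _).le
    have h2 : 1 ≤ Real.exp (I + n * (2 * δ)) := Real.one_le_exp (by positivity)
    have h3 : Real.exp (I + n * (3 * δ)) = Real.exp (I + n * (2 * δ)) * Real.exp (n * δ) := by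
      rw [← Real.exp_add]; congr 1; ring
    have h4 : 2 ≤ Real.exp (n * δ) := by
      rw [← Real.exp_log two_pos]; exact Real.exp_le_exp.2 hnlog
    rw [h3]
    nlinarith
  · obtain ⟨b, hb⟩ := exists_cover
      (J := fun (m : Fin n → S) (ω : Fin n → Ω) =>
        ∏ t, F.weight (z t) (m t) * F.posterior (z t) (m t) (ω t))
      (p := fun m => ∏ t, F.weight (z t) (m t)) (m := seqPrior μ z)
      (good := Typical F l uS uR z δ) (a := Real.exp (I + n * δ))
      (fun m ω => Finset.prod_nonneg fun t _ =>
        mul_nonneg ((F.weight_mem _).1 _) ((F.posterior_mem _ _).1 _))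
      (prod_mem_stdSimplex fun t => F.weight_mem _) (seqPrior_mem hμ z)
      (fun ω => by
        rw [sum_pi_prod (fun t s => F.weight (z t) s * F.posterior (z t) s (ω t))]
        exact Finset.prod_congr rfl fun t _ => F.sum_eq _ _)
      (Real.one_le_exp (by positivity))
      (fun m ω hT => by
        have h1 : ∏ t, F.weight (z t) (m t) * F.posterior (z t) (m t) (ω t) =
            Real.exp (∑ t, l (z t) (m t) (ω t)) *
              ((∏ t, F.weight (z t) (m t)) * seqPrior μ z ω) := by
          rw [Real.exp_sum, seqPrior, ← Finset.prod_mul_distrib, ← Finset.prod_mul_distrib]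
          refine Finset.prod_congr rfl fun t _ => ?_
          rw [hl]; ring
        rw [h1]
        refine mul_le_mul_of_nonneg_right (Real.exp_le_exp.2 ?_)
          (mul_nonneg (Finset.prod_nonneg fun t _ => (F.weight_mem _).1 _)
            ((seqPrior_mem hμ z).1 ω))
        have := (abs_lt.1 hT.1).2
        linarith) M
    refine ⟨b, hb.trans (le_trans (add_le_add (mul_le_mul_of_nonneg_left
      (sum_not_typical_le F hB hΛ hδ hn z) zero_le_two) (Real.exp_le_exp.2 ?_)) hnε.le)⟩
    rw [neg_le_neg_iff, ← div_div, div_right_comm]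
    gcongr
    rw [le_div_iff₀ (Real.exp_pos _), ← Real.exp_add]
    refine le_trans (Real.exp_le_exp.2 (le_of_eq ?_)) hMge
    ring

end Achievability

/-! ### Achievability at finite positive capacity -/

section Covering

variable {Ω A Z X Y S : Type*} [Fintype Ω] [Fintype A] [Fintype Z] [Fintype X] [Fintype Y]
  [Fintype S] {n k : ℕ} {μ : Z → Ω → ℝ} {Q : X → Y → ℝ} {z : Fin n → Z}

lemma SplittingFamily.info_le (F : SplittingFamily μ S) {l : Z → S → Ω → ℝ} {Λ : ℝ}
    (hΛ : ∀ z s ω, |l z s ω| ≤ Λ) (z : Z) : F.info l z ≤ Λ := by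
  have h : ∀ s, |∑ ω, F.posterior z s ω * l z s ω| ≤ Λ := fun s =>
    abs_sum_mul_le_of_mem (F.posterior_mem z s) (hΛ z s)
  have h1 := (abs_le.1 (abs_sum_mul_le_of_mem (F.weight_mem z) h)).2
  simpa only [SplittingFamily.info, Finset.mul_sum, mul_assoc] using h1

lemma SplittingFamily.value_le [Nonempty A] (F : SplittingFamily μ S) {uS : Ω → A → Z → ℝ}
    (uR : Ω → A → Z → ℝ) {B : ℝ} (hB : ∀ ω a z, |uS ω a z| ≤ B) (z : Z) : F.value uS uR z ≤ B :=
  (abs_le.1 (abs_sum_mul_le_of_mem (F.weight_mem z) fun s =>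
    abs_robustPayoff_le uR hB (F.posterior_mem z s))).2

/-- Payoff of the strategy that sends, through a channel code, the index of messages that are
typical with the states. -/
lemma le_optimalRobustPayoff_of_cover [Nonempty A] (hμ : ∀ z, μ z ∈ stdSimplex ℝ Ω)
    (hQ : ∀ x, Q x ∈ stdSimplex ℝ Y) (hn : 0 < n) {uS uR : Ω → A → Z → ℝ}
    (F : SplittingFamily μ S) {l : Z → S → Ω → ℝ}
    (hl : ∀ z s ω, F.posterior z s ω = μ z ω * Real.exp (l z s ω)) {B K Λ δ ε θ : ℝ}
    (hB : ∀ ω a z, |uS ω a z| ≤ B) (hB0 : 0 ≤ B) (hΛ : ∀ z s ω, |l z s ω| ≤ Λ) (hΛ0 : 0 ≤ Λ)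
    (hK : ∀ z s, LowerBoundAt uS uR z (F.posterior z s) K) (hK0 : 0 ≤ K) (hδ : 0 < δ) (hθ : 0 < θ)
    {M : ℕ} (hM0 : 0 < M) (hM : (M : ℝ) ≤ Real.exp (∑ t, F.info l (z t) + n * (3 * δ)))
    (b : Fin M → Fin n → S)
    (hb : ∑ ω, seqPrior μ z ω * (if ∀ j, ¬ Typical F l uS uR z δ (b j) ω then 1 else 0) ≤ ε)
    (c : Fin M → Fin k → X) (d : (Fin k → Y) → Fin M)
    (hcd : ∀ j, 1 - ε ≤ ∑ y, seqChannel Q (c j) y * if d y = j then 1 else 0) :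
    1 / n * ∑ t, F.value uS uR (z t) -
      (δ + 4 * B * ε + K * (1 / (2 * θ) * (4 * δ + 4 * Λ * ε) + 2 * θ)) ≤
      optimalRobustPayoff uS uR μ Q k z := by
  have hn' : (0 : ℝ) < n := by exact_mod_cast hn
  have hM' : (0 : ℝ) < M := by exact_mod_cast hM0
  have hP := seqPrior_mem hμ z
  -- An index of a codeword typical with the states when there is one, and an arbitrary index
  -- otherwise.
  choose J hJ using fun ω : Fin n → Ω => show ∃ j : Fin M,
      (∃ j, Typical F l uS uR z δ (b j) ω) → Typical F l uS uR z δ (b j) ω by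
    by_cases h : ∃ j, Typical F l uS uR z δ (b j) ω
    · obtain ⟨j, hj⟩ := h
      exact ⟨j, fun _ => hj⟩
    · exact ⟨⟨0, hM0⟩, fun h' => absurd h' h⟩
  set κ : (Fin n → Ω) → Fin M → ℝ := fun ω => Pi.single (J ω) 1
  have hσ : codedStrategy κ c ∈ senderStrategies Ω X n k :=
    codedStrategy_mem (fun ω => single_mem_stdSimplex ℝ (J ω)) c
  set W := jointLaw μ Q z (codedStrategy κ c) with hWdef
  have hW : ∀ ω y, W ω y = seqPrior μ z ω * seqChannel Q (c (J ω)) y := fun ω y => by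
    rw [hWdef, jointLaw_codedStrategy, Finset.sum_eq_single (J ω)] <;> simp +contextual [κ]
  have hW0 : ∀ ω y, 0 ≤ W ω y := jointLaw_nonneg hμ hQ hσ
  have hW1 : ∑ y, ∑ ω, W ω y = 1 := sum_sum_jointLaw hμ hQ hσ
  set bad : (Fin n → Ω) → (Fin k → Y) → ℝ := fun ω y =>
    if Typical F l uS uR z δ (b (d y)) ω then 0 else 1 with hbad
  -- One `ε` for decoding errors, one for state sequences that the codebook does not cover.
  have hbadsum : ∑ y, ∑ ω, W ω y * bad ω y ≤ 2 * ε := by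
    have h1 : ∀ y ω, W ω y * bad ω y ≤
        seqPrior μ z ω * seqChannel Q (c (J ω)) y * (if d y = J ω then 0 else 1) +
        seqPrior μ z ω * (if ∀ j, ¬ Typical F l uS uR z δ (b j) ω then 1 else 0) *
          seqChannel Q (c (J ω)) y := fun y ω => by
      have h0 := hW0 ω y
      rw [hW] at h0 ⊢
      have e : bad ω y ≤ (if d y = J ω then 0 else 1) +
          (if ∀ j, ¬ Typical F l uS uR z δ (b j) ω then 1 else 0) := by
        by_cases h2 : ∀ j, ¬ Typical F l uS uR z δ (b j) ω
        · rw [if_pos h2]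
          simp only [hbad]
          split_ifs <;> norm_num
        · rw [if_neg h2]
          push Not at h2
          by_cases h3 : d y = J ω
          · simp only [hbad]
            rw [if_pos h3, h3, if_pos (hJ ω h2)]
            norm_num
          · rw [if_neg h3]
            simp only [hbad]
            split_ifs <;> norm_num
      refine (mul_le_mul_of_nonneg_left e h0).trans (le_of_eq ?_)
      ring
    calc _ ≤ ∑ y, ∑ ω, (seqPrior μ z ω * seqChannel Q (c (J ω)) y *
          (if d y = J ω then 0 else 1) +
        seqPrior μ z ω * (if ∀ j, ¬ Typical F l uS uR z δ (b j) ω then 1 else 0) *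
          seqChannel Q (c (J ω)) y) :=
          Finset.sum_le_sum fun y _ => Finset.sum_le_sum fun ω _ => h1 y ω
      _ = ∑ ω, seqPrior μ z ω *
            (∑ y, seqChannel Q (c (J ω)) y * (if d y = J ω then 0 else 1)) +
          ∑ ω, seqPrior μ z ω * (if ∀ j, ¬ Typical F l uS uR z δ (b j) ω then 1 else 0) := by
          rw [Finset.sum_comm, ← Finset.sum_add_distrib]
          refine Finset.sum_congr rfl fun ω _ => ?_
          rw [Finset.sum_add_distrib, ← Finset.mul_sum _ _ (_ * _), (seqChannel_mem hQ _).2,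
            mul_one, Finset.mul_sum]
          simp_rw [mul_assoc]
      _ ≤ ∑ ω, seqPrior μ z ω * ε + ε := by
          refine add_le_add (Finset.sum_le_sum fun ω _ => ?_) hb
          exact mul_le_mul_of_nonneg_left (sum_error_le (seqChannel_mem hQ _) (hcd (J ω))) (hP.1 ω)
      _ = 2 * ε := by rw [← Finset.sum_mul, hP.2]; ring
  set I := ∑ t, F.info l (z t) with hI
  set ν : Fin n → (Fin k → Y) → Ω → ℝ := fun t y => F.posterior (z t) (b (d y) t) with hν
  -- The output law for a uniform index serves as reference. It dominates every codeword's output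
  -- law up to the factor `M`, so the log-ratio is at most `log M` without knowing the true law of
  -- the index.
  set q : (Fin k → Y) → ℝ := fun y => 1 / M * ∑ j, seqChannel Q (c j) y with hq
  have hqge : ∀ j y, seqChannel Q (c j) y ≤ M * q y := fun j y => by
    simp only [hq]
    rw [← mul_assoc, mul_one_div_cancel hM'.ne', one_mul]
    exact Finset.single_le_sum (f := fun j => seqChannel Q (c j) y)
      (fun j _ => (seqChannel_mem hQ _).1 y) (Finset.mem_univ j)
  have hq0 : ∀ y, 0 ≤ q y := fun y => mul_nonneg (by positivity)
    (Finset.sum_nonneg fun j _ => (seqChannel_mem hQ _).1 y)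
  have hq1 : ∑ y, q y = 1 := by
    simp only [hq]
    rw [← Finset.mul_sum, Finset.sum_comm]
    simp_rw [(seqChannel_mem hQ _).2]
    simp [hM'.ne']
  have hpos : ∀ ω y, W ω y ≠ 0 → 0 < seqPrior μ z ω ∧ 0 < seqChannel Q (c (J ω)) y := by
    intro ω y h
    rw [hW] at h
    exact ⟨lt_of_le_of_ne (hP.1 ω) (left_ne_zero_of_mul h).symm,
      lt_of_le_of_ne ((seqChannel_mem hQ _).1 y) (right_ne_zero_of_mul h).symm⟩
  have hqpos : ∀ ω y, W ω y ≠ 0 → 0 < q y := fun ω y h => by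
    have h1 := (hpos ω y h).2.trans_le (hqge (J ω) y)
    exact pos_of_mul_pos_right h1 hM'.le
  have hprod : ∀ ω y, ∏ t, ν t y (ω t) =
      seqPrior μ z ω * Real.exp (∑ t, l (z t) (b (d y) t) (ω t)) := fun ω y => by
    rw [Real.exp_sum, seqPrior, ← Finset.prod_mul_distrib]
    exact Finset.prod_congr rfl fun t _ => hl _ _ _
  -- The log-ratio is at most `log M` minus the log-density of the decoded messages. With `log M ≤ I
  -- + 3 * n * δ` and typicality, this is at most `4 * n * δ`. A bad pair costs at most `2 * n * Λ`
  -- more and has probability at most `2 * ε`.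
  have hKL : ∑ t, ∑ y, ∑ a, marg W t a y *
      Real.log (marg W t a y / ((∑ ω, W ω y) * ν t y a)) ≤ n * (4 * δ + 4 * Λ * ε) := by
    refine (sum_marg_mul_log_le hW0 hq0 (by rw [hq1, hW1]) (fun ω y h => (hqpos ω y h).ne')
      (fun ω y t h => ?_)).trans ?_
    · have h1 : ∏ t, ν t y (ω t) ≠ 0 := by
        rw [hprod]; exact (mul_pos (hpos ω y h).1 (Real.exp_pos _)).ne'
      exact Finset.prod_ne_zero_iff.1 h1 t (Finset.mem_univ t)
    calc _ ≤ ∑ y, ∑ ω, (W ω y * (n * (4 * δ)) + n * (2 * Λ) * (W ω y * bad ω y)) := by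
          refine Finset.sum_le_sum fun y _ => Finset.sum_le_sum fun ω _ => ?_
          by_cases h : W ω y = 0
          · simp [h]
          obtain ⟨hPpos, hQpos⟩ := hpos ω y h
          have hlog : Real.log (W ω y / (q y * ∏ t, ν t y (ω t))) =
              Real.log (seqChannel Q (c (J ω)) y / q y) -
                ∑ t, l (z t) (b (d y) t) (ω t) := by
            have e : W ω y / (q y * ∏ t, ν t y (ω t)) = seqChannel Q (c (J ω)) y / q y /
                Real.exp (∑ t, l (z t) (b (d y) t) (ω t)) := by
              rw [hW, hprod]
              have := (hqpos ω y h).ne'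
              have := hPpos.ne'
              field_simp
            rw [e, Real.log_div (div_pos hQpos (hqpos ω y h)).ne' (Real.exp_pos _).ne',
              Real.log_exp]
          have h1 : Real.log (seqChannel Q (c (J ω)) y / q y) ≤ I + n * (3 * δ) := by
            rw [Real.log_le_iff_le_exp (div_pos hQpos (hqpos ω y h)), div_le_iff₀ (hqpos ω y h)]
            exact (hqge _ _).trans (mul_le_mul_of_nonneg_right hM (hq0 y))
          have h2 : -∑ t, l (z t) (b (d y) t) (ω t) ≤ -I + n * δ + n * (2 * Λ) * bad ω y := by
            simp only [hbad]
            split_ifs with hT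
            · have := (abs_lt.1 hT.1).1
              linarith
            · have e1 : -∑ t, l (z t) (b (d y) t) (ω t) ≤ n * Λ := by
                rw [← Finset.sum_neg_distrib]
                calc _ ≤ ∑ _t : Fin n, Λ := Finset.sum_le_sum fun t _ =>
                      neg_le.1 (abs_le.1 (hΛ _ _ _)).1
                  _ = _ := by simp
              have e2 : I ≤ n * Λ := by
                calc I ≤ ∑ _t : Fin n, Λ := Finset.sum_le_sum fun t _ => F.info_le hΛ _
                  _ = _ := by simp
              have e3 : 0 < n * δ := by positivity
              linarith
          rw [hlog]
          calc _ ≤ W ω y * (n * (4 * δ) + n * (2 * Λ) * bad ω y) :=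
                mul_le_mul_of_nonneg_left (by linarith) (hW0 ω y)
            _ = _ := by ring
      _ = n * (4 * δ) + n * (2 * Λ) * ∑ y, ∑ ω, W ω y * bad ω y := by
          simp_rw [Finset.sum_add_distrib, ← Finset.sum_mul, ← Finset.mul_sum]
          rw [hW1, one_mul]
      _ ≤ n * (4 * δ) + n * (2 * Λ) * (2 * ε) := by gcongr
      _ = _ := by ring
  have hdist : ∑ t, ∑ y, ∑ a, |marg W t a y - (∑ ω, W ω y) * ν t y a| ≤
      n * (1 / (2 * θ) * (4 * δ + 4 * Λ * ε) + 2 * θ) := by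
    have h1 : ∀ t, ∑ y, ∑ a, |marg W t a y - (∑ ω, W ω y) * ν t y a| ≤
        1 / (2 * θ) * ∑ y, ∑ a, marg W t a y *
          Real.log (marg W t a y / ((∑ ω, W ω y) * ν t y a)) + 2 * θ := by
      intro t
      have hm1 : ∑ y, ∑ a, marg W t a y = 1 := by simp_rw [sum_marg]; exact hW1
      -- Pinsker's inequality for the joint law of the output and of the state of problem `t`.
      have h := sum_abs_sub_le (p := fun i : (Fin k → Y) × Ω => marg W t i.2 i.1)
        (q := fun i => (∑ ω, W ω i.1) * ν t i.1 i.2) (θ := θ)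
        (fun i => marg_nonneg hW0 _ _ _)
        (fun i => mul_nonneg (Finset.sum_nonneg fun ω _ => hW0 ω _) ((F.posterior_mem _ _).1 _))
        (fun i hi => by
          by_contra hne
          obtain ⟨ω, hω, hω0⟩ := Finset.exists_ne_zero_of_sum_ne_zero hne
          rw [Finset.mem_filter] at hω
          have h1 : ∏ t, ν t i.1 (ω t) ≠ 0 := by
            rw [hprod]; exact (mul_pos (hpos ω _ hω0).1 (Real.exp_pos _)).ne'
          have h2 := Finset.prod_ne_zero_iff.1 h1 t (Finset.mem_univ t)
          rw [hω.2] at h2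
          have h3 : 0 < ∑ ω, W ω i.1 := (lt_of_le_of_ne (hW0 ω i.1) hω0.symm).trans_le
            (Finset.single_le_sum (f := fun ω => W ω i.1) (fun ω _ => hW0 ω _)
              (Finset.mem_univ ω))
          exact mul_ne_zero h3.ne' h2 hi)
        (by
          simp_rw [Fintype.sum_prod_type, ← Finset.mul_sum]
          rw [hm1]
          simp_rw [hν, (F.posterior_mem _ _).2, mul_one]
          exact hW1) hθ
      simp_rw [Fintype.sum_prod_type] at h
      rwa [hm1, mul_one] at h
    calc _ ≤ ∑ t, (1 / (2 * θ) * ∑ y, ∑ a, marg W t a y *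
          Real.log (marg W t a y / ((∑ ω, W ω y) * ν t y a)) + 2 * θ) :=
          Finset.sum_le_sum fun t _ => h1 t
      _ = 1 / (2 * θ) * (∑ t, ∑ y, ∑ a, marg W t a y *
          Real.log (marg W t a y / ((∑ ω, W ω y) * ν t y a))) + n * (2 * θ) := by
          rw [Finset.sum_add_distrib, ← Finset.mul_sum]
          simp
      _ ≤ 1 / (2 * θ) * (n * (4 * δ + 4 * Λ * ε)) + n * (2 * θ) := by gcongr
      _ = _ := by ring
  set V := ∑ t, F.value uS uR (z t) with hV
  have hpay : V - n * δ - n * (4 * B * ε) ≤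
      ∑ y, (∑ ω, W ω y) * ∑ t, robustPayoff uS uR (z t) (ν t y) := by
    calc V - n * δ - n * (4 * B * ε)
        = V - n * δ - n * (2 * B) * (2 * ε) := by ring
      _ ≤ V - n * δ - n * (2 * B) * ∑ y, ∑ ω, W ω y * bad ω y := by gcongr
      _ = ∑ y, ∑ ω, (W ω y * (V - n * δ) - n * (2 * B) * (W ω y * bad ω y)) := by
          simp_rw [Finset.sum_sub_distrib, ← Finset.sum_mul, ← Finset.mul_sum]
          rw [hW1, one_mul]
      _ ≤ _ := by
          refine Finset.sum_le_sum fun y _ => ?_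
          rw [Finset.sum_mul]
          refine Finset.sum_le_sum fun ω _ => ?_
          have h1 : V - n * δ - n * (2 * B) * bad ω y ≤
              ∑ t, robustPayoff uS uR (z t) (ν t y) := by
            simp only [hbad]
            split_ifs with hT
            · have := (abs_lt.1 hT.2).1
              linarith
            · have e1 : -(n * B) ≤ ∑ t, robustPayoff uS uR (z t) (ν t y) := by
                calc -(n * B) = ∑ _t : Fin n, -B := by simp
                  _ ≤ _ := Finset.sum_le_sum fun t _ =>
                      (abs_le.1 (abs_robustPayoff_le uR hB (F.posterior_mem _ _))).1
              have e2 : V ≤ n * B := by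
                calc V ≤ ∑ _t : Fin n, B := Finset.sum_le_sum fun t _ => F.value_le uR hB _
                  _ = _ := by simp
              have e3 : 0 < n * δ := by positivity
              linarith
          calc _ = W ω y * (V - n * δ - n * (2 * B) * bad ω y) := by ring
            _ ≤ _ := mul_le_mul_of_nonneg_left h1 (hW0 ω y)
  have h := le_optimalRobustPayoff (z := z) hμ hQ hσ hn (uS := uS) (uR := uR)
    (β := ν) (K := K) fun t y => hK _ _
  refine le_trans ?_ h
  have h5 := mul_le_mul_of_nonneg_left hdist hK0
  rw [one_div, inv_mul_eq_div, inv_mul_eq_div, sub_le_iff_le_add, div_add' _ _ _ hn'.ne']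
  gcongr
  linarith

/-- Families of splittings with information below the capacity can be achieved. -/
lemma eventually_le_optimalRobustPayoff [Nonempty A] [Nonempty X]
    (hμ : ∀ z, μ z ∈ stdSimplex ℝ Ω) (hQ : ∀ x, Q x ∈ stdSimplex ℝ Y)
    (uS uR : Ω → A → Z → ℝ) (F : SplittingFamily μ S) {l : Z → S → Ω → ℝ}
    (hl : ∀ z s ω, F.posterior z s ω = μ z ω * Real.exp (l z s ω)) (hl0 : ∀ z, 0 ≤ F.info l z)
    {k n : ℕ → ℕ} (hn : Tendsto n atTop atTop) (z : (j : ℕ) → Fin (n j) → Z) {π : Z → ℝ} {r : ℝ}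
    (hr : 0 < r) (hkn : Tendsto (fun j => (k j : ℝ) / n j) atTop (𝓝 r))
    (hπ : Tendsto (fun j => empFreq (z j)) atTop (𝓝 π))
    (hinfo : ∑ z, π z * F.info l z < r * (capacity Q * Real.log 2)) {ε : ℝ} (hε : 0 < ε) :
    ∀ᶠ j in atTop, 1 / (n j : ℝ) * ∑ t, F.value uS uR (z j t) - ε ≤
      optimalRobustPayoff uS uR μ Q (k j) (z j) := by
  obtain ⟨B, hB0, hB⟩ := exists_abs_payoff_le uS
  obtain ⟨Λ, hΛ0, hΛ⟩ : ∃ Λ : ℝ, 0 ≤ Λ ∧ ∀ z s ω, |l z s ω| ≤ Λ := by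
    obtain ⟨Λ, hΛ⟩ := (Set.finite_range fun i : Z × S × Ω => |l i.1 i.2.1 i.2.2|).bddAbove
    exact ⟨max Λ 0, le_max_right _ _, fun z s ω => le_max_of_le_left (hΛ ⟨(z, s, ω), rfl⟩)⟩
  choose K hK0 hK using fun z s => exists_lowerBoundAt uS uR z (F.posterior_mem z s)
  set L := ∑ z, ∑ s, K z s with hL
  have hL0 : 0 ≤ L := Finset.sum_nonneg fun z _ => Finset.sum_nonneg fun s _ => hK0 z s
  have hKL : ∀ z s, LowerBoundAt uS uR z (F.posterior z s) L := fun z s => (hK z s).mono <|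
    (Finset.single_le_sum (fun s _ => hK0 z s) (Finset.mem_univ s)).trans
      (Finset.single_le_sum (f := fun z => ∑ s, K z s)
        (fun z _ => Finset.sum_nonneg fun s _ => hK0 z s) (Finset.mem_univ z))
  set G := r * (capacity Q * Real.log 2) - ∑ z, π z * F.info l z with hG
  have hG0 : 0 < G := by rw [hG]; linarith
  -- The coding rate gives up a quarter of the gap `G`. As `δ < G / 8`, the excess `3 * δ` of the
  -- codebook still fits.
  set ρ := capacity Q * Real.log 2 - G / (4 * r) with hρ
  have hρlt : ρ < capacity Q * Real.log 2 := by
    rw [hρ]; linarith [div_pos hG0 (by linarith : 0 < 4 * r)]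
  have hrρ : r * ρ = r * (capacity Q * Real.log 2) - G / 4 := by rw [hρ]; field_simp
  -- `θ` is fixed first, to control the part of Pinsker's bound that does not vanish with `δ`; then
  -- `δ` is small against `θ`. It also serves as the error probability of the code and of the cover.
  set θ := ε / (4 * (L + 1)) with hθ
  have hθ0 : 0 < θ := by positivity
  have hLθ : L * (2 * θ) < ε := by
    rw [hθ]
    have : L * (2 * (ε / (4 * (L + 1)))) = ε * (L / (2 * (L + 1))) := by field_simp; ring
    rw [this]
    have : L / (2 * (L + 1)) < 1 := by rw [div_lt_one (by positivity)]; linarith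
    nlinarith
  obtain ⟨δ, hδ0, hδG, hδε⟩ : ∃ δ, 0 < δ ∧ δ < G / 8 ∧
      δ + 4 * B * δ + L * (1 / (2 * θ) * (4 * δ + 4 * Λ * δ) + 2 * θ) < ε := by
    have hc : ContinuousAt (fun δ : ℝ => δ + 4 * B * δ +
        L * (1 / (2 * θ) * (4 * δ + 4 * Λ * δ) + 2 * θ)) 0 := by fun_prop
    have h1 : ∀ᶠ δ in 𝓝 (0 : ℝ), δ + 4 * B * δ +
        L * (1 / (2 * θ) * (4 * δ + 4 * Λ * δ) + 2 * θ) < ε :=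
      hc.eventually (gt_mem_nhds (by simpa using hLθ))
    have h2 : ∀ᶠ δ in 𝓝 (0 : ℝ), δ < G / 8 := gt_mem_nhds (by positivity)
    have h3 := ((h1.and h2).filter_mono nhdsWithin_le_nhds).and
      (self_mem_nhdsWithin : Set.Ioi (0 : ℝ) ∈ 𝓝[>] 0)
    obtain ⟨δ, ⟨hδ1, hδ2⟩, hδ3⟩ := h3.exists
    exact ⟨δ, hδ3, hδ2, hδ1⟩
  have hk : Tendsto k atTop atTop := by
    refine (tendsto_natCast_atTop_iff (R := ℝ)).1 ?_
    have h1 : Tendsto (fun j => (k j : ℝ) / n j * n j) atTop atTop :=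
      hkn.pos_mul_atTop hr ((tendsto_natCast_atTop_iff (R := ℝ)).2 hn)
    refine tendsto_atTop_mono (fun j => ?_) h1
    rcases eq_or_ne (n j : ℝ) 0 with h0 | h0
    · simp [h0]
    · exact (div_mul_cancel₀ _ h0).le
  have hrate : ∀ᶠ j in atTop, ∑ z₀, empFreq (z j) z₀ * F.info l z₀ + 3 * δ <
      (k j : ℝ) / n j * ρ := by
    have h1 : Tendsto (fun j => ∑ z₀, empFreq (z j) z₀ * F.info l z₀ + 3 * δ) atTop
        (𝓝 (∑ z₀, π z₀ * F.info l z₀ + 3 * δ)) :=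
      (tendsto_finsetSum _ fun z₀ _ => ((tendsto_pi_nhds.1 hπ z₀).mul_const _)).add_const _
    exact h1.eventually_lt (hkn.mul_const ρ) (by rw [hrρ]; linarith)
  filter_upwards [hk.eventually (exists_code hQ hρlt hδ0),
    hn.eventually (exists_typical_cover hμ F hl hl0 uS uR hδ0 hδ0), hrate,
    hn.eventually_gt_atTop 0] with j hcode hcover hj hnj
  have hn' : (0 : ℝ) < n j := by exact_mod_cast hnj
  obtain ⟨M, hM0, hM, b, hb⟩ := hcover (z j)
  obtain ⟨c, d, hcd⟩ := hcode M (by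
    refine hM.trans (Real.exp_le_exp.2 ?_)
    rw [sum_empFreq_mul, one_div, inv_mul_eq_div, div_mul_eq_mul_div, div_add' _ _ _ hn'.ne',
      div_lt_div_iff_of_pos_right hn'] at hj
    linarith)
  have h := le_optimalRobustPayoff_of_cover (z := z j) hμ hQ hnj F hl hB hB0 hΛ hΛ0 hKL hL0 hδ0 hθ0
    hM0 hM b hb c (fun y => (d y).getD ⟨0, hM0⟩) (fun i => by
      refine (hcd i).trans (Finset.sum_le_sum fun y _ => ?_)
      refine mul_le_mul_of_nonneg_left ?_ ((seqChannel_mem hQ _).1 y)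
      by_cases hd : d y = some i
      · simp [hd]
      · rw [if_neg hd]
        split_ifs <;> simp)
  linarith

end Covering

/-! ### Splittings with common messages and supports -/

section Families

variable {Ω A Z S : Type*} [Fintype Ω] [Fintype A] [Fintype Z] [Fintype S] {μ : Z → Ω → ℝ}

/-- Message sequences need one alphabet for all types: take the disjoint union and give messages of
other types weight zero, with the prior as posterior. -/
lemma exists_splittingFamily (hμ : ∀ z, μ z ∈ stdSimplex ℝ Ω) (s : (z : Z) → Splitting (μ z)) :
    ∃ F : SplittingFamily μ (Σ z, Fin (s z).card), ∀ z (f : (Ω → ℝ) → ℝ),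
      ∑ i, F.weight z i * f (F.posterior z i) =
        ∑ m, (s z).weight m * f ((s z).posterior m) := by
  set w : Z → (Σ z, Fin (s z).card) → ℝ := fun z i => if i.1 = z then (s i.1).weight i.2 else 0
    with hw
  set ν : Z → (Σ z, Fin (s z).card) → Ω → ℝ := fun z i =>
    if i.1 = z then (s i.1).posterior i.2 else μ z with hν
  have hsum : ∀ z (f : (Ω → ℝ) → ℝ), ∑ i, w z i * f (ν z i) =
      ∑ m, (s z).weight m * f ((s z).posterior m) := fun z f => by
    rw [Fintype.sum_sigma, Finset.sum_eq_single z]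
    · simp [hw, hν]
    · intro z' _ hz'; simp [hw, hz']
    · simp
  refine ⟨⟨w, ν, fun z => ⟨fun i => ?_, ?_⟩, fun z i => ?_, fun z ω => ?_⟩, hsum⟩
  · simp only [hw]
    split_ifs
    · exact (s i.1).weight_mem.1 _
    · exact le_rfl
  · simpa [(s z).weight_mem.2] using hsum z fun _ => 1
  · simp only [hν]
    split_ifs
    · exact (s i.1).posterior_mem _
    · exact hμ z
  · rw [hsum z fun p => p ω, (s z).sum_apply]

lemma entropy_combination_le {p q : Ω → ℝ} (hp : p ∈ stdSimplex ℝ Ω) (hq : q ∈ stdSimplex ℝ Ω)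
    {η : ℝ} (hη0 : 0 ≤ η) (hη1 : η ≤ 1) :
    (1 - η) * entropy p + η * entropy q ≤ entropy fun ω => (1 - η) * p ω + η * q ω := by
  refine le_of_mul_le_mul_right ?_ (Real.log_pos one_lt_two)
  rw [add_mul, mul_assoc, mul_assoc, entropy_mul_log_two, entropy_mul_log_two,
    entropy_mul_log_two, ← Finset.sum_neg_distrib, ← Finset.sum_neg_distrib,
    ← Finset.sum_neg_distrib, Finset.mul_sum, Finset.mul_sum, ← Finset.sum_add_distrib]
  refine Finset.sum_le_sum fun ω _ => ?_
  have h := Real.concaveOn_negMulLog.2 (hp.1 ω : p ω ∈ Set.Ici (0 : ℝ))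
    (hq.1 ω : q ω ∈ Set.Ici (0 : ℝ)) (by linarith : 0 ≤ 1 - η) hη0 (by ring)
  simp only [Real.negMulLog, smul_eq_mul] at h
  linarith

/-- Applied to a normalized belief, the linear lower bound is a quantitative lower semicontinuity.
Perturbing posteriors can thus lower the payoff only slightly. -/
lemma robustPayoff_sub_le [Nonempty A] {uS uR : Ω → A → Z → ℝ} {z : Z} {ν p : Ω → ℝ} {K : ℝ}
    (h : LowerBoundAt uS uR z ν K) (hp : p ∈ stdSimplex ℝ Ω) :
    robustPayoff uS uR z ν - K * ∑ ω, |p ω - ν ω| ≤ robustPayoff uS uR z p := by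
  obtain ⟨a, ha, hau⟩ := exists_robustPayoff_eq uS uR z p
  have h1 := h p hp.1 a ha
  rw [hp.2] at h1
  simpa [hau] using h1

/-- Mixing the posteriors with the prior makes the information strictly smaller and the supports
equal, at a small cost. -/
lemma exists_perturbed_family [Nonempty A] (hμ : ∀ z, μ z ∈ stdSimplex ℝ Ω)
    (s : (z : Z) → Splitting (μ z)) (uS uR : Ω → A → Z → ℝ) {ε : ℝ} (hε : 0 < ε) :
    ∃ η : ℝ, 0 < η ∧ η ≤ 1 ∧ ∃ (F : SplittingFamily μ (Σ z, Fin (s z).card))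
      (l : Z → (Σ z, Fin (s z).card) → Ω → ℝ),
      (∀ z i ω, F.posterior z i ω = μ z ω * Real.exp (l z i ω)) ∧
      (∀ z, 0 ≤ F.info l z) ∧
      (∀ z, F.info l z ≤ (1 - η) * ((s z).info * Real.log 2)) ∧
      ∀ z, ∑ m, (s z).weight m * robustPayoff uS uR z ((s z).posterior m) - ε ≤
        F.value uS uR z := by
  obtain ⟨F₀, hF₀⟩ := exists_splittingFamily hμ s
  choose K hK0 hK using fun z i => exists_lowerBoundAt uS uR z (F₀.posterior_mem z i)
  set L := ∑ z, ∑ i, K z i with hL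
  have hL0 : 0 ≤ L := Finset.sum_nonneg fun z _ => Finset.sum_nonneg fun s _ => hK0 z s
  have hKL : ∀ z i, LowerBoundAt uS uR z (F₀.posterior z i) L := fun z i => (hK z i).mono <|
    (Finset.single_le_sum (fun s _ => hK0 z s) (Finset.mem_univ i)).trans
      (Finset.single_le_sum (f := fun z => ∑ s, K z s)
        (fun z _ => Finset.sum_nonneg fun s _ => hK0 z s) (Finset.mem_univ z))
  set η := min 1 (ε / (2 * L + 1)) with hη
  have hη0 : 0 < η := lt_min one_pos (by positivity)
  have hη1 : η ≤ 1 := min_le_left _ _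
  have hηε : L * (η * 2) ≤ ε := by
    have h1 : η * (2 * L + 1) ≤ ε := by
      rw [← le_div_iff₀ (by positivity)]; exact min_le_right _ _
    nlinarith
  -- A posterior of weight zero may charge states that the prior excludes and would have no density,
  -- so it is replaced by the prior. The others are supported in the support of the prior, and
  -- mixing makes the supports equal.
  set ν : Z → (Σ z, Fin (s z).card) → Ω → ℝ := fun z i =>
    if F₀.weight z i = 0 then μ z else fun ω => (1 - η) * F₀.posterior z i ω + η * μ z ω with hν
  have hνne : ∀ z i, F₀.weight z i ≠ 0 →
      ν z i = fun ω => (1 - η) * F₀.posterior z i ω + η * μ z ω := fun z i h => if_neg h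
  have hνm : ∀ z i, ν z i ∈ stdSimplex ℝ Ω := fun z i => by
    by_cases h : F₀.weight z i = 0
    · simpa [hν, h] using hμ z
    · rw [hνne z i h]
      refine ⟨fun ω => add_nonneg (mul_nonneg (by linarith) ((F₀.posterior_mem z i).1 ω))
        (mul_nonneg hη0.le ((hμ z).1 ω)), ?_⟩
      rw [Finset.sum_add_distrib, ← Finset.mul_sum, ← Finset.mul_sum, (F₀.posterior_mem z i).2,
        (hμ z).2]
      ring
  have hνsum : ∀ z ω, ∑ i, F₀.weight z i * ν z i ω = μ z ω := fun z ω => by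
    have h1 : ∀ i, F₀.weight z i * ν z i ω = (1 - η) * (F₀.weight z i * F₀.posterior z i ω) +
        η * μ z ω * F₀.weight z i := fun i => by
      by_cases h : F₀.weight z i = 0
      · simp [h]
      · rw [hνne z i h]; ring
    simp_rw [h1]
    rw [Finset.sum_add_distrib, ← Finset.mul_sum, ← Finset.mul_sum, F₀.sum_eq,
      (F₀.weight_mem z).2]
    ring
  set F : SplittingFamily μ (Σ z, Fin (s z).card) := ⟨F₀.weight, ν, F₀.weight_mem, hνm, hνsum⟩
  have hinfo : ∀ z, F.info (fun z i ω => Real.log (ν z i ω / μ z ω)) z =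
      (Splitting.ofFintype (F.weight_mem z) (F.posterior_mem z) (F.sum_eq z)).info *
        Real.log 2 := fun z => by
    rw [Splitting.info, Splitting.sum_ofFintype _ _ _ entropy,
      sum_mul_sum_mul_log_div (F.weight_mem z).1 (fun i => (F.posterior_mem z i).1) (F.sum_eq z)]
    rfl
  refine ⟨η, hη0, hη1, F, fun z i ω => Real.log (ν z i ω / μ z ω), fun z i ω => ?_, fun z => ?_,
    fun z => ?_, fun z => ?_⟩
  · change ν z i ω = _
    rcases ((hμ z).1 ω).eq_or_lt with h0 | h0
    · rw [← h0, zero_mul]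
      by_cases h : F₀.weight z i = 0
      · simp [hν, h, ← h0]
      · have h1 := F₀.sum_eq z ω
        rw [← h0, Finset.sum_eq_zero_iff_of_nonneg fun i _ =>
          mul_nonneg ((F₀.weight_mem z).1 i) ((F₀.posterior_mem z i).1 ω)] at h1
        have h2 := (mul_eq_zero.1 (h1 i (Finset.mem_univ i))).resolve_left h
        simp [hνne z i h, h2, ← h0]
    · have hpos : 0 < ν z i ω := by
        by_cases h : F₀.weight z i = 0
        · simpa [hν, h] using h0
        · rw [hνne z i h]
          exact add_pos_of_nonneg_of_pos
            (mul_nonneg (by linarith) ((F₀.posterior_mem z i).1 ω)) (mul_pos hη0 h0)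
      rw [Real.exp_log (div_pos hpos h0), mul_div_cancel₀ _ h0.ne']
  · rw [hinfo]
    exact mul_nonneg (Splitting.info_nonneg (hμ z) _) (Real.log_pos one_lt_two).le
  · rw [hinfo, ← mul_assoc]
    refine mul_le_mul_of_nonneg_right ?_ (Real.log_pos one_lt_two).le
    rw [Splitting.info, Splitting.sum_ofFintype _ _ _ entropy, Splitting.info, ← hF₀ z entropy]
    -- Concavity of entropy: the mixture loses at least the proportion `η` of the information.
    have h1 : ∑ i, F₀.weight z i * ((1 - η) * entropy (F₀.posterior z i) + η * entropy (μ z)) ≤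
        ∑ i, F₀.weight z i * entropy (ν z i) := by
      refine Finset.sum_le_sum fun i _ => ?_
      by_cases h : F₀.weight z i = 0
      · simp [h]
      · rw [hνne z i h]
        exact mul_le_mul_of_nonneg_left
          (entropy_combination_le (F₀.posterior_mem z i) (hμ z) hη0.le hη1) ((F₀.weight_mem z).1 i)
    have h2 : ∑ i, F₀.weight z i * ((1 - η) * entropy (F₀.posterior z i) + η * entropy (μ z)) =
        (1 - η) * (∑ i, F₀.weight z i * entropy (F₀.posterior z i)) + η * entropy (μ z) := by
      simp_rw [mul_add]
      rw [Finset.sum_add_distrib, ← Finset.sum_mul, (F₀.weight_mem z).2, one_mul, Finset.mul_sum]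
      congr 1
      exact Finset.sum_congr rfl fun i _ => by ring
    change entropy (μ z) - ∑ i, F₀.weight z i * entropy (ν z i) ≤ _
    linarith
  · rw [← hF₀ z (robustPayoff uS uR z), SplittingFamily.value]
    change _ ≤ ∑ i, F₀.weight z i * robustPayoff uS uR z (ν z i)
    have h1 : ∑ i, F₀.weight z i * (robustPayoff uS uR z (F₀.posterior z i) - ε) =
        ∑ i, F₀.weight z i * robustPayoff uS uR z (F₀.posterior z i) - ε := by
      simp_rw [mul_sub]
      rw [Finset.sum_sub_distrib, ← Finset.sum_mul, (F₀.weight_mem z).2, one_mul]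
    rw [← h1]
    refine Finset.sum_le_sum fun i _ => ?_
    by_cases h : F₀.weight z i = 0
    · simp [h]
    refine mul_le_mul_of_nonneg_left ?_ ((F₀.weight_mem z).1 i)
    refine le_trans ?_ (robustPayoff_sub_le (hKL z i) (hνm z i))
    have h2 : ∑ ω, |ν z i ω - F₀.posterior z i ω| ≤ η * 2 := by
      rw [hνne z i h]
      refine le_trans (le_of_eq ?_) (mul_le_mul_of_nonneg_left
        (sum_abs_sub_le_two (hμ z) (F₀.posterior_mem z i)) hη0.le)
      rw [Finset.mul_sum]
      refine Finset.sum_congr rfl fun ω _ => ?_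
      rw [← abs_of_pos hη0, ← abs_mul, abs_of_pos hη0]
      congr 1
      ring
    have h3 := mul_le_mul_of_nonneg_left h2 hL0
    linarith

end Families

/-! ### The three limit regimes -/

section Limit

variable {Ω A Z X Y : Type*} [Fintype Ω] [Fintype A] [Fintype Z] [Fintype X] [Fintype Y]
  [Nonempty A] [Nonempty X] {μ : Z → Ω → ℝ} {Q : X → Y → ℝ} {π : Z → ℝ}
  {k n : ℕ → ℕ} {z : (j : ℕ) → Fin (n j) → Z}

lemma exists_lt_splitting (hμ : ∀ z, μ z ∈ stdSimplex ℝ Ω) (uS uR : Ω → A → Z → ℝ) (c : ℝ≥0∞)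
    (π : Z → ℝ) {ε : ℝ} (hε : 0 < ε) :
    ∃ s : (z : Z) → Splitting (μ z), ((∑ z, π z * (s z).info : ℝ) : EReal) ≤ (c : EReal) ∧
      splittingValue uS uR μ c π - ε <
        ∑ z, π z * ∑ m, (s z).weight m * robustPayoff uS uR z ((s z).posterior m) := by
  by_contra! h
  have := splittingValue_le (uS := uS) (uR := uR) (c := c) (π := π) hμ h
  linarith

lemma tendsto_sum_empFreq (hπ : Tendsto (fun j => empFreq (z j)) atTop (𝓝 π)) (f : Z → ℝ) :
    Tendsto (fun j => 1 / (n j : ℝ) * ∑ t, f (z j t)) atTop (𝓝 (∑ z₀, π z₀ * f z₀)) := by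
  simp_rw [← sum_empFreq_mul]
  exact tendsto_finsetSum _ fun z₀ _ => (tendsto_pi_nhds.1 hπ z₀).mul_const _

lemma tendsto_sum_abs_empFreq (hπ : Tendsto (fun j => empFreq (z j)) atTop (𝓝 π)) (B : ℝ) :
    Tendsto (fun j => B * ∑ z₀, |empFreq (z j) z₀ - π z₀|) atTop (𝓝 0) := by
  have h : Tendsto (fun j => B * ∑ z₀, |empFreq (z j) z₀ - π z₀|) atTop
      (𝓝 (B * ∑ z₀, |π z₀ - π z₀|)) :=
    (tendsto_finsetSum _ fun z₀ _ => ((tendsto_pi_nhds.1 hπ z₀).sub_const _).abs).const_mul _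
  simpa using h

/-- The comparison is multiplicative, as the transfer of feasibility requires. It is trivial at
types of limit frequency zero, whose empirical frequencies may stay positive. -/
lemma eventually_le_mul_empFreq (hπ0 : ∀ z, 0 ≤ π z)
    (hπ : Tendsto (fun j => empFreq (z j)) atTop (𝓝 π)) {δ : ℝ} (hδ : 0 < δ) :
    ∀ᶠ j in atTop, ∀ z₀, π z₀ ≤ (1 + δ) * empFreq (z j) z₀ := by
  rw [eventually_all]
  intro z₀
  rcases (hπ0 z₀).eq_or_lt with h0 | h0
  · refine Eventually.of_forall fun j => ?_
    rw [← h0]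
    exact mul_nonneg (by linarith) (by unfold empFreq; positivity)
  · have h1 := (tendsto_pi_nhds.1 hπ z₀).const_mul (1 + δ)
    exact (h1.eventually (lt_mem_nhds (by nlinarith : π z₀ < (1 + δ) * π z₀))).mono
      fun j hj => hj.le

lemma natCast_div_mul_ofReal (k : ℕ) {n : ℕ} (hn : 0 < n) (C : ℝ) :
    (k : ℝ≥0∞) / (n : ℝ≥0∞) * ENNReal.ofReal C = ENNReal.ofReal (k / n * C) := by
  have hn' : (0 : ℝ) < n := by exact_mod_cast hn
  rw [ENNReal.ofReal_mul (by positivity), ENNReal.ofReal_div_of_pos hn']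
  simp

lemma optimalRobustPayoff_le_ofReal (hμ : ∀ z, μ z ∈ stdSimplex ℝ Ω)
    (hQ : ∀ x, Q x ∈ stdSimplex ℝ Y) (hn : ∀ j, 0 < n j) (uS uR : Ω → A → Z → ℝ) (j : ℕ) :
    optimalRobustPayoff uS uR μ Q (k j) (z j) ≤
      splittingValue uS uR μ (ENNReal.ofReal ((k j : ℝ) / n j * capacity Q)) (empFreq (z j)) := by
  rw [← natCast_div_mul_ofReal (k j) (hn j)]
  exact optimalRobustPayoff_le_splittingValue hμ hQ (hn j) uS uR (k j) (z j)

/-- Convergence when the limit capacity is zero. -/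
lemma tendsto_optimalRobustPayoff_zero (hμ : ∀ z, μ z ∈ stdSimplex ℝ Ω)
    (hQ : ∀ x, Q x ∈ stdSimplex ℝ Y) (hn : ∀ j, 0 < n j) (uS uR : Ω → A → Z → ℝ)
    (hπm : π ∈ stdSimplex ℝ Z) (hπ : Tendsto (fun j => empFreq (z j)) atTop (𝓝 π))
    (h : capacity Q = 0 ∨ (Tendsto (fun j => (k j : ℝ) / n j) atTop (𝓝 0) ∧
      ∀ z, 0 < π z → ContinuousWithinAt (robustPayoff uS uR z)
        {ν | ν ∈ stdSimplex ℝ Ω ∧ ∀ ω, μ z ω = 0 → ν ω = 0} (μ z))) :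
    Tendsto (fun j => optimalRobustPayoff uS uR μ Q (k j) (z j)) atTop
      (𝓝 (splittingValue uS uR μ 0 π)) := by
  obtain ⟨B, hB0, hB⟩ := exists_abs_payoff_le uS
  have hC := capacity_nonneg Q
  have hV : splittingValue uS uR μ 0 π = ∑ z, π z * robustPayoff uS uR z (μ z) := by
    refine le_antisymm (splittingValue_zero_le hμ hπm.1) ?_
    refine le_trans (le_of_eq ?_) (le_splittingValue (fun z => Splitting.trivial (hμ z)) ?_)
    · exact Finset.sum_congr rfl fun z _ => by rw [Splitting.sum_trivial]
    · simp [Splitting.info_trivial]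
  have hlow := tendsto_sum_empFreq hπ fun z₀ => robustPayoff uS uR z₀ (μ z₀)
  -- The factor `1 + 1` is the slack `1 + δ` at `δ = 1`: doubling is harmless when the capacities
  -- are zero or tend to zero.
  have hc : ∀ ε > 0, ∃ c ≥ 0, (∀ᶠ j in atTop, (1 + 1) * ((k j : ℝ) / n j * capacity Q) ≤ c) ∧
      splittingValue uS uR μ (ENNReal.ofReal c) π ≤
        ∑ z, π z * robustPayoff uS uR z (μ z) + ε := by
    intro ε hε
    rcases h with hC0 | ⟨hkn, hcont⟩
    · refine ⟨0, le_rfl, Eventually.of_forall fun j => by simp [hC0], ?_⟩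
      rw [ENNReal.ofReal_zero, hV]
      linarith
    · obtain ⟨c, hc0, hcV⟩ := exists_splittingValue_le_add hμ hπm hcont hε
      refine ⟨c, hc0.le, ?_, hcV⟩
      have h1 := (hkn.mul_const (capacity Q)).const_mul (1 + 1 : ℝ)
      simp only [zero_mul, mul_zero] at h1
      exact (h1.eventually (gt_mem_nhds hc0)).mono fun j hj => hj.le
  rw [hV]
  refine tendsto_order.2 ⟨fun a ha => ?_, fun a ha => ?_⟩
  · filter_upwards [hlow.eventually (lt_mem_nhds ha)] with j hj
    exact hj.trans_le (sum_robustPayoff_prior_le hμ hQ (hn j) uS uR)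
  · set ε := (a - ∑ z, π z * robustPayoff uS uR z (μ z)) / 2 with hε
    have hε0 : 0 < ε := by rw [hε]; linarith
    obtain ⟨c, -, hcj, hcV⟩ := hc ε hε0
    filter_upwards [hcj, eventually_le_mul_empFreq hπm.1 hπ one_pos,
      (tendsto_sum_abs_empFreq hπ B).eventually (gt_mem_nhds hε0)] with j h1 h2 h3
    have h4 := splittingValue_le_add (uR := uR) hμ hB zero_le_one
      (mul_nonneg (by positivity) hC) h1 h2
    have h5 := optimalRobustPayoff_le_ofReal (k := k) (z := z) hμ hQ hn uS uR j
    linarith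

/-- Convergence when the limit capacity is infinite. -/
lemma tendsto_optimalRobustPayoff_top (hμ : ∀ z, μ z ∈ stdSimplex ℝ Ω)
    (hQ : ∀ x, Q x ∈ stdSimplex ℝ Y) (hn : ∀ j, 0 < n j) (uS uR : Ω → A → Z → ℝ)
    (hπ : Tendsto (fun j => empFreq (z j)) atTop (𝓝 π)) (hC : 0 < capacity Q)
    (hkn : Tendsto (fun j => (k j : ℝ) / n j) atTop atTop) :
    Tendsto (fun j => optimalRobustPayoff uS uR μ Q (k j) (z j)) atTop
      (𝓝 (splittingValue uS uR μ ⊤ π)) := by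
  obtain ⟨B, hB0, hB⟩ := exists_abs_payoff_le uS
  refine tendsto_order.2 ⟨fun a ha => ?_, fun a ha => ?_⟩
  · set ε := (splittingValue uS uR μ ⊤ π - a) / 2 with hε
    have hε0 : 0 < ε := by rw [hε]; linarith
    obtain ⟨s, -, hs⟩ := exists_lt_splitting hμ uS uR ⊤ π hε0
    obtain ⟨F, hF⟩ := exists_splittingFamily hμ s
    simp_rw [← hF] at hs
    have hlim := tendsto_sum_empFreq hπ (F.value uS uR)
    have hlt : splittingValue uS uR μ ⊤ π - ε < ∑ z₀, π z₀ * F.value uS uR z₀ := hs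
    filter_upwards [hlim.eventually (lt_mem_nhds hlt),
      eventually_le_optimalRobustPayoff_top hμ hQ hC uS uR F hn z hkn hε0] with j h1 h2
    linarith
  · have h1 := (tendsto_sum_abs_empFreq hπ B).const_add (splittingValue uS uR μ ⊤ π)
    rw [add_zero] at h1
    filter_upwards [h1.eventually (gt_mem_nhds ha)] with j hj
    exact ((optimalRobustPayoff_le_ofReal hμ hQ hn uS uR j).trans
      (splittingValue_le_top hμ hB _)).trans_lt hj

/-- Convergence when the limit capacity is positive and finite. -/
lemma tendsto_optimalRobustPayoff (hμ : ∀ z, μ z ∈ stdSimplex ℝ Ω)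
    (hQ : ∀ x, Q x ∈ stdSimplex ℝ Y) (hn : ∀ j, 0 < n j) (uS uR : Ω → A → Z → ℝ)
    (hπm : π ∈ stdSimplex ℝ Z) (hπ : Tendsto (fun j => empFreq (z j)) atTop (𝓝 π))
    (hC : 0 < capacity Q) {r : ℝ} (hr : 0 < r) (hnt : Tendsto n atTop atTop)
    (hkn : Tendsto (fun j => (k j : ℝ) / n j) atTop (𝓝 r)) :
    Tendsto (fun j => optimalRobustPayoff uS uR μ Q (k j) (z j)) atTop
      (𝓝 (splittingValue uS uR μ (ENNReal.ofReal (r * capacity Q)) π)) := by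
  obtain ⟨B, hB0, hB⟩ := exists_abs_payoff_le uS
  have hl2 : 0 < Real.log 2 := Real.log_pos one_lt_two
  have hc0 : 0 < r * capacity Q := mul_pos hr hC
  set V := splittingValue uS uR μ (ENNReal.ofReal (r * capacity Q)) π with hV
  refine tendsto_order.2 ⟨fun a ha => ?_, fun a ha => ?_⟩
  · set ε := (V - a) / 3 with hε
    have hε0 : 0 < ε := by rw [hε]; linarith
    obtain ⟨s, hs, hsV⟩ := exists_lt_splitting hμ uS uR (ENNReal.ofReal (r * capacity Q)) π hε0
    rw [coe_le_ofReal_iff hc0.le] at hs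
    -- A splitting that exhausts the capacity cannot be coded directly; the perturbation makes its
    -- information strictly smaller, because `r * capacity Q` is positive.
    obtain ⟨η, hη0, hη1, F, l, hl, hl0, hinfo, hval⟩ := exists_perturbed_family hμ s uS uR hε0
    have hlt : ∑ z, π z * F.info l z < r * (capacity Q * Real.log 2) := by
      calc _ ≤ ∑ z, π z * ((1 - η) * ((s z).info * Real.log 2)) :=
            Finset.sum_le_sum fun z _ => mul_le_mul_of_nonneg_left (hinfo z) (hπm.1 z)
        _ = (1 - η) * ((∑ z, π z * (s z).info) * Real.log 2) := by
            rw [Finset.sum_mul, Finset.mul_sum]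
            exact Finset.sum_congr rfl fun z _ => by ring
        _ ≤ (1 - η) * (r * capacity Q * Real.log 2) :=
            mul_le_mul_of_nonneg_left (mul_le_mul_of_nonneg_right hs hl2.le) (by linarith)
        _ < r * (capacity Q * Real.log 2) := by nlinarith [mul_pos hc0 hl2]
    have hvalsum : V - 2 * ε < ∑ z, π z * F.value uS uR z := by
      have h1 := Finset.sum_le_sum fun z (_ : z ∈ Finset.univ) =>
        mul_le_mul_of_nonneg_left (hval z) (hπm.1 z)
      simp_rw [mul_sub] at h1
      rw [Finset.sum_sub_distrib, ← Finset.sum_mul, hπm.2, one_mul] at h1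
      linarith
    filter_upwards [(tendsto_sum_empFreq hπ (F.value uS uR)).eventually (lt_mem_nhds hvalsum),
      eventually_le_optimalRobustPayoff hμ hQ uS uR F hl hl0 hnt z hr hkn hπ hlt hε0] with j h1 h2
    linarith
  · set ε := (a - V) / 2 with hε
    have hε0 : 0 < ε := by rw [hε]; linarith
    set θ := min (1 / 2) (ε / (2 * B + 1)) with hθ
    have hθ0 : 0 < θ := lt_min (by norm_num) (by positivity)
    have hθ1 : θ ≤ 1 / 2 := min_le_left _ _
    have hθε : 2 * B * θ ≤ ε := by
      have h1 : θ * (2 * B + 1) ≤ ε := by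
        rw [← le_div_iff₀ (by positivity)]; exact min_le_right _ _
      nlinarith
    -- Since `(1 + θ) * (1 - θ) < 1`, this leaves room for the factor `1 + θ` from the type
    -- frequencies and for the convergence of `k / n`, while mixing with weight `θ` leads back to
    -- the limit capacity.
    set c' := r * capacity Q / (1 - θ) with hc'
    have hcc' : (1 - θ) * c' = r * capacity Q := by
      rw [hc', mul_div_cancel₀]
      linarith
    have hc'0 : 0 ≤ c' := div_nonneg hc0.le (by linarith)
    have hlt : (1 + θ) * (r * capacity Q) < c' := by
      rw [hc', lt_div_iff₀ (by linarith)]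
      nlinarith [mul_pos hc0 (mul_pos hθ0 hθ0)]
    have h1 := splittingValue_le_add_of_mul_le (uR := uR) hμ hB hπm hθ0.le (by linarith) hc0.le
      hc'0 hcc'.le
    filter_upwards [((hkn.mul_const (capacity Q)).const_mul (1 + θ)).eventually (gt_mem_nhds hlt),
      eventually_le_mul_empFreq hπm.1 hπ hθ0,
      (tendsto_sum_abs_empFreq hπ B).eventually (gt_mem_nhds hε0)] with j h2 h3 h4
    have h5 := splittingValue_le_add (uR := uR) hμ hB hθ0.le
      (mul_nonneg (by positivity) hC.le) h2.le h3
    have h6 := optimalRobustPayoff_le_ofReal (k := k) (z := z) hμ hQ hn uS uR j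
    linarith

end Limit

end Persuasion

theorem theorem2 {Ω A Z X Y : Type*}
    [Fintype Ω] [Fintype A] [Fintype Z] [Fintype X] [Fintype Y] [Nonempty A] [Nonempty X]
    (μ : Z → Ω → ℝ) (hμ : ∀ z, μ z ∈ stdSimplex ℝ Ω)
    (uS uR : Ω → A → Z → ℝ)
    (Q : X → Y → ℝ) (hQ : ∀ x, Q x ∈ stdSimplex ℝ Y) :
    (∀ (n k : ℕ), 0 < n → ∀ z : Fin n → Z,
      Persuasion.optimalRobustPayoff uS uR μ Q k z ≤
        Persuasion.splittingValue uS uR μ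
          ((k : ℝ≥0∞) / (n : ℝ≥0∞) * ENNReal.ofReal (Persuasion.capacity Q))
          (Persuasion.empFreq z)) ∧
    (∀ (π : Z → ℝ), π ∈ stdSimplex ℝ Z → ∀ (r : ℝ≥0∞),
      -- only for `r = 0` and positive capacity: continuity of the robust payoff at the priors
      (r = 0 → 0 < Persuasion.capacity Q → ∀ z, 0 < π z →
        ContinuousWithinAt (Persuasion.robustPayoff uS uR z)
          {ν | ν ∈ stdSimplex ℝ Ω ∧ ∀ ω, μ z ω = 0 → ν ω = 0} (μ z)) →
      ∀ (k n : ℕ → ℕ), (∀ j, 0 < n j) → ∀ z : (j : ℕ) → Fin (n j) → Z,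
        Tendsto (fun j => max (n j) (k j)) atTop atTop →
        Tendsto (fun j => (k j : ℝ≥0∞) / (n j : ℝ≥0∞)) atTop (𝓝 r) →
        Tendsto (fun j => Persuasion.empFreq (z j)) atTop (𝓝 π) →
        Tendsto (fun j => Persuasion.optimalRobustPayoff uS uR μ Q (k j) (z j)) atTop
          (𝓝 (Persuasion.splittingValue uS uR μ
            (r * ENNReal.ofReal (Persuasion.capacity Q)) π))) := by
  refine ⟨fun n k hn z =>
    Persuasion.optimalRobustPayoff_le_splittingValue hμ hQ hn uS uR k z, ?_⟩
  intro π hπm r hcont k n hn z hmax hkn hπ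
  have hkn_eq : ∀ j, (k j : ℝ≥0∞) / (n j : ℝ≥0∞) = ENNReal.ofReal ((k j : ℝ) / n j) := fun j => by
    simpa using Persuasion.natCast_div_mul_ofReal (k j) (hn j) 1
  simp_rw [hkn_eq] at hkn
  -- Zero capacity is treated first: it covers every `r`, including `⊤ * 0 = 0`, and needs no
  -- continuity.
  rcases (Persuasion.capacity_nonneg Q).eq_or_lt with hC | hC
  · rw [← hC, ENNReal.ofReal_zero, mul_zero]
    exact Persuasion.tendsto_optimalRobustPayoff_zero hμ hQ hn uS uR hπm hπ (Or.inl hC.symm)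
  rcases eq_or_ne r ⊤ with rfl | hr
  · rw [ENNReal.top_mul (by simpa using hC)]
    exact Persuasion.tendsto_optimalRobustPayoff_top hμ hQ hn uS uR hπ hC
      (ENNReal.tendsto_ofReal_nhds_top.1 hkn)
  have hkn' : Tendsto (fun j => (k j : ℝ) / n j) atTop (𝓝 r.toReal) := by
    refine ((ENNReal.tendsto_toReal hr).comp hkn).congr fun j => ?_
    exact ENNReal.toReal_ofReal (by positivity)
  rcases eq_or_ne r 0 with rfl | hr0
  · rw [zero_mul]
    exact Persuasion.tendsto_optimalRobustPayoff_zero hμ hQ hn uS uR hπm hπ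
      (Or.inr ⟨by simpa using hkn', hcont rfl hC⟩)
  have hrpos : 0 < r.toReal := ENNReal.toReal_pos hr0 hr
  have hnt : Tendsto n atTop atTop := by
    rw [← tendsto_natCast_atTop_iff (R := ℝ)]
    -- Eventually `k ≤ (r + 1) * n`, so the maximum is at most `(r + 2) * n` and its divergence
    -- forces `n` to diverge.
    have h1 : Tendsto (fun j => ((max (n j) (k j) : ℕ) : ℝ) / (r.toReal + 2)) atTop atTop :=
      ((tendsto_natCast_atTop_iff (R := ℝ)).2 hmax).atTop_div_const (by linarith)
    refine tendsto_atTop_mono' _ ?_ h1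
    filter_upwards [hkn'.eventually (gt_mem_nhds (lt_add_one r.toReal))] with j hj
    have hn' : (0 : ℝ) < n j := by exact_mod_cast hn j
    rw [div_lt_iff₀ hn'] at hj
    rw [div_le_iff₀ (by linarith), Nat.cast_max]
    exact max_le (by nlinarith) (by nlinarith)
  have h := Persuasion.tendsto_optimalRobustPayoff hμ hQ hn uS uR hπm hπ hC hrpos hnt hkn'
  rwa [ENNReal.ofReal_mul hrpos.le, ENNReal.ofReal_toReal hr] at h
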